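/- Let $\Sigma$ be a complete nonsingular fan in $N_{\mathbb R}$, $N\cong\mathbb Z^n$, whose toric variety $X_\Sigma$ over $\mathbb C$ is projective; let $M=N^\vee$, let $\Sigma(1)$ be the set of rays (identified with their integral generators), $\Sigma_{\max}$ the set of maximal cones, and $D_\rho$ the toric divisor of $\rho\in\Sigma(1)$. A ($k$-pointed) toric quasimap to $X_\Sigma$ consists of a connected, at most nodal projective curve $C$ over $\mathbb C$ with $k$ distinct nonsingular marked points $p_1,\dots,p_k$, line bundles $L_\rho$ on $C$ with sections $u_\rho\in\Gamma(C,L_\rho)$ for $\rho\in\Sigma(1)$, and isomorphisms $\phi_m:\bigotimes_\rho L_\rho^{\otimes\langle\rho,m\rangle}\to\mathcal O_C$ for $m\in M$ with $\phi_m\otimes\phi_{m'}=\phi_{m+m'}$, such that there is a finite set $B\subset C$ of nonsingular, non-marked points for which every $y\in C\setminus B$ admits some $\sigma\in\Sigma_{\max}$ with $u_\rho(y)\neq0$ for all $\rho\not\subset\sigma$. It is stable with respect to a polarization (ample line bundle) $\mathcal O_{X_\Sigma}(1)=\bigotimes_\rho\mathcal O(D_\rho)^{\alpha_\rho}$ if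 $\omega_C(p_1+\dots+p_k)\otimes\mathcal L^{\epsilon}$, $\mathcal L=\bigotimes_\rho L_\rho^{\otimes\alpha_\rho}$, is ample for every rational $\epsilon>0$. For every toric quasimap (in particular for every stable one) and every irreducible component $C'$ of $C$: (1) there is a unique class $\beta_{C'}\in H_2(X_\Sigma,\mathbb Z)=\mathrm{Hom}(\mathrm{Pic}(X_\Sigma),\mathbb Z)$ with $\beta_{C'}\cdot D_\rho=\deg(L_\rho|_{C'})$ for all $\rho\in\Sigma(1)$, and it is effective, i.e. the class of an effective $1$-cycle (more precisely, it is a sum of finitely many classes of torus-invariant curves, possibly none and possibly with repetitions); in particular $\int_{\beta_{C'}}c_1(P)\ge 0$ for every ample line bundle $P$ on $X_\Sigma$, with equality if and only if $\beta_{C'}=0$; (2) $\beta_{C'}=0$ if and only if every $u_\rho$ is constant on $C'$, i.e. for every $\rho$ some isomorphism $L_\rho|_{C'}\cong\mathcal O_{C'}$ takes $u_\rho|_{C'}$ to a constant function. Consequently, stability does not depend on the polarization: a toric quasimap that is stable with respect to one polarization of $X_\Sigma$ is stable with respect to every other one. -/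

import Mathlib

open CategoryTheory AlgebraicGeometry TopologicalSpace

namespace ToricQM

noncomputable section

/-! ### Smooth complete fans and the toric data they determine -/

/-- A complete nonsingular fan `Σ` in `N_ℝ = ℝⁿ`, `N = ℤⁿ`. The type `ι` is the set of rays `Σ(1)`,
`gen ρ` is the integral generator of the ray `ρ`, and a maximal cone is recorded by its set of rays.
All other cones of the fan are the faces of the maximal ones. -/
structure Fan (n : ℕ) (ι : Type) [Fintype ι] [DecidableEq ι] where
  gen : ι → Fin n → ℤ
  maxCones : Set (Finset ι)
  /-- every ray lies on a maximal cone -/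
  ray_mem : ∀ ρ, ∃ σ ∈ maxCones, ρ ∈ σ
  /-- nonsingular: the generators of a maximal cone form a `ℤ`-basis of `N` -/
  linInd : ∀ σ ∈ maxCones, LinearIndependent ℤ (fun ρ : σ => gen ρ)
  span_top : ∀ σ ∈ maxCones, Submodule.span ℤ (gen '' σ) = ⊤
  /-- complete: the maximal cones cover `N_ℝ` -/
  complete : ∀ v : Fin n → ℝ, ∃ σ ∈ maxCones, ∃ c : ι → ℝ, (∀ ρ, 0 ≤ c ρ) ∧
    v = ∑ ρ ∈ σ, c ρ • (fun j => (gen ρ j : ℝ))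
  /-- two cones meet along a common face -/
  inter_face : ∀ σ ∈ maxCones, ∀ σ' ∈ maxCones, ∀ c c' : ι → ℝ,
    (∀ ρ, 0 ≤ c ρ) → (∀ ρ, 0 ≤ c' ρ) →
    ∑ ρ ∈ σ, c ρ • (fun j => (gen ρ j : ℝ)) = ∑ ρ ∈ σ', c' ρ • (fun j => (gen ρ j : ℝ)) →
    ∃ c'' : ι → ℝ, (∀ ρ, 0 ≤ c'' ρ) ∧
      ∑ ρ ∈ σ, c ρ • (fun j => (gen ρ j : ℝ)) =
        ∑ ρ ∈ σ ∩ σ', c'' ρ • (fun j => (gen ρ j : ℝ))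

namespace Fan

variable {n : ℕ} {ι : Type} [Fintype ι] [DecidableEq ι] (F : Fan n ι)

/-- The pairing `⟨ρ, m⟩` of (the generator of) a ray with an element of `M = ℤⁿ`. -/
def pairing (ρ : ι) (m : Fin n → ℤ) : ℤ := F.gen ρ ⬝ᵥ m

/-- The map `M → ℤ^{Σ(1)}`, `m ↦ ∑_ρ ⟨m, ρ⟩ D_ρ`. -/
def divMap : (Fin n → ℤ) →ₗ[ℤ] (ι → ℤ) := (Matrix.of F.gen).mulVecLin

/-- `Pic(X_Σ)`, the cokernel of `M → ℤ^{Σ(1)}`. -/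
abbrev Pic : Type := (ι → ℤ) ⧸ LinearMap.range F.divMap

/-- The class of the line bundle `𝒪(∑_ρ α_ρ D_ρ)`. -/
def lineClass (α : ι → ℤ) : F.Pic := Submodule.Quotient.mk α

/-- The class of `𝒪(D_ρ)`. -/
def D (ρ : ι) : F.Pic := F.lineClass (Pi.single ρ 1)

/-- `𝒪(∑_ρ α_ρ D_ρ)` is ample: the support function, which on each maximal cone `σ` is the linear
form `m` with `⟨m, ρ⟩ = -α_ρ` for `ρ ⊂ σ`, is strictly convex. -/
def IsAmple (α : ι → ℤ) : Prop :=
  ∀ σ ∈ F.maxCones, ∃ m : Fin n → ℤ,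
    (∀ ρ ∈ σ, F.pairing ρ m = -α ρ) ∧ ∀ ρ ∉ σ, -α ρ < F.pairing ρ m

/-- `X_Σ` is projective. -/
def IsProjective : Prop := ∃ α, F.IsAmple α

/-- `H₂(X_Σ, ℤ)`, identified with `Hom(Pic(X_Σ), ℤ)` by the intersection pairing (Poincaré
duality). -/
abbrev H2 : Type := F.Pic →ₗ[ℤ] ℤ

/-- `c` is the class of the torus invariant curve `V(τ)` of a wall `τ = σ ∩ σ'`, where the maximal
cones `σ, σ'` are spanned by `τ` and one further ray `ρ`, resp. `ρ'`: the curve meets `D_ρ` and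
`D_ρ'` transversally in one point each and does not meet `D_κ` for `κ ⊄ σ ∪ σ'`. (The `D_κ` with
`κ ⊄ σ` generate the Picard group, so this determines the class.) -/
def IsInvariantCurveClass (c : F.H2) : Prop :=
  ∃ σ ∈ F.maxCones, ∃ σ' ∈ F.maxCones, ∃ ρ ∈ σ, ∃ ρ' ∈ σ',
    ρ ∉ σ' ∧ ρ' ∉ σ ∧ σ.erase ρ = σ'.erase ρ' ∧
    c (F.D ρ) = 1 ∧ c (F.D ρ') = 1 ∧ ∀ κ, κ ∉ σ → κ ∉ σ' → c (F.D κ) = 0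

/-- Effective curve classes: classes of effective `1`-cycles, i.e. finite sums of
classes of torus invariant curves. -/
def IsEffective (β : F.H2) : Prop :=
  β ∈ AddSubmonoid.closure {c : F.H2 | F.IsInvariantCurveClass c}

end Fan

/-! ### Line bundles on schemes -/

/-- Restriction of functions. -/
def res (X : Scheme.{0}) {U V : X.Opens} (h : V ≤ U) : Γ(X, U) →+* Γ(X, V) :=
  (X.presheaf.map (homOfLE h).op).hom

theorem res_res (X : Scheme.{0}) {U V W : X.Opens} (h : V ≤ U) (h' : W ≤ V) (f : Γ(X, U)) :
    res X h' (res X h f) = res X (h'.trans h) f := by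
  simp only [res]
  rw [← CommRingCat.comp_apply, ← Functor.map_comp]
  rfl

/-- Restriction of invertible functions. -/
def resUnits (X : Scheme.{0}) {U V : X.Opens} (h : V ≤ U) : (Γ(X, U))ˣ →* (Γ(X, V))ˣ :=
  Units.map (res X h).toMonoidHom

theorem resUnits_val (X : Scheme.{0}) {U V : X.Opens} (h : V ≤ U) (f : (Γ(X, U))ˣ) :
    (resUnits X h f : Γ(X, V)) = res X h f := rfl

/-- A line bundle, given by a trivialization on an open neighbourhood `U x` of each point and the
transition functions `g x y` between them: a section has components `s x` on `U x` with
`s x = g x y * s y`. -/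
structure LineBundle (X : Scheme.{0}) where
  U : X → X.Opens
  mem : ∀ x, x ∈ U x
  g : ∀ x y, (Γ(X, U x ⊓ U y))ˣ
  cocycle : ∀ x y z (V : X.Opens) (hxy : V ≤ U x ⊓ U y) (hyz : V ≤ U y ⊓ U z)
    (hxz : V ≤ U x ⊓ U z), res X hxy (g x y) * res X hyz (g y z) = res X hxz (g x z)

namespace LineBundle

variable {X : Scheme.{0}}

/-- Global sections of a line bundle. -/
structure Sec (L : LineBundle X) where
  val : ∀ x, Γ(X, L.U x)
  compat : ∀ x y, res X inf_le_left (val x) = (L.g x y : Γ(X, L.U x ⊓ L.U y)) *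
    res X inf_le_right (val y)

/-- The open set where a section does not vanish. -/
def Sec.nonvanishing {L : LineBundle X} (s : L.Sec) : X.Opens := ⨆ x, X.basicOpen (s.val x)

/-- Isomorphisms `L ≅ 𝒪_X`; a section `s` corresponds to the function which is `val x * s x` on
`U x`. -/
structure Triv (L : LineBundle X) where
  val : ∀ x, (Γ(X, L.U x))ˣ
  compat : ∀ x y, res X inf_le_left (val x : Γ(X, L.U x)) * (L.g x y : Γ(X, L.U x ⊓ L.U y)) =
    res X inf_le_right (val y : Γ(X, L.U y))

/-- Tensor powers, `n ∈ ℤ`. -/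
def zpow (L : LineBundle X) (n : ℤ) : LineBundle X where
  U := L.U
  mem := L.mem
  g x y := L.g x y ^ n
  cocycle x y z V hxy hyz hxz := by
    have key : resUnits X hxy (L.g x y) * resUnits X hyz (L.g y z) = resUnits X hxz (L.g x z) := by
      ext
      exact L.cocycle x y z V hxy hyz hxz
    have h2 : resUnits X hxy (L.g x y ^ n) * resUnits X hyz (L.g y z ^ n) =
        resUnits X hxz (L.g x z ^ n) := by
      rw [map_zpow, map_zpow, map_zpow, ← mul_zpow, key]
    exact congrArg Units.val h2

/-- The tensor product of two line bundles. -/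
def tensor (L M : LineBundle X) : LineBundle X where
  U x := L.U x ⊓ M.U x
  mem x := ⟨L.mem x, M.mem x⟩
  g x y := resUnits X (inf_le_inf inf_le_left inf_le_left) (L.g x y) *
    resUnits X (inf_le_inf inf_le_right inf_le_right) (M.g x y)
  cocycle x y z V hxy hyz hxz := by
    have h1 := L.cocycle x y z V (hxy.trans (inf_le_inf inf_le_left inf_le_left))
      (hyz.trans (inf_le_inf inf_le_left inf_le_left))
      (hxz.trans (inf_le_inf inf_le_left inf_le_left))
    have h2 := M.cocycle x y z V (hxy.trans (inf_le_inf inf_le_right inf_le_right))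
      (hyz.trans (inf_le_inf inf_le_right inf_le_right))
      (hxz.trans (inf_le_inf inf_le_right inf_le_right))
    simp only [Units.val_mul, resUnits_val, map_mul, res_res]
    rw [← h1, ← h2]
    ring

/-- A common trivializing neighbourhood of `x` for finitely many line bundles. -/
def commonU {ι : Type} [Fintype ι] (L : ι → LineBundle X) (x : X) : X.Opens :=
  Finset.univ.inf fun ρ => (L ρ).U x

theorem commonU_le {ι : Type} [Fintype ι] (L : ι → LineBundle X) (x : X) (ρ : ι) :
    commonU L x ≤ (L ρ).U x :=
  Finset.inf_le (f := fun ρ => (L ρ).U x) (Finset.mem_univ ρ)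

/-- The tensor product `⊗_ρ L_ρ^{a_ρ}` of a finite family of line bundles. -/
def prod {ι : Type} [Fintype ι] (L : ι → LineBundle X) (a : ι → ℤ) : LineBundle X where
  U := commonU L
  mem x := by
    change x ∈ ((Finset.univ.inf fun ρ => (L ρ).U x : X.Opens) : Set X)
    rw [Opens.coe_finset_inf]
    simp [Finset.inf_eq_iInf, (L _).mem x]
  g x y := ∏ ρ, resUnits X (inf_le_inf (commonU_le L x ρ) (commonU_le L y ρ)) (L ρ |>.g x y) ^ a ρ
  cocycle x y z V hxy hyz hxz := by
    have h2 : resUnits X hxy (∏ ρ, resUnits X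
          (inf_le_inf (commonU_le L x ρ) (commonU_le L y ρ)) (L ρ |>.g x y) ^ a ρ) *
        resUnits X hyz (∏ ρ, resUnits X
          (inf_le_inf (commonU_le L y ρ) (commonU_le L z ρ)) (L ρ |>.g y z) ^ a ρ) =
        resUnits X hxz (∏ ρ, resUnits X
          (inf_le_inf (commonU_le L x ρ) (commonU_le L z ρ)) (L ρ |>.g x z) ^ a ρ) := by
      simp only [map_prod, map_zpow]
      rw [← Finset.prod_mul_distrib]
      refine Finset.prod_congr rfl fun ρ _ => ?_
      rw [← mul_zpow]
      congr 1
      ext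
      simp only [Units.val_mul, resUnits_val, res_res]
      exact (L ρ).cocycle x y z V _ _ _
    exact congrArg Units.val h2

/-- The components of a trivialization of `⊗_ρ L_ρ^{a_ρ}`, on open sets independent of `a`. -/
def Triv.unit {ι : Type} [Fintype ι] {L : ι → LineBundle X} {a : ι → ℤ} (h : (prod L a).Triv)
    (x : X) : (Γ(X, commonU L x))ˣ := h.val x

/-- The pullback of functions along `f`. -/
def pull {Y : Scheme.{0}} (f : Y ⟶ X) (A : X.Opens) (V : Y.Opens) (h : V ≤ f ⁻¹ᵁ A) :
    Γ(X, A) →+* Γ(Y, V) := (f.appLE A V h).hom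

theorem pull_res {Y : Scheme.{0}} (f : Y ⟶ X) {A B : X.Opens} (V : Y.Opens) (hBA : B ≤ A)
    (h : V ≤ f ⁻¹ᵁ B) (t : Γ(X, A)) :
    pull f B V h (res X hBA t) = pull f A V (h.trans (f.preimage_mono hBA)) t := by
  simp only [pull, res]
  rw [← CommRingCat.comp_apply, Scheme.Hom.map_appLE]

theorem res_pull {Y : Scheme.{0}} (f : Y ⟶ X) (A : X.Opens) {V W : Y.Opens} (hWV : W ≤ V)
    (h : V ≤ f ⁻¹ᵁ A) (t : Γ(X, A)) :
    res Y hWV (pull f A V h t) = pull f A W (hWV.trans h) t := by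
  simp only [pull, res]
  rw [← CommRingCat.comp_apply, Scheme.Hom.appLE_map]

theorem preimage_inf_le {Y : Scheme.{0}} (f : Y ⟶ X) (A B : X.Opens) :
    f ⁻¹ᵁ A ⊓ f ⁻¹ᵁ B ≤ f ⁻¹ᵁ (A ⊓ B) := fun _ h => h

/-- The pullback of a line bundle. -/
def pullback {Y : Scheme.{0}} (f : Y ⟶ X) (L : LineBundle X) : LineBundle Y where
  U y := f ⁻¹ᵁ L.U (f y)
  mem y := L.mem (f y)
  g y z := Units.map (pull f (L.U (f y) ⊓ L.U (f z)) (f ⁻¹ᵁ L.U (f y) ⊓ f ⁻¹ᵁ L.U (f z))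
    (preimage_inf_le f _ _)).toMonoidHom (L.g (f y) (f z))
  cocycle x y z V hxy hyz hxz := by
    have h := L.cocycle (f x) (f y) (f z) (L.U (f x) ⊓ L.U (f y) ⊓ L.U (f z))
      inf_le_left (le_inf (inf_le_left.trans inf_le_right) inf_le_right)
      (le_inf (inf_le_left.trans inf_le_left) inf_le_right)
    have hV : V ≤ f ⁻¹ᵁ (L.U (f x) ⊓ L.U (f y) ⊓ L.U (f z)) :=
      fun p hp => ⟨hxy hp, (hyz hp).2⟩
    have h' := congrArg (pull f _ V hV) h
    rw [map_mul, pull_res, pull_res, pull_res] at h'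
    exact (congrArg₂ (· * ·) (res_pull f _ hxy (preimage_inf_le f _ _) _)
      (res_pull f _ hyz (preimage_inf_le f _ _) _)).trans
        (h'.trans (res_pull f _ hxz (preimage_inf_le f _ _) _).symm)

/-- The pullback of a section. -/
def Sec.pullback {Y : Scheme.{0}} (f : Y ⟶ X) {L : LineBundle X} (s : L.Sec) :
    (L.pullback f).Sec where
  val y := pull f (L.U (f y)) (f ⁻¹ᵁ L.U (f y)) le_rfl (s.val (f y))
  compat y z := by
    have h := congrArg (pull f _ (f ⁻¹ᵁ L.U (f y) ⊓ f ⁻¹ᵁ L.U (f z)) (preimage_inf_le f _ _))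
      (s.compat (f y) (f z))
    rw [map_mul, pull_res, pull_res] at h
    exact (res_pull f _ inf_le_left le_rfl _).trans
      (h.trans (congrArg₂ (· * ·) rfl (res_pull f _ inf_le_right le_rfl _).symm))

/-- `L` is ample: `X` is quasi-compact and every point lies in some affine `X_s`, for a section `s`
of a positive power of `L`. -/
def IsAmple (L : LineBundle X) : Prop :=
  CompactSpace X ∧ ∀ x : X, ∃ n : ℕ, 1 ≤ n ∧ ∃ s : (L.zpow n).Sec,
    x ∈ s.nonvanishing ∧ IsAffineOpen s.nonvanishing

/-- The `ℚ`-line bundle `A ⊗ L^ε` is ample, i.e. its multiple `A^b ⊗ L^a` is, where `ε = a / b`. -/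
def IsAmpleTwist (A L : LineBundle X) (ε : ℚ) : Prop :=
  ((A.zpow ε.den).tensor (L.zpow ε.num)).IsAmple

/-- The degree of a line bundle on an integral projective curve over `ℂ`: the degree of the divisor
of the rational section which is `1` in the given frame at the generic point `ξ` (in the frame at
`z`, this rational section is the function `g z ξ`). -/
def degree [IsIntegral X] [IsLocallyNoetherian X] (L : LineBundle X) : ℤ :=
  ∑ᶠ z : X, Scheme.ord (X := X) (X.presheaf.germ (L.U z ⊓ L.U (genericPoint X)) (genericPoint X)
    ⟨((genericPoint_spec X).mem_open_set_iff (L.U z).isOpen).mpr ⟨z, trivial, L.mem z⟩,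
      L.mem _⟩ (L.g z (genericPoint X))) z

end LineBundle

/-! ### Pointed nodal curves over `ℂ` -/

/-- Constant functions on a scheme over `ℂ`. -/
def const {X : Scheme.{0}} (π : X ⟶ Spec (.of ℂ)) (V : X.Opens) : ℂ →+* Γ(X, V) :=
  (res X le_top).comp (π.appTop.hom.comp (Scheme.ΓSpecIso (.of ℂ)).inv.hom)

/-- A section of `L` is constant if some isomorphism `L ≅ 𝒪_X` takes it to a constant function. -/
def IsConstant {X : Scheme.{0}} (π : X ⟶ Spec (.of ℂ)) {L : LineBundle X} (s : L.Sec) : Prop :=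
  ∃ (h : L.Triv) (c : ℂ), ∀ x, (h.val x : Γ(X, L.U x)) * s.val x = const π (L.U x) c

/-- The curve is nonsingular at the closed point `p`. -/
def IsSmoothPt (X : Scheme.{0}) (p : X) : Prop :=
  ∃ _ : IsDomain (X.presheaf.stalk p), IsDiscreteValuationRing (X.presheaf.stalk p)

/-- The closed point `p` is a node: the completed local ring is `ℂ⟦x, y⟧ / (xy)`. -/
def IsNode (X : Scheme.{0}) (p : X) : Prop :=
  Nonempty (AdicCompletion (IsLocalRing.maximalIdeal (X.presheaf.stalk p)) (X.presheaf.stalk p) ≃+*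
    (MvPowerSeries (Fin 2) ℂ ⧸
      Ideal.span {(MvPowerSeries.X 0 * MvPowerSeries.X 1 : MvPowerSeries (Fin 2) ℂ)}))

/-- Connected, at most nodal, `k`-pointed projective curves over `ℂ`. (A proper curve is
projective.) -/
structure PointedNodalCurve (k : ℕ) where
  C : Scheme.{0}
  π : C ⟶ Spec (.of ℂ)
  proper : IsProper π
  connected : ConnectedSpace C
  nodal : ∀ p : C, IsClosed {p} → IsSmoothPt C p ∨ IsNode C p
  pt : Fin k → C
  pt_injective : Function.Injective pt
  pt_closed : ∀ i, IsClosed {pt i}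
  pt_smooth : ∀ i, IsSmoothPt C (pt i)

/-- `P ≅ 𝒪(p)`: the line bundle `P` has a section whose zero scheme is the reduced point `p`. -/
def IsPointBundle {X : Scheme.{0}} (p : X) (P : LineBundle X) : Prop :=
  ∃ s : P.Sec, (∀ y, y ≠ p → y ∈ s.nonvanishing) ∧
    Ideal.span {X.presheaf.germ (P.U p) p (P.mem p) (s.val p)} =
      IsLocalRing.maximalIdeal (X.presheaf.stalk p)

/-- A `ℂ`-derivation `𝒪_X → ω`; `d x V` gives its component in the frame of `ω` at `x`. -/
structure DerivationTo {X : Scheme.{0}} (π : X ⟶ Spec (.of ℂ)) (ω : LineBundle X) where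
  d : ∀ (x : X) (V : X.Opens), V ≤ ω.U x → Γ(X, V) →+ Γ(X, V)
  leibniz : ∀ x V hV f g, d x V hV (f * g) = f * d x V hV g + g * d x V hV f
  d_const : ∀ x V hV c, d x V hV (const π V c) = 0
  d_res : ∀ x V hV W (hW : W ≤ V) f, d x W (hW.trans hV) (res X hW f) = res X hW (d x V hV f)
  d_frame : ∀ x y V (hx : V ≤ ω.U x) (hy : V ≤ ω.U y) f,
    d x V hx f = res X (le_inf hx hy) (ω.g x y : Γ(X, ω.U x ⊓ ω.U y)) * d y V hy f

/-- `ω` is the dualizing sheaf of a nodal curve: there is a derivation `d : 𝒪 → ω` (equivalently a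
map `Ω → ω`) which identifies `ω` with the Kähler differentials at nonsingular points, while at a
node with branches `x = 0` and `y = 0`, `ω` has the generator `η = dx / x = - dy / y`, that is,
differentials with at most simple poles on the branches, and opposite residues. (The branch
coordinates are approximated by elements `x, y` of the local ring with `xy ∈ 𝔪³`, and `dx = x η`,
`dy = - y η` hold modulo `𝔪²`; this is the same condition as for coordinates of the completion
with `xy = 0`.) -/
def IsDualizing {X : Scheme.{0}} (π : X ⟶ Spec (.of ℂ)) (ω : LineBundle X) : Prop :=
  ∃ δ : DerivationTo π ω,
    (∀ p : X, IsClosed {p} → IsSmoothPt X p →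
      ∃ (V : X.Opens) (hp : p ∈ V) (hV : V ≤ ω.U p) (f : Γ(X, V)),
        IsUnit (X.presheaf.germ V p hp (δ.d p V hV f))) ∧
    (∀ p : X, IsClosed {p} → IsNode X p →
      ∃ (V : X.Opens) (hp : p ∈ V) (hV : V ≤ ω.U p) (x y : Γ(X, V))
        (η : X.presheaf.stalk p), IsUnit η ∧
        Ideal.span {X.presheaf.germ V p hp x, X.presheaf.germ V p hp y} =
          IsLocalRing.maximalIdeal (X.presheaf.stalk p) ∧
        X.presheaf.germ V p hp x * X.presheaf.germ V p hp y ∈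
          IsLocalRing.maximalIdeal (X.presheaf.stalk p) ^ 3 ∧
        X.presheaf.germ V p hp (δ.d p V hV x) - η * X.presheaf.germ V p hp x ∈
          IsLocalRing.maximalIdeal (X.presheaf.stalk p) ^ 2 ∧
        X.presheaf.germ V p hp (δ.d p V hV y) + η * X.presheaf.germ V p hp y ∈
          IsLocalRing.maximalIdeal (X.presheaf.stalk p) ^ 2)

/-! ### Toric quasimaps -/

/-- Pointed toric quasimaps to `X_Σ` (satisfying nondegeneracy; stability is imposed separately). -/
structure ToricQuasimap {n : ℕ} {ι : Type} [Fintype ι] [DecidableEq ι] (F : Fan n ι) (k : ℕ)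
    extends PointedNodalCurve k where
  L : ι → LineBundle C
  u : ∀ ρ, (L ρ).Sec
  φ : ∀ m : Fin n → ℤ, (LineBundle.prod L fun ρ => F.pairing ρ m).Triv
  /-- `φ_m ⊗ φ_{m'} = φ_{m + m'}` -/
  φ_add : ∀ m m' x, (φ m).unit x * (φ m').unit x = (φ (m + m')).unit x
  nondegenerate : ∃ B : Set C, B.Finite ∧ (∀ b ∈ B, IsClosed {b} ∧ IsSmoothPt C b) ∧
    (∀ i, pt i ∉ B) ∧
    ∀ y ∉ B, ∃ σ ∈ F.maxCones, ∀ ρ ∉ σ, y ∈ (u ρ).nonvanishing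

/-- Stability with respect to `𝒪_{X_Σ}(1) = ⊗_ρ 𝒪(D_ρ)^{α_ρ}`: the `ℚ`-line bundle
`ω_C(p₁ + ⋯ + p_k) ⊗ 𝓛^ε`, `𝓛 = ⊗_ρ L_ρ^{α_ρ}`, is ample for every rational `ε > 0`. -/
def ToricQuasimap.IsStable {n : ℕ} {ι : Type} [Fintype ι] [DecidableEq ι] {F : Fan n ι} {k : ℕ}
    (Q : ToricQuasimap F k) (α : ι → ℤ) : Prop :=
  ∃ (ω : LineBundle Q.C) (P : Fin k → LineBundle Q.C),
    IsDualizing Q.π ω ∧ (∀ i, IsPointBundle (Q.pt i) (P i)) ∧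
    ∀ ε : ℚ, 0 < ε →
      (ω.tensor (LineBundle.prod P fun _ => 1)).IsAmpleTwist (LineBundle.prod Q.L α) ε

/-- `β` is the class `β_{C'}` of the curve `C'` over `C`: the homomorphism `Pic(X_Σ) → ℤ` with
`β · D_ρ = deg(L_ρ|_{C'})`. -/
def ToricQuasimap.HasClass {n : ℕ} {ι : Type} [Fintype ι] [DecidableEq ι] {F : Fan n ι} {k : ℕ}
    (Q : ToricQuasimap F k) {C' : Scheme.{0}} [IsIntegral C'] [IsLocallyNoetherian C']
    (i : C' ⟶ Q.C) (β : F.H2) : Prop :=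
  ∀ ρ, β (F.D ρ) = ((Q.L ρ).pullback i).degree

end

end ToricQM

/-! Let ξ be the generic point of C'. A base point is nonsingular, so it has a proper generization;
ξ has none, hence ξ is not a base point. So there is a maximal cone σ such that u_ρ is nonzero at ξ,
and therefore deg L_ρ ≥ 0 on C', for all ρ ∉ σ. The trivializations φ_m give ∑ ⟨ρ, m⟩ deg L_ρ = 0,
so the degrees define β.

The toric input is that a class nonnegative on the divisors off one maximal cone is effective
(`isEffective_of_nonneg`). It is a nonnegative combination of the relations expressing a ray ρ ∉ σ
in the basis σ. As long as ρ has a negative coordinate, crossing the corresponding wall splits off a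
positive multiple of the class of an invariant curve and lowers the degree against an ample class
(`effRel_rayRel`). Against the support form of σ, an ample class has positive coefficients exactly
off σ, which gives positivity and the equality case. If β = 0, a section that is nonzero at ξ
vanishes nowhere; if u_ρ = 0, then ρ ∈ σ, and φ_m for m dual to ρ in σ writes L_ρ in terms of the
trivial bundles L_κ, κ ∉ σ.

Degrees on the possibly singular curve C' rest on the product formula `finsum_ord_eq_zero`. The
order at a point is the sum of the orders at the places above it, and both zeros and poles of f are
counted by [K : ℂ(f)].

For stability, Nα' - α is nef for large N (`exists_multiple`). The corresponding bundle on C is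
semiample (`semiample`): off the base points monomials in the u_ρ are nonzero, and at a base point b
one multiplies a power of a monomial by a power of a function whose only pole is b (`exists_pole`,
`exists_sec_isUnit`). Such functions exist because the Čech H¹ of the structure sheaf for a cover by
two affine opens is finite-dimensional. Ample tensor semiample is ample (`isAmple_of_semiample`).

Sections are handled as families of germs, one in the frame at each point, so that identities are
checked in stalks without restriction maps. -/

namespace ToricQM

noncomputable section

/-! ### Toric combinatorics: relations between rays, walls, effective classes. -/

namespace Fan

variable {n : ℕ} {ι : Type} [Fintype ι] [DecidableEq ι] (F : Fan n ι)

/-- The generator of a ray as a real vector. -/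
def rgen (ρ : ι) : Fin n → ℝ := fun j => (F.gen ρ j : ℝ)

/-- The map `ℤ^{Σ(1)} → N`; its kernel consists of the relations between the rays. -/
def rel : (ι → ℤ) →ₗ[ℤ] (Fin n → ℤ) := Fintype.linearCombination ℤ F.gen

theorem rel_apply (b : ι → ℤ) : F.rel b = ∑ ρ, b ρ • F.gen ρ := rfl

theorem rel_dotProduct (b : ι → ℤ) (m : Fin n → ℤ) :
    F.rel b ⬝ᵥ m = ∑ ρ, F.pairing ρ m * b ρ := by
  rw [rel_apply, sum_dotProduct]
  exact Finset.sum_congr rfl fun ρ _ => by rw [smul_dotProduct, smul_eq_mul, mul_comm]; rfl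

@[simp] theorem rel_single (ρ : ι) : F.rel (Pi.single ρ 1) = F.gen ρ := by
  simp [rel]

theorem mulVecLin_apply (m : Fin n → ℤ) (ρ : ι) : F.divMap m ρ = F.pairing ρ m := rfl

/-- The homomorphism `Pic → ℤ` given by a relation between the rays. -/
def ofRel (b : ι → ℤ) (hb : F.rel b = 0) : F.H2 :=
  (LinearMap.range F.divMap).liftQ (Fintype.linearCombination ℤ b) (by
    rintro _ ⟨m, rfl⟩
    have := F.rel_dotProduct b m
    rw [hb, zero_dotProduct] at this
    simpa [Fintype.linearCombination_apply, mulVecLin_apply] using this.symm)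

theorem ofRel_lineClass (b : ι → ℤ) (hb) (α : ι → ℤ) :
    F.ofRel b hb (F.lineClass α) = ∑ ρ, α ρ * b ρ := by
  simp [ofRel, lineClass, Fintype.linearCombination_apply]

@[simp] theorem ofRel_D (b : ι → ℤ) (hb) (ρ : ι) : F.ofRel b hb (F.D ρ) = b ρ := by
  simp [D, ofRel_lineClass, Pi.single_apply]

theorem lineClass_eq_sum (α : ι → ℤ) : F.lineClass α = ∑ ρ, α ρ • F.D ρ := by
  have : α = ∑ ρ, α ρ • (Pi.single ρ 1 : ι → ℤ) := by
    ext j; simp [Finset.sum_apply, Pi.single_apply]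
  have h2 := congrArg (Submodule.mkQ (LinearMap.range F.divMap)) this
  simp only [map_sum, map_smul] at h2
  exact h2

theorem apply_lineClass (β : F.H2) (α : ι → ℤ) :
    β (F.lineClass α) = ∑ ρ, α ρ * β (F.D ρ) := by
  rw [lineClass_eq_sum, map_sum]; simp

theorem H2_ext {β β' : F.H2} (h : ∀ ρ, β (F.D ρ) = β' (F.D ρ)) : β = β' := by
  refine LinearMap.ext fun x => ?_
  obtain ⟨α, rfl⟩ := Submodule.Quotient.mk_surjective _ x
  change β (F.lineClass α) = β' (F.lineClass α)
  simp [apply_lineClass, h]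

theorem rel_of_pairing (b : ι → ℤ) (h : ∀ m, ∑ ρ, F.pairing ρ m * b ρ = 0) :
    F.rel b = 0 := by
  ext j
  have := h (Pi.single j 1)
  rwa [← rel_dotProduct, dotProduct_single_one] at this

theorem H2_pairing (β : F.H2) (m : Fin n → ℤ) : ∑ ρ, F.pairing ρ m * β (F.D ρ) = 0 := by
  have : F.lineClass (F.divMap m) = 0 := (Submodule.Quotient.mk_eq_zero _).2 ⟨m, rfl⟩
  have h := congrArg β this
  rwa [apply_lineClass, map_zero] at h

theorem H2_rel (β : F.H2) : F.rel (fun ρ => β (F.D ρ)) = 0 :=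
  F.rel_of_pairing _ (F.H2_pairing β)

variable {F}

/-- The basis of `N` given by a maximal cone. -/
def basis {σ : Finset ι} (hσ : σ ∈ F.maxCones) : Module.Basis σ ℤ (Fin n → ℤ) :=
  .mk (F.linInd σ hσ) (by
    rw [← F.span_top σ hσ]
    apply Submodule.span_mono
    rintro _ ⟨x, hx, rfl⟩
    exact ⟨⟨x, hx⟩, rfl⟩)

/-- Coordinates with respect to the rays of a maximal cone. -/
def coord {σ : Finset ι} (hσ : σ ∈ F.maxCones) (v : Fin n → ℤ) (ρ : ι) : ℤ :=
  if h : ρ ∈ σ then (F.basis hσ).repr v ⟨ρ, h⟩ else 0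

theorem coord_of_notMem {σ : Finset ι} (hσ : σ ∈ F.maxCones) (v : Fin n → ℤ) {ρ : ι}
    (h : ρ ∉ σ) : coord hσ v ρ = 0 := dif_neg h

theorem sum_coord {σ : Finset ι} (hσ : σ ∈ F.maxCones) (v : Fin n → ℤ) :
    F.rel (coord hσ v) = v := by
  rw [rel_apply]
  rw [← Finset.sum_subset (Finset.subset_univ σ)
    (fun ρ _ h => by simp [coord_of_notMem hσ v h]), ← Finset.sum_attach]
  conv_rhs => rw [← (F.basis hσ).sum_repr v]
  refine Finset.sum_congr rfl fun x _ => ?_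
  simp [coord, basis]

theorem card_eq {σ : Finset ι} (hσ : σ ∈ F.maxCones) : σ.card = n := by
  have := Module.finrank_eq_card_basis (F.basis hσ)
  simpa using this.symm

theorem eq_zero_of_rel {σ : Finset ι} (hσ : σ ∈ F.maxCones) {b : ι → ℤ}
    (hb : F.rel b = 0) (h0 : ∀ ρ ∉ σ, b ρ = 0) : b = 0 := by
  rw [rel_apply, ← Finset.sum_subset (Finset.subset_univ σ)
    (fun ρ _ h => by simp [h0 ρ h]), ← Finset.sum_attach] at hb
  have := Fintype.linearIndependent_iff.1 (F.linInd σ hσ) (fun x => b x) (by simpa using hb)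
  ext ρ
  by_cases h : ρ ∈ σ
  · exact this ⟨ρ, h⟩
  · exact h0 ρ h

/-- Real version of `sum_coord` -/
theorem sum_coord_real {σ : Finset ι} (hσ : σ ∈ F.maxCones) (v : Fin n → ℤ) :
    ∑ ρ ∈ σ, (coord hσ v ρ : ℝ) • F.rgen ρ = fun j => (v j : ℝ) := by
  rw [Finset.sum_subset (Finset.subset_univ σ)
    (fun ρ _ h => by simp [coord_of_notMem hσ v h])]
  ext j
  have := congrFun (sum_coord hσ v) j
  rw [← this]
  simp [rgen, rel_apply]

theorem linInd_real {σ : Finset ι} (hσ : σ ∈ F.maxCones) :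
    LinearIndependent ℝ (fun ρ : σ => F.rgen ρ) := by
  refine linearIndependent_of_top_le_span_of_card_eq_finrank ?_ (by simp [card_eq hσ])
  rw [← (Pi.basisFun ℝ (Fin n)).span_eq, Submodule.span_le]
  rintro _ ⟨j, rfl⟩
  have h := sum_coord_real hσ (Pi.single j 1)
  have e : (fun k => (((Pi.single j 1 : Fin n → ℤ) k : ℤ) : ℝ)) = Pi.basisFun ℝ (Fin n) j := by
    ext k; by_cases hk : k = j <;> simp [hk]
  rw [← e, ← h]
  exact Submodule.sum_mem _ fun ρ hρ => Submodule.smul_mem _ _ (Submodule.subset_span ⟨⟨ρ, hρ⟩, rfl⟩)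

theorem eq_zero_of_rel_real {σ : Finset ι} (hσ : σ ∈ F.maxCones) {b : ι → ℝ}
    (hb : ∑ ρ ∈ σ, b ρ • F.rgen ρ = 0) : ∀ ρ ∈ σ, b ρ = 0 := by
  rw [← Finset.sum_attach] at hb
  have := Fintype.linearIndependent_iff.1 (F.linInd_real hσ) (fun x => b x) (by simpa using hb)
  exact fun ρ h => this ⟨ρ, h⟩

/-- A ray with nonnegative coordinates with respect to a maximal cone belongs to it. -/
theorem mem_of_coord_nonneg {σ : Finset ι} (hσ : σ ∈ F.maxCones) {ρ : ι}
    (h : ∀ κ, 0 ≤ coord hσ (F.gen ρ) κ) : ρ ∈ σ := by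
  by_contra hρ
  obtain ⟨σ', hσ', hρ'⟩ := F.ray_mem ρ
  have h1 := sum_coord_real hσ (F.gen ρ)
  have h2 : ∑ κ ∈ σ', (Pi.single ρ 1 : ι → ℝ) κ • F.rgen κ = F.rgen ρ := by
    simp [Pi.single_apply, hρ']
  -- `gen ρ` lies in both cones, hence in the span of σ' ∩ σ, which omits ρ. This contradicts the
  -- independence of the rays of σ'.
  obtain ⟨c, hc, e⟩ := F.inter_face σ' hσ' σ hσ (Pi.single ρ 1) (fun κ => (coord hσ (F.gen ρ) κ : ℝ))
    (fun κ => by by_cases hk : κ = ρ <;> simp [hk])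
    (fun κ => by exact_mod_cast h κ) (h2.trans h1.symm)
  change ∑ κ ∈ σ', (Pi.single ρ 1 : ι → ℝ) κ • F.rgen κ = ∑ κ ∈ σ' ∩ σ, c κ • F.rgen κ at e
  have e2 : ∑ κ ∈ σ' ∩ σ, c κ • F.rgen κ = ∑ κ ∈ σ', (if κ ∈ σ then c κ else 0) • F.rgen κ := by
    rw [← Finset.filter_mem_eq_inter, Finset.sum_filter]
    exact Finset.sum_congr rfl fun κ _ => by split_ifs <;> simp
  rw [e2, ← sub_eq_zero, ← Finset.sum_sub_distrib] at e
  simp_rw [← sub_smul] at e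
  have := eq_zero_of_rel_real hσ' e ρ hρ'
  simp [hρ] at this

theorem coord_gen {σ : Finset ι} (hσ : σ ∈ F.maxCones) {κ : ι} (h : κ ∈ σ) :
    coord hσ (F.gen κ) = Pi.single κ 1 := by
  rw [← sub_eq_zero]
  refine eq_zero_of_rel hσ (by simp [sum_coord]) fun ρ hρ => ?_
  have : ρ ≠ κ := fun e => hρ (e ▸ h)
  simp [coord_of_notMem hσ _ hρ, this]

/-- Cones containing points near a wall. -/
theorem exists_cone_near {σ : Finset ι} (κ : ι) : ∃ (σ' : Finset ι) (hσ' : σ' ∈ F.maxCones),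
    {k : ℕ | ∀ ρ, 0 ≤ ((∑ l ∈ σ.erase κ, coord hσ' (F.gen l) ρ : ℤ) : ℝ)
      - (coord hσ' (F.gen κ) ρ : ℝ) / (k + 1)}.Infinite := by
  -- For κ ∈ σ these points approach an interior point of the facet opposite κ from outside σ. There
  -- are finitely many cones, so one of them contains infinitely many of the points.
  have h := fun k : ℕ => F.complete
    (∑ l ∈ σ.erase κ, F.rgen l - (1 / ((k : ℝ) + 1)) • F.rgen κ)
  choose f hf c hc hv using h
  have : Finite F.maxCones := Set.toFinite _
  obtain ⟨⟨σ', hσ'⟩, hinf⟩ := Finite.exists_infinite_fiber (fun k => (⟨f k, hf k⟩ : F.maxCones))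
  refine ⟨σ', hσ', (Set.infinite_coe_iff.1 hinf).mono fun k hk ρ => ?_⟩
  have hk' : f k = σ' := congrArg Subtype.val hk
  by_cases hρ : ρ ∈ σ'
  · have e := hv k
    rw [hk'] at e
    have e1 : ∀ l, F.rgen l = ∑ ρ ∈ σ', (coord hσ' (F.gen l) ρ : ℝ) • F.rgen ρ := fun l =>
      (sum_coord_real hσ' (F.gen l)).symm
    have e2 : ∑ ρ ∈ σ', (((∑ l ∈ σ.erase κ, coord hσ' (F.gen l) ρ : ℤ) : ℝ)
      - (coord hσ' (F.gen κ) ρ : ℝ) / (k + 1) - c k ρ) • F.rgen ρ = 0 := by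
      simp only [sub_smul, Finset.sum_sub_distrib, Int.cast_sum, Finset.sum_smul]
      rw [Finset.sum_comm]
      simp only [← e1]
      rw [sub_eq_zero]
      refine Eq.trans ?_ e
      congr 1
      rw [e1 κ, Finset.smul_sum]
      refine Finset.sum_congr rfl fun ρ _ => ?_
      rw [smul_smul]
      congr 1; ring
    have := eq_zero_of_rel_real hσ' e2 ρ hρ
    rw [sub_eq_zero.1 this]
    exact hc k ρ
  · simp [coord_of_notMem hσ' _ hρ]

/-- The limit k → ∞ of the coordinate inequalities; as A is an integer, one k > |B| suffices to
exclude A ≤ -1. -/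
theorem nonneg_of_infinite {A B : ℤ} {S : Set ℕ} (hS : S.Infinite)
    (h : ∀ k ∈ S, 0 ≤ (A : ℝ) - (B : ℝ) / (k + 1)) : 0 ≤ A := by
  by_contra hA
  obtain ⟨k, hk, hkB⟩ := hS.exists_gt B.natAbs
  have h1 := h k hk
  have hA' : (A : ℝ) ≤ -1 := by exact_mod_cast (by omega : A ≤ -1)
  have h2 : -(B : ℝ) ≤ k := by exact_mod_cast (by omega : -B ≤ (k : ℤ))
  have h3 : (0 : ℝ) < k + 1 := by positivity
  have h4 : (B : ℝ) / (k + 1) ≤ -1 := by linarith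
  rw [div_le_iff₀ h3] at h4
  linarith

/-- The maximal cone on the other side of a wall. -/
theorem exists_wall {σ : Finset ι} (hσ : σ ∈ F.maxCones) {κ : ι} (hκ : κ ∈ σ) :
    ∃ σ' ∈ F.maxCones, ∃ κ' ∈ σ', κ ∉ σ' ∧ κ' ∉ σ ∧ σ.erase κ = σ'.erase κ' ∧
      coord hσ (F.gen κ') κ = -1 := by
  obtain ⟨σ', hσ', hinf⟩ := F.exists_cone_near (σ := σ) κ
  have hA : ∀ ρ, 0 ≤ ∑ l ∈ σ.erase κ, coord hσ' (F.gen l) ρ := fun ρ =>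
    nonneg_of_infinite hinf fun k hk => hk ρ
  obtain ⟨k, hk⟩ := hinf.nonempty
  have hk0 : (0 : ℝ) < k + 1 := by positivity
  -- The sum of the wall generators has nonnegative σ'-coordinates, so it lies in the common face.
  -- Its σ-coordinate is 1 at every wall ray, which puts all of them in σ'.
  have hsub : ∀ l ∈ σ.erase κ, l ∈ σ' := by
    have e0 : ∑ ρ ∈ σ, (if ρ ∈ σ.erase κ then (1 : ℝ) else 0) • F.rgen ρ =
        ∑ ρ ∈ σ', ((∑ l ∈ σ.erase κ, coord hσ' (F.gen l) ρ : ℤ) : ℝ) • F.rgen ρ := by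
      simp only [Int.cast_sum, Finset.sum_smul]
      rw [Finset.sum_comm]
      simp only [sum_coord_real, ite_smul, one_smul, zero_smul]
      rw [← Finset.sum_filter]
      refine Finset.sum_congr ?_ fun _ _ => rfl
      ext l
      simp
    obtain ⟨c, -, e⟩ := F.inter_face σ hσ σ' hσ' _ _ (fun ρ => by split_ifs <;> simp)
      (fun ρ => by exact_mod_cast hA ρ) e0
    change ∑ ρ ∈ σ, (if ρ ∈ σ.erase κ then (1 : ℝ) else 0) • F.rgen ρ =
      ∑ ρ ∈ σ ∩ σ', c ρ • F.rgen ρ at e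
    have e2 : ∑ ρ ∈ σ ∩ σ', c ρ • F.rgen ρ =
        ∑ ρ ∈ σ, (if ρ ∈ σ' then c ρ else 0) • F.rgen ρ := by
      rw [← Finset.filter_mem_eq_inter, Finset.sum_filter]
      exact Finset.sum_congr rfl fun κ _ => by split_ifs <;> simp
    rw [e2, ← sub_eq_zero, ← Finset.sum_sub_distrib] at e
    simp_rw [← sub_smul] at e
    intro l hl
    have := eq_zero_of_rel_real hσ e l (Finset.mem_of_mem_erase hl)
    by_contra hl'
    simp only [hl, hl', if_true, if_false] at this
    norm_num at this
  -- Otherwise σ = σ', and the nearby points would have the negative κ-coordinate -1/(k+1).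
  have hκσ' : κ ∉ σ' := by
    intro hκ'
    have hss : σ ⊆ σ' := fun l hl => by
      by_cases e : l = κ
      · exact e ▸ hκ'
      · exact hsub l (Finset.mem_erase.2 ⟨e, hl⟩)
    obtain rfl : σ = σ' := Finset.eq_of_subset_of_card_le hss (by rw [card_eq hσ, card_eq hσ'])
    have h0 : ∑ l ∈ σ.erase κ, coord hσ' (F.gen l) κ = 0 := Finset.sum_eq_zero fun l hl => by
      rw [coord_gen hσ' (Finset.mem_of_mem_erase hl), Pi.single_apply,
        if_neg (Finset.ne_of_mem_erase hl).symm]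
    have := hk κ
    rw [h0, coord_gen hσ' hκ, Pi.single_eq_same] at this
    have h1 : (0 : ℝ) < ((1 : ℤ) : ℝ) / (k + 1) := by positivity
    simp only [Int.cast_zero] at this
    linarith
  have hcard : (σ' \ σ.erase κ).card = 1 := by
    rw [Finset.card_sdiff_of_subset hsub, Finset.card_erase_of_mem hκ, card_eq hσ, card_eq hσ']
    have : 0 < n := card_eq hσ ▸ Finset.card_pos.2 ⟨κ, hκ⟩
    omega
  obtain ⟨κ', hκ'⟩ := Finset.card_eq_one.1 hcard
  have hmem : ∀ l, (l ∈ σ' ∧ l ∉ σ.erase κ) ↔ l = κ' := fun l => by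
    rw [← Finset.mem_sdiff, hκ', Finset.mem_singleton]
  have h1 := (hmem κ').2 rfl
  have hκκ' : κ' ≠ κ := fun e => hκσ' (e ▸ h1.1)
  have hκ'σ : κ' ∉ σ := fun h => h1.2 (Finset.mem_erase.2 ⟨hκκ', h⟩)
  refine ⟨σ', hσ', κ', h1.1, hκσ', hκ'σ, ?_, ?_⟩
  · ext l
    constructor
    · intro hl
      exact Finset.mem_erase.2 ⟨fun e => h1.2 (e ▸ hl), hsub l hl⟩
    · intro hl
      by_contra hl'
      exact (Finset.ne_of_mem_erase hl) ((hmem l).1 ⟨Finset.mem_of_mem_erase hl, hl'⟩)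
  -- Nonsingularity enters here: a and b are integers with ab = 1. The κ'-coordinate of the nearby
  -- points is -b/(k+1), so b ≤ 0 and a = b = -1.
  · set a := coord hσ (F.gen κ') κ with ha
    set b := coord hσ' (F.gen κ) κ' with hb
    have hb0 : b ≤ 0 := by
      have h0 : ∑ l ∈ σ.erase κ, coord hσ' (F.gen l) κ' = 0 := Finset.sum_eq_zero fun l hl => by
        rw [coord_gen hσ' (hsub l hl), Pi.single_apply, if_neg (fun e : κ' = l => h1.2 (e ▸ hl))]
      have := hk κ'
      rw [h0, ← hb, Int.cast_zero, zero_sub, neg_nonneg, div_le_iff₀ hk0, zero_mul] at this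
      exact_mod_cast this
    -- The entries at κ' cancel, so the relation is supported on σ and vanishes. Its entry at κ
    -- reads 1 - ba = 0.
    have hr : Pi.single κ 1 - coord hσ' (F.gen κ) +
        b • (Pi.single κ' 1 - coord hσ (F.gen κ')) = 0 := by
      refine eq_zero_of_rel hσ (by simp [sum_coord, -zsmul_eq_mul]) fun l hl => ?_
      have hlκ : l ≠ κ := fun e => hl (e ▸ hκ)
      by_cases hlκ' : l = κ'
      · subst hlκ'
        simp [hlκ, coord_of_notMem hσ _ hl, hb]
      · have hl' : l ∉ σ' := fun h => hlκ' ((hmem l).1 ⟨h, fun h' => hl (Finset.mem_of_mem_erase h')⟩)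
        simp [hlκ, hlκ', coord_of_notMem hσ _ hl, coord_of_notMem hσ' _ hl']
    have := congrFun hr κ
    simp only [Pi.add_apply, Pi.sub_apply, Pi.smul_apply, Pi.single_eq_same, Pi.zero_apply,
      coord_of_notMem hσ' _ hκσ', Pi.single_apply, if_neg hκκ'.symm, smul_eq_mul, ← ha] at this
    have hab : b * a = 1 := by linarith
    rcases Int.mul_eq_one_iff_eq_one_or_neg_one.1 hab with h | h
    · omega
    · exact h.2

/-- The effective classes, as relations. -/
def EffRel (F : Fan n ι) (b : ι → ℤ) : Prop :=
  ∃ hb : F.rel b = 0, F.IsEffective (F.ofRel b hb)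

theorem EffRel.zero : EffRel F 0 := by
  refine ⟨map_zero _, ?_⟩
  have : F.ofRel 0 (map_zero _) = 0 := F.H2_ext fun ρ => by simp
  rw [this]
  exact AddSubmonoid.zero_mem _

theorem EffRel.add {b b' : ι → ℤ} (h : EffRel F b) (h' : EffRel F b') : EffRel F (b + b') := by
  obtain ⟨h1, h2⟩ := h
  obtain ⟨h1', h2'⟩ := h'
  have hb : F.rel (b + b') = 0 := by rw [map_add, h1, h1', add_zero]
  have : F.ofRel (b + b') hb = F.ofRel b h1 + F.ofRel b' h1' := F.H2_ext fun ρ => by simp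
  exact ⟨hb, this ▸ AddSubmonoid.add_mem _ h2 h2'⟩

theorem EffRel.nsmul {b : ι → ℤ} (h : EffRel F b) (k : ℕ) : EffRel F (k • b) := by
  induction k with
  | zero => simpa using EffRel.zero
  | succ k ih => rw [succ_nsmul]; exact ih.add h

theorem EffRel.zsmul {b : ι → ℤ} (h : EffRel F b) {k : ℤ} (hk : 0 ≤ k) : EffRel F (k • b) := by
  lift k to ℕ using hk
  simpa using h.nsmul k

theorem EffRel.sum {s : Finset ι} {f : ι → ι → ℤ} (h : ∀ i ∈ s, EffRel F (f i)) :
    EffRel F (∑ i ∈ s, f i) := by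
  induction s using Finset.induction_on with
  | empty => simpa using EffRel.zero
  | insert a s ha ih =>
    rw [Finset.sum_insert ha]
    exact (h a (by simp)).add (ih fun i hi => h i (by simp [hi]))

/-- The relation `ρ - ∑_{κ ∈ σ} (coordinate) κ`. -/
def rayRel {σ : Finset ι} (hσ : σ ∈ F.maxCones) (ρ : ι) : ι → ℤ :=
  Pi.single ρ 1 - coord hσ (F.gen ρ)

theorem rayRel_rel {σ : Finset ι} (hσ : σ ∈ F.maxCones) (ρ : ι) :
    F.rel (rayRel hσ ρ) = 0 := by
  simp [rayRel, sum_coord]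

theorem rayRel_of_notMem {σ : Finset ι} (hσ : σ ∈ F.maxCones) (ρ : ι) {κ} (h : κ ∉ σ) :
    rayRel hσ ρ κ = (Pi.single ρ 1 : ι → ℤ) κ := by
  simp [rayRel, coord_of_notMem hσ _ h]

/-- The intersection number of an ample class with a relation. -/
theorem ample_rel {α : ι → ℤ} (hα : F.IsAmple α) {σ : Finset ι} (hσ : σ ∈ F.maxCones)
    {b : ι → ℤ} (hb : F.rel b = 0) (h0 : ∀ ρ ∉ σ, 0 ≤ b ρ) :
    0 ≤ ∑ ρ, α ρ * b ρ ∧ (∑ ρ, α ρ * b ρ = 0 → b = 0) := by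
  obtain ⟨m, h1, h2⟩ := hα σ hσ
  have hm : ∑ ρ, F.pairing ρ m * b ρ = 0 := by
    rw [← F.rel_dotProduct, hb, zero_dotProduct]
  -- Adding the principal divisor of the support form of σ leaves the degree unchanged and kills all
  -- coefficients on σ.
  have key : ∑ ρ, α ρ * b ρ = ∑ ρ, (α ρ + F.pairing ρ m) * b ρ := by
    simp [add_mul, Finset.sum_add_distrib, hm]
  have hnn : ∀ ρ ∈ Finset.univ, 0 ≤ (α ρ + F.pairing ρ m) * b ρ := fun ρ _ => by
    by_cases h : ρ ∈ σ
    · simp [h1 ρ h]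
    · exact mul_nonneg (by linarith [h2 ρ h]) (h0 ρ h)
  refine ⟨key ▸ Finset.sum_nonneg hnn, fun h => eq_zero_of_rel hσ hb fun ρ hρ => ?_⟩
  have := (Finset.sum_eq_zero_iff_of_nonneg hnn).1 (key ▸ h) ρ (Finset.mem_univ _)
  rcases mul_eq_zero.1 this with h | h
  · linarith [h2 ρ hρ]
  · exact h

/-- The coordinate -1 is what makes the intersection number with the second outer divisor, that of
κ, equal to 1. -/
theorem effRel_wall {σ σ' : Finset ι} (hσ : σ ∈ F.maxCones) (hσ' : σ' ∈ F.maxCones) {κ κ' : ι}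
    (hκ : κ ∈ σ) (hκ' : κ' ∈ σ') (h1 : κ ∉ σ') (h2 : κ' ∉ σ) (h : σ.erase κ = σ'.erase κ')
    (hc : coord hσ (F.gen κ') κ = -1) : EffRel F (rayRel hσ κ') := by
  refine ⟨rayRel_rel hσ κ', AddSubmonoid.subset_closure
    ⟨σ, hσ, σ', hσ', κ, hκ, κ', hκ', h1, h2, h, ?_, ?_, fun l hl hl' => ?_⟩⟩
  · rw [ofRel_D, rayRel, Pi.sub_apply, hc, Pi.single_apply, if_neg (fun e : κ = κ' => h1 (e ▸ hκ'))]; rfl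
  · rw [ofRel_D, rayRel_of_notMem hσ _ h2, Pi.single_eq_same]
  · rw [ofRel_D, rayRel_of_notMem hσ _ hl, Pi.single_apply, if_neg (fun e : l = κ' => hl' (e ▸ hκ'))]

/-- Induction on the α-degree of the relation. If all coordinates of ρ in σ are nonnegative, then ρ
∈ σ and the relation is zero. Otherwise cross the wall opposite a ray with negative coordinate: the
relation changes by a positive multiple of the wall relation, which has positive degree, so the
degree drops. -/
theorem effRel_rayRel {α : ι → ℤ} (hα : F.IsAmple α) {σ : Finset ι} (hσ : σ ∈ F.maxCones)
    (ρ : ι) : EffRel F (rayRel hσ ρ) := by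
  have nn : ∀ {σ : Finset ι} (hσ : σ ∈ F.maxCones) (κ : ι), ∀ l ∉ σ, 0 ≤ rayRel hσ κ l :=
    fun hσ κ l hl => by
      rw [rayRel_of_notMem hσ _ hl]; by_cases h : l = κ <;> simp [h]
  have pos : ∀ {σ : Finset ι} (hσ : σ ∈ F.maxCones) (κ : ι),
      0 ≤ ∑ l, α l * rayRel hσ κ l := fun hσ κ => (ample_rel hα hσ (rayRel_rel hσ κ) (nn hσ κ)).1
  obtain ⟨k, hk⟩ := Int.eq_ofNat_of_zero_le (pos hσ ρ)
  induction k using Nat.strong_induction_on generalizing σ with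
  | _ k ih =>
  by_cases hneg : ∀ κ, 0 ≤ coord hσ (F.gen ρ) κ
  · have hρ := mem_of_coord_nonneg hσ hneg
    have : rayRel hσ ρ = 0 := eq_zero_of_rel hσ (rayRel_rel hσ ρ) fun l hl => by
      rw [rayRel_of_notMem hσ _ hl, Pi.single_apply, if_neg (fun e : l = ρ => hl (e ▸ hρ))]
    rw [this]; exact EffRel.zero
  push Not at hneg
  obtain ⟨κ, hneg⟩ := hneg
  have hκ : κ ∈ σ := by by_contra h; simp [coord_of_notMem hσ _ h] at hneg
  obtain ⟨σ', hσ', κ', hκ', h1, h2, h, hc⟩ := exists_wall hσ hκ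
  have hw := effRel_wall hσ hσ' hκ hκ' h1 h2 h hc
  set a := - coord hσ (F.gen ρ) κ with ha
  have hsub : ∀ l, l ∉ σ' → l ≠ κ → l ∉ σ := fun l hl hlk hls =>
    hl (Finset.mem_of_mem_erase (h ▸ Finset.mem_erase.2 ⟨hlk, hls⟩))
  -- A relation is determined by its entries off σ'. The coefficient a is forced at κ, where the
  -- wall relation has entry 1.
  have e : rayRel hσ ρ = rayRel hσ' ρ + a • rayRel hσ κ' := by
    rw [← sub_eq_zero]
    refine eq_zero_of_rel hσ' ?_ fun l hl => ?_
    · simp only [map_sub, map_add, map_smul, rayRel_rel, smul_zero, add_zero, sub_zero]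
    · have hlk' : l ≠ κ' := fun e => hl (e ▸ hκ')
      by_cases hlk : l = κ
      · subst hlk
        rw [Pi.sub_apply, Pi.add_apply, Pi.smul_apply, rayRel_of_notMem hσ' _ hl]
        simp [rayRel, hc, ha, hlk']; ring
      · have hls := hsub l hl hlk
        simp [rayRel_of_notMem hσ' _ hl, rayRel_of_notMem hσ _ hls, Pi.single_apply, hlk']
  have hw0 : 0 < ∑ l, α l * rayRel hσ κ' l := by
    refine lt_of_le_of_ne (pos hσ κ') fun h0 => ?_
    have := congrFun ((ample_rel hα hσ (rayRel_rel hσ κ') (nn hσ κ')).2 h0.symm) κ'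
    simp [rayRel_of_notMem hσ _ h2] at this
  obtain ⟨k', hk'⟩ := Int.eq_ofNat_of_zero_le (pos hσ' ρ)
  have hsum : ∑ l, α l * rayRel hσ ρ l =
      ∑ l, α l * rayRel hσ' ρ l + a * ∑ l, α l * rayRel hσ κ' l := by
    rw [e, Finset.mul_sum, ← Finset.sum_add_distrib]
    exact Finset.sum_congr rfl fun l _ => by simp; ring
  have hapos : 0 < a := by omega
  rw [e]
  refine (ih k' ?_ hσ' hk').add (hw.zsmul hapos.le)
  have : 0 < a * ∑ l, α l * rayRel hσ κ' l := mul_pos hapos hw0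
  omega

/-- A class which is nonnegative on the divisors not containing a torus fixed point is effective. -/
theorem isEffective_of_nonneg (hF : F.IsProjective) {σ : Finset ι} (hσ : σ ∈ F.maxCones)
    (β : F.H2) (h0 : ∀ ρ ∉ σ, 0 ≤ β (F.D ρ)) : F.IsEffective β := by
  obtain ⟨α, hα⟩ := hF
  -- For ρ ∉ σ, the only nonzero entry of `rayRel hσ ρ` off σ is the 1 at ρ, and the entries off σ
  -- determine a relation.
  have e : (fun ρ => β (F.D ρ)) = ∑ ρ ∈ Finset.univ \ σ, β (F.D ρ) • rayRel hσ ρ := by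
    rw [← sub_eq_zero]
    refine eq_zero_of_rel hσ ?_ fun l hl => ?_
    · simp only [map_sub, map_sum, map_smul, F.H2_rel β, rayRel_rel, smul_zero,
        Finset.sum_const_zero, sub_zero]
    · simp [Finset.sum_apply, rayRel_of_notMem hσ _ hl, Pi.single_apply, hl]
  have h : EffRel F (fun ρ => β (F.D ρ)) := by
    rw [e]
    refine EffRel.sum fun ρ hρ => (effRel_rayRel hα hσ ρ).zsmul (h0 ρ ?_)
    simpa using hρ
  obtain ⟨hb, h⟩ := h
  convert h
  exact F.H2_ext fun ρ => by simp

theorem ample_nonneg {α : ι → ℤ} (hα : F.IsAmple α) {σ : Finset ι} (hσ : σ ∈ F.maxCones)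
    (β : F.H2) (h0 : ∀ ρ ∉ σ, 0 ≤ β (F.D ρ)) :
    0 ≤ β (F.lineClass α) ∧ (β (F.lineClass α) = 0 ↔ β = 0) := by
  have h := ample_rel hα hσ (F.H2_rel β) h0
  rw [apply_lineClass]
  refine ⟨h.1, fun e => F.H2_ext fun ρ => ?_, fun e => by simp [e]⟩
  simpa using congrFun (h.2 e) ρ

end Fan

/-! ### Families of germs -/

/-- The germ of a function at a point. -/
def gm {X : Scheme.{0}} {V : X.Opens} {z : X} (hz : z ∈ V) : Γ(X, V) →+* X.presheaf.stalk z :=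
  (X.presheaf.germ V z hz).hom

theorem gm_res {X : Scheme.{0}} {U V : X.Opens} (h : V ≤ U) {z : X} (hz : z ∈ V) (t : Γ(X, U)) :
    gm hz (res X h t) = gm (h hz) t :=
  X.presheaf.germ_res_apply (homOfLE h) z hz t

theorem section_ext_gm {X : Scheme.{0}} {V : X.Opens} {s t : Γ(X, V)}
    (h : ∀ z (hz : z ∈ V), gm hz s = gm hz t) : s = t :=
  TopCat.Presheaf.section_ext X.sheaf V s t h

theorem exists_gm_eq {X : Scheme.{0}} {z : X} (a : X.presheaf.stalk z) :
    ∃ (V : X.Opens) (hz : z ∈ V) (t : Γ(X, V)), gm hz t = a :=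
  X.presheaf.exists_germ_eq a

theorem exists_nhd_of_gm_eq {X : Scheme.{0}} {U V : X.Opens} {z : X} (hU : z ∈ U) (hV : z ∈ V)
    {s : Γ(X, U)} {t : Γ(X, V)} (h : gm hU s = gm hV t) :
    ∃ W : X.Opens, z ∈ W ∧ ∃ (h1 : W ≤ U) (h2 : W ≤ V), res X h1 s = res X h2 t := by
  obtain ⟨W, hz, i1, i2, e⟩ := X.presheaf.germ_eq z hU hV s t h
  exact ⟨W, hz, i1.le, i2.le, e⟩

theorem mem_basicOpen_iff {X : Scheme.{0}} {U : X.Opens} {z : X} (hz : z ∈ U) (s : Γ(X, U)) :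
    z ∈ X.basicOpen s ↔ IsUnit (gm hz s) := X.mem_basicOpen s z hz

theorem isUnit_of_gm {X : Scheme.{0}} {V : X.Opens} {s : Γ(X, V)}
    (h : ∀ z (hz : z ∈ V), IsUnit (gm hz s)) : IsUnit s := by
  have : X.basicOpen s = V := le_antisymm (X.basicOpen_le s) fun z hz =>
    (mem_basicOpen_iff hz s).2 (h z hz)
  have h2 := X.toRingedSpace.isUnit_res_basicOpen s
  have h3 : ∀ (W : X.Opens) (hW : W ≤ V), W = V → IsUnit (res X hW s) → IsUnit s := by
    rintro W hW rfl h
    have : res X hW s = s := section_ext_gm fun z hz => gm_res hW hz s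
    rwa [this] at h
  exact h3 _ (X.basicOpen_le s) this h2

theorem mem_inf {X : Scheme.{0}} {U V : X.Opens} {z : X} (h : z ∈ U) (h' : z ∈ V) : z ∈ U ⊓ V :=
  ⟨h, h'⟩

/-- Families of germs. -/
abbrev Germs (X : Scheme.{0}) : Type := ∀ z : X, X.presheaf.stalk z

/-- The families of germs which come from a function on `U`. -/
def reg {X : Scheme.{0}} (U : X.Opens) : Subring (Germs X) where
  carrier := {σ | ∃ t : Γ(X, U), ∀ z (hz : z ∈ U), gm hz t = σ z}
  mul_mem' := by
    rintro _ _ ⟨s, hs⟩ ⟨t, ht⟩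
    exact ⟨s * t, fun z hz => by rw [map_mul, hs, ht]; rfl⟩
  one_mem' := ⟨1, fun _ _ => map_one _⟩
  add_mem' := by
    rintro _ _ ⟨s, hs⟩ ⟨t, ht⟩
    exact ⟨s + t, fun z hz => by rw [map_add, hs, ht]; rfl⟩
  zero_mem' := ⟨0, fun _ _ => map_zero _⟩
  neg_mem' := by
    rintro _ ⟨s, hs⟩
    exact ⟨-s, fun _ hz => by rw [map_neg, hs]; rfl⟩

section Reg

variable {X : Scheme.{0}}

theorem reg_mono {U V : X.Opens} (h : V ≤ U) : reg U ≤ reg V := by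
  rintro σ ⟨t, ht⟩
  exact ⟨res X h t, fun z hz => by rw [gm_res, ht]⟩

theorem reg_congr {U : X.Opens} {σ τ : Germs X} (h : ∀ z ∈ U, σ z = τ z) (hσ : σ ∈ reg U) :
    τ ∈ reg U := by
  obtain ⟨t, ht⟩ := hσ
  exact ⟨t, fun z hz => by rw [ht, h z hz]⟩

theorem reg_glue {U : X.Opens} {σ : Germs X}
    (h : ∀ z ∈ U, ∃ V : X.Opens, z ∈ V ∧ σ ∈ reg V) : σ ∈ reg U := by
  have h' : ∀ z : U, ∃ V : X.Opens, z.1 ∈ V ∧ V ≤ U ∧ σ ∈ reg V := fun z => by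
    obtain ⟨V, h1, h2⟩ := h z z.2
    exact ⟨V ⊓ U, ⟨h1, z.2⟩, inf_le_right, reg_mono inf_le_left h2⟩
  choose V hz hV t ht using h'
  obtain ⟨s, hs, -⟩ := X.sheaf.existsUnique_gluing' V U (fun i => homOfLE (hV i))
    (fun z hz' => (Opens.mem_iSup).2 ⟨⟨z, hz'⟩, hz _⟩) t (by
      intro i j
      refine section_ext_gm fun z hz => ?_
      refine (gm_res inf_le_left hz _).trans (Eq.trans ?_ (gm_res inf_le_right hz _).symm)
      rw [ht, ht])
  refine ⟨s, fun z hzU => ?_⟩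
  rw [← ht ⟨z, hzU⟩ z (hz _), ← hs ⟨z, hzU⟩]
  exact (gm_res (hV _) (hz ⟨z, hzU⟩) s).symm

theorem reg_inv {U : X.Opens} {σ τ : Germs X} (h : σ ∈ reg U) (hu : ∀ z ∈ U, σ z * τ z = 1) :
    τ ∈ reg U := by
  obtain ⟨t, ht⟩ := h
  have : IsUnit t := isUnit_of_gm fun z hz => by
    rw [ht]; exact IsUnit.of_mul_eq_one _ (hu z hz)
  obtain ⟨u, rfl⟩ := this
  refine ⟨(u⁻¹ : (Γ(X, U))ˣ), fun z hz => ?_⟩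
  have h1 : gm hz (u : Γ(X, U)) * gm hz ((u⁻¹ : (Γ(X, U))ˣ) : Γ(X, U)) = 1 := by
    rw [← map_mul, Units.mul_inv, map_one]
  rw [ht] at h1
  calc _ = gm hz ((u⁻¹ : (Γ(X, U))ˣ) : Γ(X, U)) * (σ z * τ z) := by rw [hu z hz, mul_one]
    _ = (σ z * gm hz ((u⁻¹ : (Γ(X, U))ˣ) : Γ(X, U))) * τ z := by ring
    _ = τ z := by rw [h1, one_mul]

open Classical in
/-- The family of germs of a function, extended by zero. -/
def ext0 {U : X.Opens} (t : Γ(X, U)) : Germs X := fun z => if h : z ∈ U then gm h t else 0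

theorem ext0_apply {U : X.Opens} (t : Γ(X, U)) {z : X} (h : z ∈ U) : ext0 t z = gm h t := dif_pos h

theorem ext0_mem {U : X.Opens} (t : Γ(X, U)) : ext0 t ∈ reg U :=
  ⟨t, fun z hz => (ext0_apply t hz).symm⟩

/-- A point where two functions agree has a neighbourhood where they do. -/
theorem reg_eq_nhd {U V : X.Opens} {σ τ : Germs X} (hσ : σ ∈ reg U) (hτ : τ ∈ reg V) {z : X}
    (hz : z ∈ U) (hz' : z ∈ V) (h : σ z = τ z) :
    ∃ W : X.Opens, z ∈ W ∧ W ≤ U ∧ W ≤ V ∧ ∀ y ∈ W, σ y = τ y := by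
  obtain ⟨s, hs⟩ := hσ
  obtain ⟨t, ht⟩ := hτ
  obtain ⟨W, hW, h1, h2, e⟩ := exists_nhd_of_gm_eq hz hz' (s := s) (t := t) (by rw [hs, ht, h])
  refine ⟨W, hW, h1, h2, fun y hy => ?_⟩
  rw [← hs y (h1 hy), ← ht y (h2 hy), ← gm_res h1 hy, ← gm_res h2 hy, e]

end Reg

/-! ### Sections of line bundles as families of germs -/

namespace LineBundle

variable {X : Scheme.{0}}

open Classical in
/-- The germ at `z` of the transition function from the frame at `z` to the frame at `y`. -/
def c (L : LineBundle X) (y z : X) : (X.presheaf.stalk z)ˣ :=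
  if h : z ∈ L.U y then Units.map (gm (V := L.U y ⊓ L.U z) (mem_inf h (L.mem z))).toMonoidHom (L.g y z)
  else 1

theorem c_of_mem (L : LineBundle X) {y z : X} (h : z ∈ L.U y) : L.c y z =
    Units.map (gm (V := L.U y ⊓ L.U z) (mem_inf h (L.mem z))).toMonoidHom (L.g y z) := dif_pos h

theorem c_val (L : LineBundle X) {y z : X} (h : z ∈ L.U y) : (L.c y z : X.presheaf.stalk z) =
    gm (V := L.U y ⊓ L.U z) (mem_inf h (L.mem z)) (L.g y z) := by rw [c_of_mem L h]; rfl

theorem c_self (L : LineBundle X) (y : X) : L.c y y = 1 := by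
  have h := L.cocycle y y y (L.U y ⊓ L.U y) le_rfl le_rfl le_rfl
  have h2 := congrArg (gm (V := L.U y ⊓ L.U y) (mem_inf (L.mem y) (L.mem y))) h
  rw [map_mul, gm_res, ← c_val L (L.mem y)] at h2
  exact mul_eq_left.1 (Units.ext h2)

/-- The germs of transition functions satisfy the cocycle condition. -/
theorem c_mul (L : LineBundle X) {x y z : X} (hx : z ∈ L.U x) (hy : z ∈ L.U y) :
    gm (V := L.U x ⊓ L.U y) (mem_inf hx hy) (L.g x y) * L.c y z = L.c x z := by
  have h := L.cocycle x y z (L.U x ⊓ L.U y ⊓ L.U z) inf_le_left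
    (le_inf (inf_le_left.trans inf_le_right) inf_le_right)
    (le_inf (inf_le_left.trans inf_le_left) inf_le_right)
  have h2 := congrArg (gm (V := L.U x ⊓ L.U y ⊓ L.U z) (mem_inf (mem_inf hx hy) (L.mem z))) h
  rwa [map_mul, gm_res, gm_res, gm_res, ← c_val L hx, ← c_val L hy] at h2

/-- Families of germs (in the frame at each point) which are locally given by sections. -/
def IsSec (L : LineBundle X) (σ : Germs X) : Prop :=
  ∀ y, ∃ V : X.Opens, y ∈ V ∧ V ≤ L.U y ∧ (fun z => (L.c y z : X.presheaf.stalk z) * σ z) ∈ reg V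

/-- The germs of a section. -/
def Sec.fn {L : LineBundle X} (s : L.Sec) : Germs X := fun z => gm (L.mem z) (s.val z)

theorem Sec.gm_val {L : LineBundle X} (s : L.Sec) {y z : X} (h : z ∈ L.U y) :
    gm h (s.val y) = L.c y z * s.fn z := by
  have h2 := congrArg (gm (V := L.U y ⊓ L.U z) (mem_inf h (L.mem z))) (s.compat y z)
  rwa [map_mul, gm_res, gm_res, ← c_val L h] at h2

theorem Sec.isSec {L : LineBundle X} (s : L.Sec) : L.IsSec s.fn := fun y =>
  ⟨L.U y, L.mem y, le_rfl, s.val y, fun _ hz => s.gm_val hz⟩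

/-- Near z ∈ `L.U y` the family is regular in the frame at z, and the transition function from z to
y carries this over to the frame at y; the local functions then glue. -/
theorem IsSec.reg {L : LineBundle X} {σ : Germs X} (h : L.IsSec σ) (y : X) :
    (fun z => (L.c y z : X.presheaf.stalk z) * σ z) ∈ reg (L.U y) := by
  refine reg_glue fun z hz => ?_
  obtain ⟨V, hzV, hV, hr⟩ := h z
  refine ⟨V ⊓ L.U y, ⟨hzV, hz⟩, ?_⟩
  obtain ⟨t, ht⟩ := hr
  refine ⟨res X (le_inf inf_le_right (inf_le_left.trans hV)) (L.g y z : Γ(X, L.U y ⊓ L.U z)) *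
    res X inf_le_left t, fun w hw => ?_⟩
  rw [map_mul, gm_res, gm_res, ht, ← mul_assoc, c_mul L hw.2 (hV hw.1)]

theorem IsSec.exists_sec {L : LineBundle X} {σ : Germs X} (h : L.IsSec σ) :
    ∃ s : L.Sec, s.fn = σ := by
  choose t ht using h.reg
  refine ⟨⟨t, fun x y => section_ext_gm fun z hz => ?_⟩, funext fun z => ?_⟩
  · rw [map_mul, gm_res, gm_res, ht, ht, ← mul_assoc, c_mul L hz.1 hz.2]
  · change gm (L.mem z) (t z) = _
    rw [ht]
    change (L.c z z : X.presheaf.stalk z) * σ z = σ z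
    rw [c_self, Units.val_one, one_mul]

theorem Sec.mem_nonvanishing {L : LineBundle X} (s : L.Sec) {z : X} :
    z ∈ s.nonvanishing ↔ IsUnit (s.fn z) := by
  simp only [Sec.nonvanishing, Opens.mem_iSup]
  constructor
  · rintro ⟨y, hy⟩
    have hz := X.basicOpen_le _ hy
    have := (mem_basicOpen_iff hz _).1 hy
    rw [s.gm_val hz] at this
    exact (Units.isUnit_units_mul _ _).1 this
  · intro h
    exact ⟨z, (mem_basicOpen_iff (L.mem z) _).2 h⟩

theorem c_zpow (L : LineBundle X) (n : ℤ) (y z : X) : (L.zpow n).c y z = L.c y z ^ n := by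
  by_cases h : z ∈ L.U y
  · rw [c_of_mem L h, ← map_zpow]; exact c_of_mem (L.zpow n) h
  · rw [c, c, dif_neg h, one_zpow]; exact dif_neg h

theorem c_tensor (L M : LineBundle X) {y z : X} (h : z ∈ L.U y) (h' : z ∈ M.U y) :
    (L.tensor M).c y z = L.c y z * M.c y z := by
  ext
  rw [Units.val_mul, c_val L h, c_val M h', c_val (L.tensor M) (mem_inf h h')]
  exact (map_mul (gm _) _ _).trans (congrArg₂ (· * ·) (gm_res _ _ _) (gm_res _ _ _))

theorem mem_commonU {ι : Type} [Fintype ι] (L : ι → LineBundle X) {y z : X} :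
    z ∈ commonU L y ↔ ∀ ρ, z ∈ (L ρ).U y := by
  change z ∈ ((Finset.univ.inf fun ρ => (L ρ).U y : X.Opens) : Set X) ↔ _
  rw [Opens.coe_finset_inf]
  simp [Finset.inf_eq_iInf]

theorem c_prod {ι : Type} [Fintype ι] (L : ι → LineBundle X) (a : ι → ℤ) {y z : X}
    (h : z ∈ commonU L y) : (prod L a).c y z = ∏ ρ, (L ρ).c y z ^ a ρ := by
  rw [c_of_mem (prod L a) h]
  change Units.map _ (∏ ρ, _ ^ a ρ) = _
  rw [map_prod]
  refine Finset.prod_congr rfl fun ρ _ => ?_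
  refine (map_zpow _ _ _).trans (congrArg (· ^ a ρ) (Units.ext ?_))
  rw [c_val (L ρ) (mem_commonU L |>.1 h ρ)]
  exact gm_res _ _ _

/-- Multiplication of sections: if the transition functions of `N` are `c_L * c_M` near each point,
products of sections of `L` and `M` are sections of `N`. -/
theorem IsSec.mul {L M N : LineBundle X} {σ τ : Germs X} (hσ : L.IsSec σ) (hτ : M.IsSec τ)
    (h : ∀ y, ∃ V : X.Opens, y ∈ V ∧ V ≤ N.U y ∧ ∀ z ∈ V, N.c y z = L.c y z * M.c y z) :
    N.IsSec (σ * τ) := fun y => by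
  obtain ⟨V, hy, hV, e⟩ := h y
  obtain ⟨V1, hy1, hV1, h1⟩ := hσ y
  obtain ⟨V2, hy2, hV2, h2⟩ := hτ y
  refine ⟨V ⊓ V1 ⊓ V2, ⟨⟨hy, hy1⟩, hy2⟩, (inf_le_left.trans inf_le_left).trans hV,
    reg_congr (fun z hz => ?_) (mul_mem (reg_mono (inf_le_left.trans inf_le_right) h1)
      (reg_mono inf_le_right h2))⟩
  rw [e z hz.1.1]
  simp only [Pi.mul_apply, Units.val_mul]
  ring

theorem IsSec.congr {L N : LineBundle X} {σ : Germs X} (hσ : L.IsSec σ)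
    (h : ∀ y, ∃ V : X.Opens, y ∈ V ∧ V ≤ N.U y ∧ ∀ z ∈ V, N.c y z = L.c y z) :
    N.IsSec σ := fun y => by
  obtain ⟨V, hy, hV, e⟩ := h y
  obtain ⟨V1, hy1, hV1, h1⟩ := hσ y
  refine ⟨V ⊓ V1, ⟨hy, hy1⟩, inf_le_left.trans hV,
    reg_congr (fun z hz => ?_) (reg_mono inf_le_right h1)⟩
  rw [e z hz.1]

theorem IsSec.pow {L : LineBundle X} {σ : Germs X} (hσ : L.IsSec σ) (k : ℕ) :
    (L.zpow k).IsSec (σ ^ k) := fun y => by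
  obtain ⟨V1, hy1, hV1, h1⟩ := hσ y
  refine ⟨V1, hy1, hV1, reg_congr (fun z hz => ?_) (pow_mem h1 k)⟩
  simp [c_zpow, mul_pow]

theorem IsSec.add {L : LineBundle X} {σ τ : Germs X} (hσ : L.IsSec σ) (hτ : L.IsSec τ) :
    L.IsSec (σ + τ) := fun y => by
  refine ⟨L.U y, L.mem y, le_rfl, reg_congr (fun z _ => ?_) (add_mem (hσ.reg y) (hτ.reg y))⟩
  simp [mul_add]

theorem IsSec.zero {L : LineBundle X} : L.IsSec 0 := fun y =>
  ⟨L.U y, L.mem y, le_rfl, reg_congr (fun z _ => by simp) (zero_mem _)⟩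

theorem zpow_zpow_isSec {L : LineBundle X} {σ : Germs X} {m n k : ℤ} (h : k = m * n) :
    ((L.zpow m).zpow n).IsSec σ ↔ (L.zpow k).IsSec σ := by
  simp only [IsSec, c_zpow, h, zpow_mul]; rfl

theorem zpow_one_isSec {L : LineBundle X} {σ : Germs X} : (L.zpow 1).IsSec σ ↔ L.IsSec σ := by
  simp only [IsSec, c_zpow, zpow_one]; rfl

theorem IsSec.pow_zpow {L : LineBundle X} {σ : Germs X} {m : ℤ} (hσ : (L.zpow m).IsSec σ)
    (k : ℕ) : (L.zpow (m * k)).IsSec (σ ^ k) :=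
  (zpow_zpow_isSec rfl).1 (hσ.pow k)

/-- The open set where a section, given by its germs, does not vanish. -/
def nv {L : LineBundle X} {σ : Germs X} (h : L.IsSec σ) : X.Opens where
  carrier := {z | IsUnit (σ z)}
  is_open' := by
    obtain ⟨s, rfl⟩ := h.exists_sec
    convert s.nonvanishing.isOpen using 1
    ext z
    exact s.mem_nonvanishing.symm

theorem mem_nv {L : LineBundle X} {σ : Germs X} (h : L.IsSec σ) {z : X} :
    z ∈ nv h ↔ IsUnit (σ z) := Iff.rfl

theorem isAmple_iff (L : LineBundle X) : L.IsAmple ↔ CompactSpace X ∧ ∀ x : X, ∃ n : ℕ, 1 ≤ n ∧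
    ∃ (σ : Germs X) (h : (L.zpow n).IsSec σ), x ∈ nv h ∧ IsAffineOpen (nv h) := by
  refine and_congr Iff.rfl (forall_congr' fun x => exists_congr fun n => and_congr Iff.rfl ?_)
  constructor
  · rintro ⟨s, h1, h2⟩
    have : nv s.isSec = s.nonvanishing := Opens.ext (Set.ext fun z => s.mem_nonvanishing.symm)
    exact ⟨s.fn, s.isSec, this ▸ h1, this ▸ h2⟩
  · rintro ⟨σ, h, h1, h2⟩
    obtain ⟨s, rfl⟩ := h.exists_sec
    have : nv h = s.nonvanishing := Opens.ext (Set.ext fun z => s.mem_nonvanishing.symm)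
    exact ⟨s, this ▸ h1, this ▸ h2⟩

end LineBundle

/-! ### Extending and annihilating functions by powers of another function. -/

section Reg

variable {X : Scheme.{0}}

theorem reg_pow_mul_eq_zero {O : X.Opens} (hO : IsCompact (O : Set X)) {s d : Germs X}
    (hs : s ∈ reg O) (hd : d ∈ reg O) (h : ∀ z ∈ O, IsUnit (s z) → d z = 0) :
    ∃ n : ℕ, ∀ z ∈ O, s z ^ n * d z = 0 := by
  obtain ⟨t, ht⟩ := hs
  obtain ⟨e, he⟩ := hd
  obtain ⟨n, hn⟩ := exists_pow_mul_eq_zero_of_res_basicOpen_eq_zero_of_isCompact X hO e t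
    (section_ext_gm fun z hz => by
      have hz' := X.basicOpen_le t hz
      rw [map_zero]
      refine (gm_res (X.basicOpen_le t) hz e).trans ?_
      rw [he]
      refine h z hz' ?_
      rw [← ht z hz']
      exact (mem_basicOpen_iff hz' t).1 hz)
  refine ⟨n, fun z hz => ?_⟩
  rw [← ht z hz, ← he z hz, ← map_pow, ← map_mul, hn, map_zero]

theorem reg_extend {W : X.Opens} (hW : IsAffineOpen W) {s a : Germs X} (hs : s ∈ reg W)
    (ha : ∀ z ∈ W, IsUnit (s z) → ∃ V : X.Opens, z ∈ V ∧ a ∈ reg V) :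
    ∃ (n : ℕ) (b : Germs X), b ∈ reg W ∧ ∀ z ∈ W, IsUnit (s z) → b z = s z ^ n * a z := by
  obtain ⟨t, ht⟩ := hs
  have hu : ∀ z (hz : z ∈ W), z ∈ X.basicOpen t ↔ IsUnit (s z) := fun z hz => by
    rw [mem_basicOpen_iff hz t, ht]
  have ha' : a ∈ reg (X.basicOpen t) := reg_glue fun z hz =>
    ha z (X.basicOpen_le t hz) ((hu z (X.basicOpen_le t hz)).1 hz)
  obtain ⟨a', ha'⟩ := ha'
  obtain ⟨n, b, e⟩ := exists_eq_pow_mul_of_isCompact_of_isQuasiSeparated X W hW.isCompact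
    hW.isQuasiSeparated t a'
  refine ⟨n, ext0 b, ext0_mem b, fun z hz hzu => ?_⟩
  have hz' := (hu z hz).2 hzu
  have e2 := congrArg (gm hz') e
  rw [map_mul, map_pow, ha'] at e2
  rw [ext0_apply b hz, ← ht z hz]
  refine (gm_res (X.basicOpen_le t) hz' b).symm.trans (e2.trans ?_)
  congr 2
  exact gm_res (X.basicOpen_le t) hz' t

end Reg

/-! ### Ample line bundles: affine nonvanishing loci and separation of points. -/

namespace LineBundle

variable {X : Scheme.{0}} {L : LineBundle X}

/-- On a small affine open the section is a function in a frame, and its nonvanishing locus is a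
basic open set. -/
theorem isAffineHom_nv {σ : Germs X} (h : L.IsSec σ) : IsAffineHom (nv h).ι := by
  refine isAffineHom_of_forall_exists_isAffineOpen _ fun x => ?_
  obtain ⟨_, ⟨U, hU, rfl⟩, hxU, hUL⟩ :=
    X.isBasis_affineOpens.exists_subset_of_mem_open (L.mem x) (L.U x).isOpen
  refine ⟨U, hxU, hU, ?_⟩
  obtain ⟨t, ht⟩ := reg_mono hUL (h.reg x)
  rw [← (Scheme.Opens.ι _).isAffineOpen_iff_of_isOpenImmersion]
  convert hU.basicOpen t using 1
  ext z
  constructor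
  · rintro ⟨w, hw, rfl⟩
    have hw' : (nv h).ι w ∈ U := hw
    refine (mem_basicOpen_iff hw' t).2 ?_
    rw [ht, Units.isUnit_units_mul]
    exact w.2
  · intro hz
    have hz' := X.basicOpen_le t hz
    have h1 := (mem_basicOpen_iff hz' t).1 hz
    rw [ht, Units.isUnit_units_mul] at h1
    exact ⟨⟨z, h1⟩, hz', rfl⟩

theorem isAffineOpen_inf_nv {σ : Germs X} (h : L.IsSec σ) {V : X.Opens} (hV : IsAffineOpen V) :
    IsAffineOpen (V ⊓ nv h) := by
  have := isAffineHom_nv h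
  have h1 := (hV.preimage (nv h).ι)
  rw [← (Scheme.Opens.ι _).isAffineOpen_iff_of_isOpenImmersion] at h1
  convert h1 using 1
  ext z
  constructor
  · rintro ⟨h1, h2⟩
    exact ⟨⟨z, h2⟩, h1, rfl⟩
  · rintro ⟨w, hw, rfl⟩
    exact ⟨hw, w.2⟩

/-- Transition functions cancel in the quotient τ/σ of two sections of the same bundle. -/
theorem quot_mem_reg {σ τ : Germs X} (hσ : L.IsSec σ) (hτ : L.IsSec τ) :
    (fun z => Ring.inverse (σ z) * τ z) ∈ reg (nv hσ) := by
  refine reg_glue fun z hz => ⟨L.U z ⊓ nv hσ, ⟨L.mem z, hz⟩, ?_⟩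
  have h1 := reg_mono (V := L.U z ⊓ nv hσ) inf_le_left (hσ.reg z)
  have h2 := reg_mono (V := L.U z ⊓ nv hσ) inf_le_left (hτ.reg z)
  have h3 : (fun y => (((L.c z y)⁻¹ : (X.presheaf.stalk y)ˣ) : X.presheaf.stalk y) *
      Ring.inverse (σ y)) ∈ reg (L.U z ⊓ nv hσ) := reg_inv h1 fun y hy => by
    have := Ring.mul_inverse_cancel _ hy.2
    calc _ = (((L.c z y) * (L.c z y)⁻¹ : (X.presheaf.stalk y)ˣ) : X.presheaf.stalk y) *
          (σ y * Ring.inverse (σ y)) := by rw [Units.val_mul]; ring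
      _ = 1 := by rw [this]; simp
  refine reg_congr (fun y hy => ?_) (mul_mem h3 h2)
  calc _ = (((L.c z y) * (L.c z y)⁻¹ : (X.presheaf.stalk y)ˣ) : X.presheaf.stalk y) *
          (Ring.inverse (σ y) * τ y) := by
        rw [Units.val_mul]; simp only [Pi.mul_apply]; ring
    _ = _ := by simp

/-- On the locus W of σ + τ, the functions σ/(σ+τ) and τ/(σ+τ) sum to 1. Their basic opens are W ∩
`nv hσ` and W ∩ `nv hτ`, which are affine, and hence so is W. -/
theorem isAffineOpen_nv_add {σ τ : Germs X} (hσ : L.IsSec σ) (hτ : L.IsSec τ)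
    (h1 : IsAffineOpen (nv hσ)) (h2 : IsAffineOpen (nv hτ)) :
    IsAffineOpen (nv (hσ.add hτ)) := by
  set W := nv (hσ.add hτ) with hW
  obtain ⟨a, ha⟩ := quot_mem_reg (hσ.add hτ) hσ
  obtain ⟨b, hb⟩ := quot_mem_reg (hσ.add hτ) hτ
  have hab : a + b = 1 := section_ext_gm fun z hz => by
    rw [map_add, ha, hb, map_one, ← mul_add]
    exact Ring.inverse_mul_cancel _ hz
  have key : ∀ {ρ : Germs X} (hρ : L.IsSec ρ) (t : Γ(X, W))
      (_ : ∀ z (hz : z ∈ W), gm hz t = Ring.inverse ((σ + τ) z) * ρ z)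
      (_ : IsAffineOpen (nv hρ)), IsAffineOpen (X.basicOpen t) := fun hρ t ht hn => by
    convert isAffineOpen_inf_nv (hσ.add hτ) hn using 1
    ext z
    constructor
    · intro hz
      have hz' := X.basicOpen_le t hz
      have := (mem_basicOpen_iff hz' t).1 hz
      rw [ht] at this
      exact ⟨isUnit_of_mul_isUnit_right this, hz'⟩
    · rintro ⟨hz, hz'⟩
      refine (mem_basicOpen_iff hz' t).2 ?_
      rw [ht]
      exact (IsUnit.ringInverse hz').mul hz
  refine isAffineOpen_of_isAffineOpen_basicOpen W {a, b} ?_ ?_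
  · rw [Ideal.eq_top_iff_one, ← hab]
    exact add_mem (Ideal.subset_span (by simp)) (Ideal.subset_span (by simp))
  · rintro i (rfl | rfl)
    · exact key hσ _ ha h1
    · exact key hτ _ hb h2

theorem c_div_mem_reg (L : LineBundle X) (y y' : X) :
    (fun z => ((L.c y z * (L.c y' z)⁻¹ : (X.presheaf.stalk z)ˣ) : X.presheaf.stalk z)) ∈
      reg (L.U y ⊓ L.U y') := by
  refine ⟨L.g y y', fun z hz => ?_⟩
  change _ = ((L.c y z * (L.c y' z)⁻¹ : (X.presheaf.stalk z)ˣ) : X.presheaf.stalk z)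
  rw [Units.val_mul, ← L.c_mul hz.1 hz.2, mul_assoc, ← Units.val_mul, mul_inv_cancel,
    Units.val_one, mul_one]

section Algebra

variable {R : Type*} [CommRing R] (u v : Rˣ) (s a : R)

theorem units_pow_sub (N : ℕ) :
    (u : R) ^ N * (s ^ N * a) - ((u * v⁻¹ : Rˣ) : R) ^ N * ((v : R) ^ N * (s ^ N * a)) = 0 := by
  rw [← mul_assoc (((u * v⁻¹ : Rˣ) : R) ^ N), ← mul_pow, ← Units.val_mul, inv_mul_cancel_right,
    sub_self]

theorem eq_zero_of_units_mul_pow (l : ℕ) (h : ((u : R) * s) ^ l * a = 0) : s ^ l * a = 0 := by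
  rw [mul_pow, mul_assoc, ← Units.val_pow_eq_pow_val] at h
  exact (Units.mul_right_eq_zero _).1 h

theorem units_pow_mul (N l : ℕ) : ((u * v⁻¹ : Rˣ) : R) ^ N * (((u : R) * s) ^ l * a) =
    ((u ^ ((N + l : ℕ) : ℤ) : Rˣ) : R) * (((v ^ N)⁻¹ : Rˣ) * (s ^ l * a)) := by
  rw [zpow_natCast, ← inv_pow]
  simp only [Units.val_mul, Units.val_pow_eq_pow_val]
  ring

theorem isUnit_add_of_not [IsLocalRing R] {x y : R} (hx : IsUnit x) (hy : ¬ IsUnit y) :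
    IsUnit (x + y) := by
  by_contra hc
  have := IsLocalRing.nonunits_add hc (fun h => hy (by simpa using IsUnit.neg h) : -y ∈ nonunits R)
  simp [hx] at this

end Algebra

/-- Functions on the nonvanishing locus of a section extend after multiplication with a power of
the section. -/
theorem exists_extend [IsNoetherian X] {σ a : Germs X} (hσ : L.IsSec σ) (ha : a ∈ reg (nv hσ)) :
    ∃ (k : ℕ) (τ : Germs X), 1 ≤ k ∧ (L.zpow k).IsSec τ ∧
      (∀ z ∈ nv hσ, τ z = σ z ^ k * a z) ∧ ∀ z ∉ nv hσ, ¬ IsUnit (τ z) := by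
  have hW : ∀ y, ∃ W : X.Opens, IsAffineOpen W ∧ y ∈ W ∧ W ≤ L.U y := fun y => by
    obtain ⟨_, ⟨U, hU, rfl⟩, hxU, hUL⟩ :=
      X.isBasis_affineOpens.exists_subset_of_mem_open (L.mem y) (L.U y).isOpen
    exact ⟨U, hU, hxU, hUL⟩
  choose W hWa hWm hWL using hW
  obtain ⟨T, hT⟩ := isCompact_univ.elim_finite_subcover (fun y => (W y : Set X))
    (fun y => (W y).isOpen) (fun y _ => Set.mem_iUnion.2 ⟨y, hWm y⟩)
  have hT' : ∀ z, ∃ y ∈ T, z ∈ W y := fun z => by simpa using hT (Set.mem_univ z)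
  choose f hfT hfW using hT'
  have hs : ∀ y, (fun z => (L.c y z : X.presheaf.stalk z) * σ z) ∈ reg (W y) := fun y =>
    reg_mono (hWL y) (hσ.reg y)
  have hb := fun y => reg_extend (hWa y) (hs y) (a := a) fun z hz hu =>
    ⟨nv hσ, (Units.isUnit_units_mul _ _).1 hu, ha⟩
  choose n b hb hb' using hb
  -- On the chart at y, a becomes regular after multiplication by the `n y`-th power of σ. Passing
  -- to the common exponent N makes `b' y` a local extension of σ^N a.
  set N := T.sup n with hN
  set b' : X → Germs X := fun y z => ((L.c y z : X.presheaf.stalk z) * σ z) ^ (N - n y) * b y z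
    with hb'def
  have hb'r : ∀ y, b' y ∈ reg (W y) := fun y => mul_mem (pow_mem (hs y) _) (hb y)
  have hb'e : ∀ y ∈ T, ∀ z ∈ W y, IsUnit (σ z) →
      b' y z = (L.c y z : X.presheaf.stalk z) ^ N * (σ z ^ N * a z) := fun y hy z hz hu => by
    have : n y ≤ N := Finset.le_sup hy
    rw [hb'def]
    dsimp only
    rw [hb' y z hz ((Units.isUnit_units_mul _ _).2 hu), ← mul_assoc, ← pow_add,
      Nat.sub_add_cancel this, mul_pow, mul_assoc]
  -- Two local extensions agree where σ is invertible, so on the overlap their difference is killed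
  -- by a power of σ.
  have hl : ∀ p : X × X, ∃ l : ℕ, p.1 ∈ T → p.2 ∈ T → ∀ z ∈ W p.1 ⊓ W p.2,
      σ z ^ l * (b' p.1 z - (L.c p.1 z * (L.c p.2 z)⁻¹ : (X.presheaf.stalk z)ˣ) ^ N * b' p.2 z)
        = 0 := by
    rintro ⟨y, y'⟩
    by_cases hy : y ∈ T
    swap
    · exact ⟨0, fun h => absurd h hy⟩
    by_cases hy' : y' ∈ T
    swap
    · exact ⟨0, fun _ h => absurd h hy'⟩
    have hg := reg_mono (inf_le_inf (hWL y) (hWL y')) (L.c_div_mem_reg y y')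
    obtain ⟨l, hl⟩ := reg_pow_mul_eq_zero (O := W y ⊓ W y') (NoetherianSpace.isCompact _)
      (reg_mono inf_le_left (hs y)) (sub_mem (reg_mono inf_le_left (hb'r y))
        (mul_mem (pow_mem hg N) (reg_mono inf_le_right (hb'r y')))) fun z hz hu => by
        have hu' := (Units.isUnit_units_mul _ _).1 hu
        change b' y z - ((L.c y z * (L.c y' z)⁻¹ : (X.presheaf.stalk z)ˣ) :
          X.presheaf.stalk z) ^ N * b' y' z = 0
        rw [hb'e y hy z hz.1 hu', hb'e y' hy' z hz.2 hu', units_pow_sub]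
    exact ⟨l, fun _ _ z hz => eq_zero_of_units_mul_pow _ _ _ _ (hl z hz)⟩
  choose l hl using hl
  set l0 := (T ×ˢ T).sup l with hl0
  -- The power l0 makes the local extensions agree. The additional factor σ makes the glued section
  -- vanish off `nv hσ` and its exponent positive.
  set τ : X → Germs X := fun y z => (((L.c y z) ^ N)⁻¹ : (X.presheaf.stalk z)ˣ) *
    (σ z ^ (l0 + 1) * b' y z) with hτ
  have hττ : ∀ y ∈ T, ∀ y' ∈ T, ∀ z, z ∈ W y → z ∈ W y' → τ y z = τ y' z := by
    intro y hy y' hy' z hz hz'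
    have h1 := hl (y, y') hy hy' z ⟨hz, hz'⟩
    have h2 : l (y, y') ≤ l0 := Finset.le_sup (Finset.mem_product.2 ⟨hy, hy'⟩)
    dsimp only at h1
    have h3 : σ z ^ (l0 + 1) * (b' y z - (L.c y z * (L.c y' z)⁻¹ : (X.presheaf.stalk z)ˣ) ^ N *
        b' y' z) = 0 := by
      rw [show l0 + 1 = (l0 + 1 - l (y, y')) + l (y, y') by omega, pow_add, mul_assoc, h1, mul_zero]
    rw [mul_sub, sub_eq_zero] at h3
    simp only [hτ]
    rw [h3, ← Units.val_pow_eq_pow_val, mul_pow, Units.val_mul]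
    have h4 : ((((L.c y z) ^ N)⁻¹ : (X.presheaf.stalk z)ˣ) : X.presheaf.stalk z) *
        ((L.c y z) ^ N : (X.presheaf.stalk z)ˣ) = 1 := Units.inv_mul _
    calc _ = (((((L.c y z) ^ N)⁻¹ : (X.presheaf.stalk z)ˣ) : X.presheaf.stalk z) *
        ((L.c y z) ^ N : (X.presheaf.stalk z)ˣ)) *
        ((((L.c y' z)⁻¹ ^ N : (X.presheaf.stalk z)ˣ) : X.presheaf.stalk z) *
          (σ z ^ (l0 + 1) * b' y' z)) := by ring
      _ = _ := by rw [h4, one_mul, inv_pow]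
  refine ⟨N + (l0 + 1), fun z => τ (f z) z, by omega, fun y => ?_, fun z hz => ?_, fun z hz hu => ?_⟩
  · refine ⟨W (f y) ⊓ L.U y, ⟨hfW y, L.mem y⟩, inf_le_right, ?_⟩
    have hg := reg_mono (V := W (f y) ⊓ L.U y) (le_inf inf_le_right (inf_le_left.trans (hWL _)))
      (L.c_div_mem_reg y (f y))
    have hr := mul_mem (pow_mem hg N) (mul_mem
      (pow_mem (reg_mono (V := W (f y) ⊓ L.U y) inf_le_right (hσ.reg y)) (l0 + 1))
      (reg_mono (V := W (f y) ⊓ L.U y) inf_le_left (hb'r (f y))))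
    refine reg_congr (fun z hz => ?_) hr
    change _ = ((L.zpow ↑(N + (l0 + 1))).c y z : X.presheaf.stalk z) * τ (f z) z
    rw [hττ (f z) (hfT z) (f y) (hfT y) z (hfW z) hz.1, c_zpow]
    exact units_pow_mul _ _ _ _ _ _
  · have hz' : IsUnit (σ z) := hz
    simp only [hτ]
    rw [hb'e (f z) (hfT z) z (hfW z) hz', ← Units.val_pow_eq_pow_val]
    calc _ = (((((L.c (f z) z) ^ N)⁻¹ : (X.presheaf.stalk z)ˣ) : X.presheaf.stalk z) *
        ((L.c (f z) z) ^ N : (X.presheaf.stalk z)ˣ)) *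
          (σ z ^ (N + (l0 + 1)) * a z) := by rw [pow_add (σ z) N]; ring
      _ = _ := by rw [Units.inv_mul, one_mul]
  · simp only [hτ] at hu
    rw [Units.isUnit_units_mul, pow_succ] at hu
    exact hz (isUnit_of_mul_isUnit_right (isUnit_of_mul_isUnit_left hu))

/-- Inside an affine `nv h` around z take a basic open D(a) missing Z. A power of the section times
a extends to all of X, and the nonvanishing locus of the extension is exactly D(a). -/
theorem exists_affine_avoid_point [IsNoetherian X] (hL : L.IsAmple) {z : X} {Z : Set X}
    (hZ : IsClosed Z) (hz : z ∉ Z) : ∃ (n : ℕ) (σ : Germs X) (h : (L.zpow n).IsSec σ), 1 ≤ n ∧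
      z ∈ nv h ∧ IsAffineOpen (nv h) ∧ ∀ y ∈ Z, y ∉ nv h := by
  obtain ⟨n, hn, σ, h, hzσ, hσ⟩ := (isAmple_iff L).1 hL |>.2 z
  obtain ⟨a, ha, hza⟩ := hσ.exists_basicOpen_le (V := ⟨Zᶜ, hZ.isOpen_compl⟩) ⟨z, hz⟩ hzσ
  obtain ⟨k, τ, hk, hτ, h1, h2⟩ := exists_extend h (ext0_mem a)
  have hτ' : (L.zpow ((n * k : ℕ) : ℤ)).IsSec τ := (zpow_zpow_isSec (by push_cast; ring)).1 hτ
  have e : nv hτ' = X.basicOpen a := by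
    ext y
    constructor
    · intro hy
      have hy' : y ∈ nv h := by by_contra hc; exact h2 y hc hy
      refine (mem_basicOpen_iff hy' a).2 ?_
      have hy2 : IsUnit (τ y) := hy
      rw [h1 y hy', ext0_apply a hy'] at hy2
      exact isUnit_of_mul_isUnit_right hy2
    · intro hy
      have hy' := X.basicOpen_le a hy
      change IsUnit (τ y)
      rw [h1 y hy', ext0_apply a hy']
      exact (IsUnit.pow k hy').mul ((mem_basicOpen_iff hy' a).1 hy)
  exact ⟨n * k, τ, hτ', Nat.mul_pos hn hk, e ▸ hza, e ▸ hσ.basicOpen a, fun y hy hy' =>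
    ha (e ▸ hy' : y ∈ X.basicOpen a) hy⟩

theorem nv_pow {σ : Germs X} {n : ℤ} (h : (L.zpow n).IsSec σ) {k : ℕ} (hk : 1 ≤ k) :
    nv (h.pow_zpow k) = nv h := by
  ext z
  exact isUnit_pow_iff (by omega)

/-- Sections of powers of an ample line bundle with affine nonvanishing locus separate finite sets
of closed points from closed sets. -/
theorem exists_affine_avoid [IsNoetherian X] (hL : L.IsAmple) (s : Finset X)
    (hs : ∀ z ∈ s, IsClosed {z}) {Z : Set X} (hZ : IsClosed Z) (hsZ : ∀ z ∈ s, z ∉ Z) :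
    ∃ (n : ℕ) (σ : Germs X) (h : (L.zpow n).IsSec σ), 1 ≤ n ∧
      (∀ z ∈ s, z ∈ nv h) ∧ IsAffineOpen (nv h) ∧ ∀ y ∈ Z, y ∉ nv h := by
  classical
  induction s using Finset.induction_on generalizing Z with
  | empty =>
    by_cases hX : ∃ z, z ∉ Z
    · obtain ⟨z, hz⟩ := hX
      obtain ⟨n, σ, h, h1, -, h2, h3⟩ := exists_affine_avoid_point hL hZ hz
      exact ⟨n, σ, h, h1, by simp, h2, h3⟩
    · push Not at hX
      have h0 : ∀ y, y ∉ nv (IsSec.zero (L := L.zpow (1 : ℕ))) := fun y hy => by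
        simpa using mem_nv _ |>.1 hy
      have : nv (IsSec.zero (L := L.zpow (1 : ℕ))) = ⊥ := by
        ext y
        exact iff_of_false (h0 y) id
      exact ⟨1, 0, IsSec.zero, le_rfl, by simp, this ▸ isAffineOpen_bot X, fun y _ => h0 y⟩
  | insert z s hzs ih =>
    have hzc : IsClosed {z} := hs z (by simp)
    have hsc : IsClosed (s : Set X) := by
      rw [← Set.biUnion_of_singleton (s : Set X)]
      exact s.finite_toSet.isClosed_biUnion fun y hy => hs y (by simp [Finset.mem_coe.1 hy])
    -- One section is nonzero on s and zero at z, the other is nonzero at z and zero on s, and both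
    -- vanish on Z. After equalizing exponents their sum does what is required.
    obtain ⟨n, σ, h, hn, h1, h2, h3⟩ := ih (fun y hy => hs y (by simp [hy])) (hZ.union hzc)
      (fun y hy => by
        rintro (h | h)
        · exact hsZ y (by simp [hy]) h
        · exact hzs (Set.mem_singleton_iff.1 h ▸ hy))
    obtain ⟨n', σ', h', hn', h1', h2', h3'⟩ := exists_affine_avoid_point hL (hZ.union hsc) (z := z)
      (by
        rintro (h | h)
        · exact hsZ z (by simp) h
        · exact hzs h)
    have e := h.pow_zpow n'
    have e' : (L.zpow ((n : ℤ) * n')).IsSec (σ' ^ n) := mul_comm (n : ℤ) n' ▸ h'.pow_zpow n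
    have hnv : nv e = nv h := nv_pow h hn'
    have hnv' : nv e' = nv h' := by
      ext z
      exact isUnit_pow_iff (by omega)
    refine ⟨n * n', σ ^ n' + σ' ^ n, by push_cast; exact e.add e', Nat.mul_pos hn hn', ?_, ?_, ?_⟩
    · intro y hy
      rcases Finset.mem_insert.1 hy with rfl | hy
      · have a1 : ¬ IsUnit ((σ ^ n') y) := fun hu => h3 y (Or.inr rfl) (hnv ▸ hu : y ∈ nv h)
        have a2 : IsUnit ((σ' ^ n) y) := (hnv'.symm ▸ h1' : y ∈ nv e')
        change IsUnit ((σ ^ n') y + (σ' ^ n) y)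
        rw [add_comm]
        exact isUnit_add_of_not a2 a1
      · have a1 : ¬ IsUnit ((σ' ^ n) y) := fun hu => h3' y (Or.inr hy) (hnv' ▸ hu : y ∈ nv h')
        have a2 : IsUnit ((σ ^ n') y) := (hnv.symm ▸ h1 y hy : y ∈ nv e)
        exact isUnit_add_of_not a2 a1
    · exact isAffineOpen_nv_add e e' (hnv ▸ h2) (hnv' ▸ h2')
    · intro y hy hu
      have a1 : ¬ IsUnit ((σ' ^ n) y) := fun hu => h3' y (Or.inl hy) (hnv' ▸ hu : y ∈ nv h')
      have a2 : ¬ IsUnit ((σ ^ n') y) := fun hu => h3 y (Or.inl hy) (hnv ▸ hu : y ∈ nv h)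
      exact IsLocalRing.nonunits_add a2 a1 hu

end LineBundle

/-! ### Commutative algebra for semiampleness -/

section CommAlg

open Polynomial

/-- Every chain of primes in a node has length at most one. -/
theorem isMaximal_of_lt_of_node {A : Type} [CommRing A] [IsLocalRing A] [IsNoetherianRing A]
    (e : AdicCompletion (IsLocalRing.maximalIdeal A) A ≃+* (MvPowerSeries (Fin 2) ℂ ⧸
      Ideal.span {(MvPowerSeries.X 0 * MvPowerSeries.X 1 : MvPowerSeries (Fin 2) ℂ)}))
    {P Q : Ideal A} (hP : P.IsPrime) (hQ : Q.IsPrime) (hPQ : P < Q) : Q.IsMaximal := by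
  set m := IsLocalRing.maximalIdeal A with hm
  let q : MvPowerSeries (Fin 2) ℂ →+* A ⧸ m ^ 3 :=
    ((AdicCompletion.evalₐ m 3).toRingHom.comp e.symm.toRingHom).comp (Ideal.Quotient.mk _)
  have hq : Function.Surjective q :=
    ((AdicCompletion.surjective_evalₐ m 3).comp e.symm.surjective).comp Ideal.Quotient.mk_surjective
  have hq0 : q (MvPowerSeries.X 0 * MvPowerSeries.X 1) = 0 := by
    have : (Ideal.Quotient.mk (Ideal.span {(MvPowerSeries.X 0 * MvPowerSeries.X 1 :
      MvPowerSeries (Fin 2) ℂ)})) (MvPowerSeries.X 0 * MvPowerSeries.X 1) = 0 :=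
      Ideal.Quotient.eq_zero_iff_mem.2 (Ideal.subset_span rfl)
    simp only [q, RingHom.comp_apply, this, map_zero]
  have hm3 : m ^ 3 ≤ m := Ideal.pow_le_self (by norm_num)
  have : Nontrivial (A ⧸ m ^ 3) := Ideal.Quotient.nontrivial_iff.2 fun h =>
    (IsLocalRing.maximalIdeal.isMaximal A).ne_top (top_le_iff.1 (h ▸ hm3))
  have hloc := IsLocalHom.of_surjective (Ideal.Quotient.mk (m ^ 3)) Ideal.Quotient.mk_surjective
  have hlocq := IsLocalHom.of_surjective q hq
  -- The element t lifts x + y modulo 𝔪³. Modulo xy one has (xg + yh)(xg' + yh') = (x + y)(xgg' +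
  -- yhh'), so 𝔪² ⊂ (t) + 𝔪³ and 𝔪² ⊂ (t) by Nakayama. Hence 𝔪 is minimal over (t), and Krull's
  -- theorem bounds its height by 1.
  obtain ⟨t, ht⟩ := Ideal.Quotient.mk_surjective (q (MvPowerSeries.X 0 + MvPowerSeries.X 1))
  have hmem : ∀ f : MvPowerSeries (Fin 2) ℂ, ∀ a ∈ m, Ideal.Quotient.mk (m ^ 3) a = q f →
      ∃ g h, f = MvPowerSeries.X 0 * g + MvPowerSeries.X 1 * h := by
    intro f a ha haf
    have h0 : MvPowerSeries.coeff 0 f = 0 := by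
      by_contra hc
      have hu : IsUnit f := MvPowerSeries.isUnit_iff_constantCoeff.2 (by
        rw [← MvPowerSeries.coeff_zero_eq_constantCoeff_apply]; exact isUnit_iff_ne_zero.2 hc)
      exact (IsLocalRing.mem_maximalIdeal _).1 ha ((isUnit_map_iff _ _).1 (haf ▸ hu.map q))
    -- The terms of f divisible by the first variable; the others are divisible by the second, since
    -- the constant term is zero.
    let g : MvPowerSeries (Fin 2) ℂ := fun n => if n 0 = 0 then 0 else MvPowerSeries.coeff n f
    have hg : ∀ n, MvPowerSeries.coeff n g = if n 0 = 0 then 0 else MvPowerSeries.coeff n f :=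
      fun n => rfl
    obtain ⟨g', hg'⟩ := (MvPowerSeries.X_dvd_iff (s := 0) (φ := g)).2 fun n hn => by simp [hg, hn]
    obtain ⟨h', hh'⟩ := (MvPowerSeries.X_dvd_iff (s := 1) (φ := f - g)).2 fun n hn => by
      rw [map_sub, hg]
      split_ifs with h
      · have : n = 0 := by
          ext i
          fin_cases i
          · exact h
          · exact hn
        rw [this, h0, sub_zero]
      · exact sub_self _
    exact ⟨g', h', by rw [← hg', ← hh']; ring⟩
  have h1 : m ^ 2 ≤ Ideal.span {t} ⊔ m • m ^ 2 := by
    rw [pow_two, Ideal.mul_le]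
    intro a ha b hb
    obtain ⟨f, hf⟩ := hq (Ideal.Quotient.mk _ a)
    obtain ⟨f', hf'⟩ := hq (Ideal.Quotient.mk _ b)
    obtain ⟨g, h, rfl⟩ := hmem f a ha hf.symm
    obtain ⟨g', h', rfl⟩ := hmem f' b hb hf'.symm
    have key : Ideal.Quotient.mk (m ^ 3) (a * b) = Ideal.Quotient.mk (m ^ 3) t *
        q (MvPowerSeries.X 0 * (g * g') + MvPowerSeries.X 1 * (h * h')) := by
      rw [map_mul, ← hf, ← hf', ht, ← map_mul, ← map_mul, ← sub_eq_zero, ← map_sub]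
      have : ∀ x y : MvPowerSeries (Fin 2) ℂ, (x * g + y * h) * (x * g' + y * h') -
          (x + y) * (x * (g * g') + y * (h * h')) =
          (x * y) * (g * h' + h * g' - g * g' - h * h') := by intros; ring
      rw [this, map_mul, hq0, zero_mul]
    obtain ⟨d, hd⟩ := Ideal.Quotient.mk_surjective
      (q (MvPowerSeries.X 0 * (g * g') + MvPowerSeries.X 1 * (h * h')))
    rw [← hd, ← map_mul, Ideal.Quotient.eq] at key
    have e1 : a * b = t * d + (a * b - t * d) := by ring
    rw [e1]
    refine Submodule.add_mem_sup (Ideal.mul_mem_right _ _ (Ideal.subset_span rfl)) ?_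
    rw [smul_eq_mul, ← pow_two, ← pow_succ']
    exact key
  have h2 : m ^ 2 ≤ Ideal.span {t} := Submodule.le_of_le_smul_of_le_jacobson_bot
    (IsNoetherian.noetherian _) (IsLocalRing.maximalIdeal_le_jacobson _) h1
  by_contra hQm
  have hQlt : Q < m := lt_of_le_of_ne (IsLocalRing.le_maximalIdeal hQ.ne_top) fun h =>
    hQm (h ▸ IsLocalRing.maximalIdeal.isMaximal A)
  have htm : t ∈ m := by
    rw [hm, IsLocalRing.mem_maximalIdeal]
    intro hu
    have hu2 := hu.map (Ideal.Quotient.mk (m ^ 3))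
    rw [ht] at hu2
    have := MvPowerSeries.isUnit_iff_constantCoeff.1 ((isUnit_map_iff _ _).1 hu2)
    simp at this
  have hmin : m ∈ (Ideal.span {t}).minimalPrimes := by
    refine ⟨⟨(IsLocalRing.maximalIdeal.isMaximal A).isPrime, ?_⟩, fun R hR _ => ?_⟩
    · rwa [Ideal.span_le, Set.singleton_subset_iff]
    · exact hR.1.le_of_pow_le (h2.trans hR.2)
  have hh := Ideal.height_le_one_of_isPrincipal_of_mem_minimalPrimes _ m hmin
  have h3 := Ideal.height_add_one_le_of_lt_of_isPrime hQlt
  have h4 := Ideal.height_add_one_le_of_lt_of_isPrime hPQ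
  have h5 : (1 : ℕ∞) ≤ Q.height := le_trans (by simp) h4
  have h6 : (1 + 1 : ℕ∞) ≤ 1 := (add_le_add_left h5 1).trans (h3.trans hh)
  exact absurd h6 (by decide)

/-- Powers of an element of `S` are, up to lower powers, sums of elements of two subrings, if one
of them is finite over a polynomial ring and the other inverts the variable. -/
theorem exists_monic_eval {k R S T : Type*} [Field k] [CommRing R] [CommRing S] [CommRing T]
    (cR : k →+* R) (cT : k →+* T) (f : R →+* S) (g : T →+* S)
    (hc : ∀ a, g (cT a) = f (cR a)) (x : R) (y : T) (hxy : f x * g y = 1)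
    (hfin : (eval₂RingHom cR x).Finite) (hS : ∀ a : S, ∃ l r, f x ^ l * a = f r)
    (hT : ∀ r : R, ∃ l t, g y ^ l * f r = g t) (h : S) :
    ∃ (P : k[X]) (r : R) (t : T), P.Monic ∧ 1 ≤ P.natDegree ∧
      eval₂ (f.comp cR) h P = f r + g t := by
  classical
  let _ : Algebra k S := (f.comp cR).toAlgebra
  let _ : Algebra k[X] R := (eval₂RingHom cR x).toAlgebra
  have hfin' : Module.Finite k[X] R := hfin
  obtain ⟨G, hG⟩ := hfin'.fg_top
  choose l t hlt using hT
  -- For a cover by two affine opens with rings R and T and overlap ring S, the quotient S / M is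
  -- the Čech H¹ of the structure sheaf. It is shown to be finite-dimensional, so the powers of h
  -- are linearly dependent modulo M.
  let M : Submodule k S :=
    { carrier := {a | ∃ r t, a = f r + g t}
      zero_mem' := ⟨0, 0, by simp⟩
      add_mem' := by
        rintro _ _ ⟨r, t, rfl⟩ ⟨r', t', rfl⟩
        exact ⟨r + r', t + t', by rw [map_add, map_add]; ring⟩
      smul_mem' := by
        rintro c _ ⟨r, t, rfl⟩
        refine ⟨cR c * r, cT c * t, ?_⟩
        rw [Algebra.smul_def, map_mul, map_mul, hc, mul_add]
        rfl }
  have hfM : ∀ r, f r ∈ M := fun r => ⟨r, 0, by simp⟩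
  have hgM : ∀ t, g t ∈ M := fun t => ⟨0, t, by simp⟩
  set N := G.sup l with hN
  -- E spans S modulo M: for n ≥ N the element yⁿr, with r ∈ G, already comes from T.
  let E : Finset S := (Finset.range N ×ˢ G).image fun p => g y ^ p.1 * f p.2
  have hxyn : ∀ n, f x ^ n * g y ^ n = 1 := fun n => by rw [← mul_pow, hxy, one_pow]
  have hmono : ∀ n : ℕ, ∀ r ∈ G, g y ^ n * f r ∈ M ⊔ Submodule.span k (E : Set S) := by
    intro n r hr
    by_cases hn : n < N
    · refine Submodule.mem_sup_right (Submodule.subset_span ?_)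
      exact Finset.mem_coe.2 (Finset.mem_image.2 ⟨(n, r), by simp [hn, hr], rfl⟩)
    · refine Submodule.mem_sup_left ?_
      have : l r ≤ n := (Finset.le_sup (f := l) hr).trans (not_lt.1 hn)
      rw [← Nat.sub_add_cancel this, pow_add, mul_assoc, hlt, ← map_pow, ← map_mul]
      exact hgM _
  -- As xy = 1, multiplying yⁿr by a power of x either lowers n or gives an element of f(R).
  have hmono2 : ∀ r, (∀ n, g y ^ n * f r ∈ M ⊔ Submodule.span k (E : Set S)) → ∀ j n : ℕ,
      g y ^ n * (f x ^ j * f r) ∈ M ⊔ Submodule.span k (E : Set S) := by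
    intro r hr j n
    rcases le_total j n with hjn | hjn
    · have : g y ^ n * (f x ^ j * f r) = g y ^ (n - j) * f r := by
        calc _ = g y ^ (n - j + j) * (f x ^ j * f r) := by rw [Nat.sub_add_cancel hjn]
          _ = (f x ^ j * g y ^ j) * (g y ^ (n - j) * f r) := by rw [pow_add]; ring
          _ = _ := by rw [hxyn, one_mul]
      rw [this]
      exact hr _
    · have : g y ^ n * (f x ^ j * f r) = f (x ^ (j - n) * r) := by
        calc _ = g y ^ n * (f x ^ (j - n + n) * f r) := by rw [Nat.sub_add_cancel hjn]
          _ = (f x ^ n * g y ^ n) * (f x ^ (j - n) * f r) := by rw [pow_add]; ring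
          _ = _ := by rw [hxyn, one_mul, map_mul, map_pow]
      rw [this]
      exact Submodule.mem_sup_left (hfM _)
  have hR : ∀ (r : R) (n : ℕ), g y ^ n * f r ∈ M ⊔ Submodule.span k (E : Set S) := by
    intro r
    have hr : r ∈ Submodule.span k[X] (G : Set R) := hG ▸ Submodule.mem_top
    induction hr using Submodule.span_induction with
    | mem r hr => exact fun n => hmono n r hr
    | zero => intro n; rw [map_zero, mul_zero]; exact zero_mem _
    | add r s _ _ hr hs => intro n; rw [map_add, mul_add]; exact add_mem (hr n) (hs n)
    | smul p r _ hr =>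
      induction p using Polynomial.induction_on' with
      | add p q hp hq => intro n; rw [add_smul, map_add, mul_add]; exact add_mem (hp n) (hq n)
      | monomial j a =>
        intro n
        have e1 : (monomial j a : k[X]) • r = cR a * x ^ j * r := by
          rw [Algebra.smul_def]
          exact congrArg (· * r) (eval₂_monomial cR x)
        have e2 : g y ^ n * f ((monomial j a : k[X]) • r) = a • (g y ^ n * (f x ^ j * f r)) := by
          rw [e1, Algebra.smul_def, map_mul, map_mul, map_pow]
          change _ = f (cR a) * _
          ring
        rw [e2]
        exact Submodule.smul_mem _ _ (hmono2 r hr j n)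
  have htop : M ⊔ Submodule.span k (E : Set S) = ⊤ := by
    refine eq_top_iff.2 fun a _ => ?_
    obtain ⟨n, r, hr⟩ := hS a
    have := hR r n
    rwa [← hr, ← mul_assoc, mul_comm (g y ^ n), hxyn, one_mul] at this
  have hfd : Module.Finite k (S ⧸ M) := by
    refine ⟨⟨E.image M.mkQ, ?_⟩⟩
    rw [Finset.coe_image, Submodule.span_image, ← Submodule.range_mkQ M, LinearMap.range_eq_map,
      ← htop, Submodule.map_sup, Submodule.mkQ_map_self, bot_sup_eq]
  -- The spans of h, …, hⁿ modulo M stabilize, so some power of h is a combination of lower positive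
  -- powers modulo M.
  let W : ℕ →o Submodule k (S ⧸ M) :=
    { toFun := fun n => Submodule.span k ((fun i => M.mkQ (h ^ (i + 1))) '' (Finset.range n : Set ℕ))
      monotone' := fun a b hab => Submodule.span_mono (Set.image_mono (by simpa using hab)) }
  obtain ⟨n, hn⟩ := monotone_stabilizes_iff_noetherian.2 (inferInstance : IsNoetherian k (S ⧸ M)) W
  have h1 : M.mkQ (h ^ (n + 1)) ∈ W n := by
    rw [hn (n + 1) (Nat.le_succ n)]
    exact Submodule.subset_span ⟨n, by simp, rfl⟩
  obtain ⟨c, hc'⟩ := (Submodule.mem_span_image_finset_iff_exists_fun k).1 h1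
  let c' : ℕ → k := fun i => if h : i ∈ Finset.range n then c ⟨i, h⟩ else 0
  let P : k[X] := X ^ (n + 1) - ∑ i ∈ Finset.range n, C (c' i) * X ^ (i + 1)
  have hPd : (∑ i ∈ Finset.range n, C (c' i) * X ^ (i + 1)).degree < ((n + 1 : ℕ) : WithBot ℕ) := by
    refine (degree_sum_le _ _).trans_lt ((Finset.sup_lt_iff (WithBot.bot_lt_coe _)).2 fun i hi => ?_)
    refine (degree_C_mul_X_pow_le _ _).trans_lt ?_
    exact_mod_cast Nat.succ_lt_succ (Finset.mem_range.1 hi)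
  have hPm : P.Monic := monic_X_pow_sub hPd
  have hPn : P.natDegree = n + 1 := natDegree_eq_of_degree_eq_some (by
    rw [degree_sub_eq_left_of_degree_lt (by rwa [degree_X_pow]), degree_X_pow])
  have h2 : eval₂ (f.comp cR) h P ∈ M := by
    rw [← Submodule.ker_mkQ M, LinearMap.mem_ker, eval₂_sub, map_sub, eval₂_X_pow, ← hc', sub_eq_zero,
      eval₂_finsetSum, map_sum,
      ← Finset.sum_coe_sort (Finset.range n)]
    refine Finset.sum_congr rfl fun i _ => ?_
    have e1 : c' i = c i := dif_pos i.2
    rw [e1, eval₂_mul, eval₂_C, eval₂_X_pow, ← map_smul, Algebra.smul_def]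
    rfl
  obtain ⟨r, t, hrt⟩ := h2
  exact ⟨P, r, t, hPm, by omega, hrt⟩

/-- The homogenization of a monic polynomial. -/
theorem exists_homogenization {k R : Type*} [Field k] [CommRing R] (c : k →+* R) {P : k[X]}
    (hP : P.Monic) (E x : R) : ∃ F G : R, F = E ^ P.natDegree + x * G ∧
      ∀ {S : Type _} [CommRing S] (f : R →+* S) (h : S), f x * h = f E →
        f F = f x ^ P.natDegree * eval₂ (f.comp c) h P := by
  have hs : ∀ k ∈ Finset.range P.natDegree, x ∣ c (P.coeff k) * E ^ k * x ^ (P.natDegree - k) :=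
    fun k hk => Dvd.dvd.mul_left (dvd_pow_self x (by have := Finset.mem_range.1 hk; omega)) _
  obtain ⟨G, hG⟩ := Finset.dvd_sum hs
  refine ⟨_, G, rfl, fun {S} _ f h hh => ?_⟩
  rw [← hG, eval₂_eq_sum_range, Finset.sum_range_succ, hP.coeff_natDegree, map_one, one_mul,
    mul_add, ← mul_pow, hh, map_add, map_pow, add_comm, map_sum, Finset.mul_sum]
  congr 1
  refine Finset.sum_congr rfl fun i hi => ?_
  have : f x ^ P.natDegree = f x ^ (P.natDegree - i) * f x ^ i := by
    rw [← pow_add]; congr 1; have := Finset.mem_range.1 hi; omega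
  rw [this, map_mul, map_mul, map_pow, map_pow, ← hh, mul_pow, RingHom.comp_apply]
  ring

/-- Separating a maximal ideal from the others in a one-dimensional situation. -/
theorem exists_separate {R : Type*} [CommRing R] [IsNoetherianRing R] (x : R)
    (hx : ∀ P : Ideal R, P.IsPrime → x ∈ P → P.IsMaximal) (m : Ideal R) (hm : m.IsMaximal) :
    ∃ (e e' c : R) (N : ℕ), e + e' = 1 ∧ 1 ≤ N ∧ e ∉ m ∧ (e * e') ^ N = x * c ∧
      ∀ P : Ideal R, P.IsPrime → x ∈ P → P ≠ m → e ∈ P ∧ e' ∉ P := by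
  classical
  have hmin : ∀ P : Ideal R, P.IsPrime → x ∈ P → P ∈ (Ideal.span {x}).minimalPrimes := by
    intro P hP hxP
    refine ⟨⟨hP, by rwa [Ideal.span_le, Set.singleton_subset_iff]⟩, fun Q hQ hQP => ?_⟩
    have := hx Q hQ.1 (hQ.2 (Ideal.subset_span rfl))
    exact (this.eq_of_le hP.ne_top hQP).ge
  have hfin := (Ideal.span {x}).finite_minimalPrimes_of_isNoetherianRing R
  let s : Finset (Ideal R) := (hfin.toFinset).erase m
  have hs : ∀ P, P ∈ s ↔ P.IsPrime ∧ x ∈ P ∧ P ≠ m := fun P => by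
    simp only [s, Finset.mem_erase, Set.Finite.mem_toFinset]
    constructor
    · rintro ⟨h1, h2⟩
      exact ⟨h2.1.1, h2.1.2 (Ideal.subset_span rfl), h1⟩
    · rintro ⟨h1, h2, h3⟩
      exact ⟨h3, hmin P h1 h2⟩
  -- The primes containing x are maximal and minimal over x, hence finite in number and pairwise
  -- comaximal. Write 1 = e' + e with e' ∈ m and e in all the others; then ee' lies in every prime
  -- containing x.
  have hcop : IsCoprime m (∏ P ∈ s, P) := IsCoprime.prod_right fun P hP => by
    have h := (hs P).1 hP
    rw [Ideal.isCoprime_iff_sup_eq]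
    exact hm.coprime_of_ne (hx P h.1 h.2.1) h.2.2.symm
  obtain ⟨e', he', e, he, hee⟩ := Ideal.isCoprime_iff_exists.1 hcop
  have heP : ∀ P : Ideal R, P.IsPrime → x ∈ P → P ≠ m → e ∈ P := fun P h1 h2 h3 =>
    (Ideal.prod_le_inf.trans (Finset.inf_le ((hs P).2 ⟨h1, h2, h3⟩))) he
  have hrad : e * e' ∈ (Ideal.span {x}).radical := by
    rw [Ideal.radical_eq_sInf, Submodule.mem_sInf]
    rintro P ⟨h1, h2⟩
    have hxP := h1 (Ideal.subset_span rfl)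
    by_cases h : P = m
    · exact h ▸ m.mul_mem_left _ he'
    · exact Ideal.mul_mem_right _ P (heP P h2 hxP h)
  obtain ⟨N, hN⟩ := hrad
  have hN' := (Ideal.span {x}).mul_mem_left (e * e') hN
  rw [← pow_succ'] at hN'
  obtain ⟨c, hc⟩ := Ideal.mem_span_singleton.1 hN'
  refine ⟨e, e', c, N + 1, by rw [add_comm, hee], by omega, fun h => ?_, hc, fun P h1 h2 h3 =>
    ⟨heP P h1 h2 h3, fun h => ?_⟩⟩
  · exact hm.ne_top ((Ideal.eq_top_iff_one _).2 (hee ▸ add_mem he' h))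
  · exact h1.ne_top ((Ideal.eq_top_iff_one _).2 (hee ▸ add_mem h (heP P h1 h2 h3)))

end CommAlg

/-! ### Points of curves -/

/-- Chains of specializations have length at most one. -/
def AtMostOneDim (X : Type) [TopologicalSpace X] : Prop :=
  ∀ a b c : X, a ⤳ b → b ⤳ c → a = b ∨ b = c

theorem specializes_closed_eq {X : Type} [TopologicalSpace X] {a b : X} (ha : IsClosed {a})
    (h : a ⤳ b) : b = a := h.mem_closed ha rfl

theorem exists_closed_specialization {X : Type} [TopologicalSpace X] [CompactSpace X] [T0Space X]
    (a : X) : ∃ b, IsClosed {b} ∧ a ⤳ b := by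
  obtain ⟨b, hb, hc⟩ := (isClosed_closure (s := {a})).exists_closed_singleton ⟨a, subset_closure rfl⟩
  exact ⟨b, hc, specializes_iff_mem_closure.2 hb⟩

section

variable {X : Scheme.{0}}

/-- The point with a given prime of a local ring. -/
def pointOf (p : X) (P : PrimeSpectrum (X.presheaf.stalk p)) : X := X.fromSpecStalk p P

theorem pointOf_injective (p : X) : Function.Injective (pointOf p) :=
  (X.fromSpecStalk p).isEmbedding.injective

theorem pointOf_specializes {p : X} {a b : PrimeSpectrum (X.presheaf.stalk p)} :
    pointOf p a ⤳ pointOf p b ↔ a ≤ b :=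
  (X.fromSpecStalk p).isEmbedding.isInducing.specializes_iff.trans
    (PrimeSpectrum.le_iff_specializes _ _).symm

theorem pointOf_closedPoint (p : X) : pointOf p (IsLocalRing.closedPoint _) = p :=
  Scheme.fromSpecStalk_closedPoint

theorem exists_pointOf {p y : X} : (∃ P, pointOf p P = y) ↔ y ⤳ p := by
  have : y ∈ Set.range (X.fromSpecStalk p) ↔ y ∈ {y | y ⤳ p} := by
    rw [Scheme.range_fromSpecStalk]
  exact this

/-- The last point of a chain of specializations specializes to a closed point p, and the chain
becomes a chain of primes in the local ring at p. -/
theorem atMostOneDim_of_stalks [CompactSpace X] (h : ∀ p : X, IsClosed {p} →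
    ∀ P Q : Ideal (X.presheaf.stalk p), P.IsPrime → Q.IsPrime → P < Q → Q.IsMaximal) :
    AtMostOneDim X := by
  intro a b c hab hbc
  obtain ⟨p, hp, hcp⟩ := exists_closed_specialization c
  by_contra hne
  push Not at hne
  obtain ⟨Q, rfl⟩ := exists_pointOf.2 (hbc.trans hcp)
  obtain ⟨P, rfl⟩ := exists_pointOf.2 (hab.trans (hbc.trans hcp))
  have hPQ : P < Q := lt_of_le_of_ne (pointOf_specializes.1 hab) fun h => hne.1 (h ▸ rfl)
  have hQ := h p hp P.asIdeal Q.asIdeal P.2 Q.2 hPQ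
  have hQ' : Q = IsLocalRing.closedPoint _ := PrimeSpectrum.ext (IsLocalRing.eq_maximalIdeal hQ)
  rw [hQ', pointOf_closedPoint] at hbc hne
  exact hne.2 (specializes_closed_eq hp hbc).symm

/-- A discrete valuation ring is the local ring of a point with a proper generization. -/
theorem exists_generization {p : X} (hp : IsSmoothPt X p) : ∃ η : X, η ⤳ p ∧ η ≠ p := by
  obtain ⟨_, _⟩ := hp
  refine ⟨pointOf p ⊥, exists_pointOf.1 ⟨_, rfl⟩, fun h => ?_⟩
  have h3 := congrArg PrimeSpectrum.asIdeal
    (pointOf_injective p (h.trans (pointOf_closedPoint p).symm))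
  exact IsDiscreteValuationRing.not_a_field (X.presheaf.stalk p) h3.symm

end

/-! ### Affine points -/

section Ev

variable {X : Scheme.{0}}

/-- Evaluation of functions along a morphism from an affine scheme. -/
def ev {A : Type} [CommRing A] (g : Spec (.of A) ⟶ X) (W : X.Opens) (h : ∀ p, g p ∈ W) :
    Γ(X, W) →+* A :=
  (Scheme.ΓSpecIso (.of A)).hom.hom.comp (g.appLE W ⊤ fun p _ => h p).hom

theorem ev_res {A : Type} [CommRing A] (g : Spec (.of A) ⟶ X) {W W' : X.Opens} (hW : W' ≤ W)
    (h : ∀ p, g p ∈ W') (t : Γ(X, W)) : ev g W' h (res X hW t) = ev g W (fun p => hW (h p)) t :=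
  congrArg (Scheme.ΓSpecIso (.of A)).hom.hom
    (LineBundle.pull_res g ⊤ hW (fun p _ => h p) t)

theorem ev_congr {A : Type} [CommRing A] {g g' : Spec (.of A) ⟶ X} (e : g = g') (W : X.Opens)
    (h : ∀ p, g p ∈ W) (h' : ∀ p, g' p ∈ W) (t : Γ(X, W)) : ev g W h t = ev g' W h' t := by
  subst e; rfl

theorem ev_comp {A B : Type} [CommRing A] [CommRing B] (g : Spec (.of A) ⟶ X) (f : A →+* B)
    (W : X.Opens) (h : ∀ p, g p ∈ W) (h' : ∀ p, (Spec.map (CommRingCat.ofHom f) ≫ g) p ∈ W)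
    (t : Γ(X, W)) : ev (Spec.map (CommRingCat.ofHom f) ≫ g) W h' t = f (ev g W h t) := by
  have h1 := Scheme.Hom.appLE_comp_appLE (Spec.map (CommRingCat.ofHom f)) g W ⊤ ⊤
    (fun p _ => h p) le_top
  have h2 := Scheme.ΓSpecIso_naturality (CommRingCat.ofHom f)
  have h3 : g.appLE W ⊤ (fun p _ => h p) ≫ (Spec.map (CommRingCat.ofHom f)).appTop ≫
      (Scheme.ΓSpecIso (.of B)).hom = (Spec.map (CommRingCat.ofHom f) ≫ g).appLE W ⊤
        (fun p _ => h' p) ≫ (Scheme.ΓSpecIso (.of B)).hom := by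
    rw [← h1, Category.assoc]
    congr 2
  rw [h2] at h3
  exact (congrArg (fun k => k.hom t) h3).symm

theorem ev_fromSpec {U : X.Opens} (hU : IsAffineOpen U) (h : ∀ p, hU.fromSpec p ∈ U)
    (t : Γ(X, U)) : ev (A := Γ(X, U)) hU.fromSpec U h t = t := by
  have h1 := hU.fromSpec_app_self
  have h2 : hU.fromSpec.appLE U ⊤ (fun p _ => h p) ≫ (Scheme.ΓSpecIso Γ(X, U)).hom = 𝟙 _ := by
    change (hU.fromSpec.app U ≫ (Spec Γ(X, U)).presheaf.map
      (homOfLE fun p _ => h p : ⊤ ⟶ hU.fromSpec ⁻¹ᵁ U).op) ≫ _ = _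
    rw [h1, Category.assoc, Category.assoc, ← Functor.map_comp_assoc]
    have : ∀ f : Opposite.op (⊤ : (Spec Γ(X, U)).Opens) ⟶ Opposite.op ⊤,
        (Spec Γ(X, U)).presheaf.map f = 𝟙 _ := fun f => by
      rw [Subsingleton.elim f (𝟙 _)]; exact CategoryTheory.Functor.map_id _ _
    rw [this, Category.id_comp, Iso.inv_hom_id]
  exact congrArg (fun k => k.hom t) h2

theorem isUnit_ev {A : Type} [CommRing A] (g : Spec (.of A) ⟶ X) (W : X.Opens) (h : ∀ p, g p ∈ W)
    (t : Γ(X, W)) (ht : IsUnit (ev g W h t)) (p) : g p ∈ X.basicOpen t := by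
  have h1 : IsUnit ((g.appLE W ⊤ fun p _ => h p).hom t) := by
    have := ht.map (Scheme.ΓSpecIso (.of A)).inv.hom
    simpa [ev] using this
  have h2 := Scheme.basicOpen_appLE g ⊤ W (fun p _ => h p) t
  rw [Scheme.basicOpen_of_isUnit _ h1] at h2
  have : p ∈ (⊤ : (Spec (.of A)).Opens) ⊓ g ⁻¹ᵁ X.basicOpen t := h2 ▸ trivial
  exact this.2

theorem fromSpec_const (π : X ⟶ Spec (.of ℂ)) {U : X.Opens} (hU : IsAffineOpen U) :
    hU.fromSpec ≫ π = Spec.map (CommRingCat.ofHom (const π U)) := by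
  have h := IsAffineOpen.SpecMap_appLE_fromSpec π (isAffineOpen_top _) hU le_top
  rw [← h, IsAffineOpen.fromSpec_top, Scheme.isoSpec_Spec_inv, ← Spec.map_comp]
  rfl

/-- The existence part of the valuative criterion. -/
theorem exists_lift {Y : Scheme.{0}} (π : X ⟶ Y) [IsProper π] {R K : Type} [CommRing R] [IsDomain R]
    [ValuationRing R] [Field K] [Algebra R K] [IsFractionRing R K] (i₁ : Spec (.of K) ⟶ X)
    (i₂ : Spec (.of R) ⟶ Y)
    (h : i₁ ≫ π = Spec.map (CommRingCat.ofHom (algebraMap R K)) ≫ i₂) :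
    ∃ l : Spec (.of R) ⟶ X, Spec.map (CommRingCat.ofHom (algebraMap R K)) ≫ l = i₁ ∧ l ≫ π = i₂ := by
  have hex : ValuativeCriterion.Existence π := by
    have : IsProper π := inferInstance
    rw [IsProper.eq_valuativeCriterion] at this
    exact this.1.1.1.existence
  obtain ⟨⟨l, hl1, hl2⟩⟩ := hex ⟨R, K, _, _, ⟨h⟩⟩
  exact ⟨l, hl1, hl2⟩

/-- If `X = U ∪ V` is proper, `x y = 1` on `U ∩ V` and `y` is not invertible outside `U`, then the
functions on `U` are integral over `ℂ[x]`. -/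
theorem isIntegral_of_cover (π : X ⟶ Spec (.of ℂ)) [IsProper π] {U V : X.Opens}
    (hU : IsAffineOpen U) (hUV : ∀ z, z ∈ U ∨ z ∈ V) (x : Γ(X, U)) (y : Γ(X, V))
    (hxy : res X (inf_le_left : U ⊓ V ≤ U) x * res X (inf_le_right : U ⊓ V ≤ V) y = 1)
    (hy : X.basicOpen y ≤ U) : (Polynomial.eval₂RingHom (const π U) x).IsIntegral := by
  -- An affine universally closed morphism is integral, so it suffices to verify the valuative
  -- criterion for Spec Γ(U) → 𝔸¹. Properness of X first yields a lift to X.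
  have huc : UniversallyClosed
      (Spec.map (CommRingCat.ofHom (Polynomial.eval₂RingHom (const π U) x))) := by
    refine UniversallyClosed.of_valuativeCriterion _ fun S => ?_
    obtain ⟨α, hα⟩ : ∃ α : Γ(X, U) →+* S.K, S.i₁ = Spec.map (CommRingCat.ofHom α) :=
      ⟨(Spec.preimage S.i₁).hom, (Spec.map_preimage _).symm⟩
    obtain ⟨β, hβ⟩ : ∃ β : Polynomial ℂ →+* S.R, S.i₂ = Spec.map (CommRingCat.ofHom β) :=
      ⟨(Spec.preimage S.i₂).hom, (Spec.map_preimage _).symm⟩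
    have hcomm : (algebraMap S.R S.K).comp β =
        α.comp (Polynomial.eval₂RingHom (const π U) x) := by
      have h := S.commSq.w
      rw [hα, hβ, ← Spec.map_comp, ← Spec.map_comp] at h
      exact congrArg CommRingCat.Hom.hom (Spec.map_injective h).symm
    have hsq : (Spec.map (CommRingCat.ofHom α) ≫ hU.fromSpec) ≫ π =
        Spec.map (CommRingCat.ofHom (algebraMap S.R S.K)) ≫
          Spec.map (CommRingCat.ofHom (β.comp Polynomial.C)) := by
      rw [Category.assoc, fromSpec_const, ← Spec.map_comp, ← Spec.map_comp]
      congr 1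
      ext a
      have := congrArg (fun k => k (Polynomial.C a)) hcomm
      simpa using this.symm
    obtain ⟨l, hl1, hl2⟩ := exists_lift π _ _ hsq
    have hgU : ∀ p, (Spec.map (CommRingCat.ofHom α) ≫ hU.fromSpec) p ∈ U := fun p =>
      hU.range_fromSpec.subset ⟨_, rfl⟩
    have hαU : ∀ t, ev (Spec.map (CommRingCat.ofHom α) ≫ hU.fromSpec) U hgU t = α t := fun t => by
      have h : ∀ p, hU.fromSpec p ∈ U := fun p => hU.range_fromSpec.subset ⟨_, rfl⟩
      rw [ev_comp (A := Γ(X, U)) hU.fromSpec α U h, ev_fromSpec hU h]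
    have hnhd : ∀ W : X.Opens, l (IsLocalRing.closedPoint S.R) ∈ W → ∀ p, l p ∈ W := fun W hW p =>
      ((IsLocalRing.specializes_closedPoint p).map l.continuous).mem_open W.isOpen hW
    have hlW : ∀ (W : X.Opens) (h : ∀ p, l p ∈ W) (p),
        (Spec.map (CommRingCat.ofHom (algebraMap S.R S.K)) ≫ l) p ∈ W := fun W h p => h _
    -- If the closed point went outside U, it would go to V. The image of x lies in the valuation
    -- ring and xy = 1, so y would be a unit along the lift, and the lift would meet only
    -- `X.basicOpen y` ≤ U.
    have hlU : ∀ p, l p ∈ U := by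
      by_cases hc : l (IsLocalRing.closedPoint S.R) ∈ U
      · exact hnhd U hc
      exfalso
      have hlV := hnhd V ((hUV _).resolve_left hc)
      have hgV : ∀ p, (Spec.map (CommRingCat.ofHom α) ≫ hU.fromSpec) p ∈ V := fun p => by
        have := hlW V hlV p
        rwa [hl1] at this
      have e := congrArg (ev (Spec.map (CommRingCat.ofHom α) ≫ hU.fromSpec) (U ⊓ V)
        (fun p => mem_inf (hgU p) (hgV p))) hxy
      rw [map_mul, map_one, ev_res, ev_res, hαU, ← ev_congr hl1 V (hlW V hlV),
        ev_comp l _ V hlV] at e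
      have e2 := congrArg (fun k => k Polynomial.X) hcomm
      simp only [RingHom.comp_apply, Polynomial.coe_eval₂RingHom, Polynomial.eval₂_X] at e2
      rw [← e2, ← map_mul, ← map_one (algebraMap S.R S.K)] at e
      exact hc (hy (isUnit_ev l V hlV y (IsUnit.of_mul_eq_one_right _ (IsFractionRing.injective S.R S.K e)) _))
    have hαl : ∀ t, algebraMap S.R S.K (ev l U hlU t) = α t := fun t => by
      rw [← hαU, ← ev_congr hl1 U (hlW U hlU), ev_comp l _ U hlU]
    refine CommSq.HasLift.mk' ⟨Spec.map (CommRingCat.ofHom (ev l U hlU)), ?_, ?_⟩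
    · rw [hα, ← Spec.map_comp]
      congr 1
      ext t
      exact hαl t
    · rw [hβ, ← Spec.map_comp]
      refine congrArg Spec.map (CommRingCat.hom_ext (RingHom.ext fun p => ?_))
      refine IsFractionRing.injective S.R S.K ((hαl _).trans ?_)
      exact (congrArg (fun k => k p) hcomm).symm
  have := (IsIntegralHom.iff_universallyClosed_and_isAffineHom
    (f := Spec.map (CommRingCat.ofHom (Polynomial.eval₂RingHom (const π U) x)))).2
      ⟨huc, inferInstance⟩
  exact IsIntegralHom.SpecMap_iff.1 this

end Ev

/-! ### Closed subsets of curves, and pairs of sections without common zeros. -/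

section Curves

variable {X : Scheme.{0}}

theorem isNoetherian_of_proper (π : X ⟶ Spec (.of ℂ)) [IsProper π] : IsNoetherian X := by
  have : IsLocallyNoetherian X := LocallyOfFiniteType.isLocallyNoetherian π
  have : CompactSpace X := (quasiCompact_iff_compactSpace π).mp inferInstance
  exact {}

/-- In dimension one, closed sets without generic points are finite sets of closed points. -/
theorem finite_of_isClosed [IsNoetherian X] (hX : AtMostOneDim X) {Z : Set X} (hZ : IsClosed Z)
    (h : ∀ z ∈ Z, ∃ η, η ⤳ z ∧ η ∉ Z) : Z.Finite ∧ ∀ z ∈ Z, IsClosed {z} := by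
  have hc : ∀ z ∈ Z, IsClosed {z} := fun z hz => by
    obtain ⟨η, hη, hηZ⟩ := h z hz
    obtain ⟨p, hp, hzp⟩ := exists_closed_specialization z
    rcases hX η z p hη hzp with rfl | rfl
    · exact absurd hz hηZ
    · exact hp
  refine ⟨?_, hc⟩
  obtain ⟨S, hS, hSi, hSZ⟩ := NoetherianSpace.exists_finite_set_isClosed_irreducible hZ
  rw [hSZ.2]
  refine hS.sUnion fun s hs => ?_
  obtain ⟨z, hz⟩ := QuasiSober.sober (hSZ.1 s hs) (hSi s hs)
  have hzZ : z ∈ Z := hSZ.2 ▸ Set.mem_sUnion_of_mem (hz.mem) hs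
  have : s = {z} := by rw [← hz.def, (hc z hzZ).closure_eq]
  rw [this]
  exact Set.finite_singleton z

theorem exists_generic (z : X) : ∃ η : X, closure {η} = irreducibleComponent z := by
  obtain ⟨η, hη⟩ := QuasiSober.sober (isIrreducible_irreducibleComponent (x := z))
    isClosed_irreducibleComponent
  exact ⟨η, hη.def⟩

end Curves

namespace LineBundle

variable {X : Scheme.{0}} {L : LineBundle X}

/-- Two sections of a power of an ample line bundle on a curve without common zeros, such that the
second vanishes at a given point. -/
theorem exists_two_sections [IsNoetherian X] (hX : AtMostOneDim X) (hL : L.IsAmple) {b : X}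
    (hb : IsClosed {b}) : ∃ (n : ℕ) (σ τ : Germs X) (hσ : (L.zpow n).IsSec σ)
      (hτ : (L.zpow n).IsSec τ), IsAffineOpen (nv hσ) ∧ IsAffineOpen (nv hτ) ∧
      IsUnit (σ b) ∧ ¬ IsUnit (τ b) ∧ ∀ z, IsUnit (σ z) ∨ IsUnit (τ z) := by
  classical
  have hcp : ∀ s ∈ irreducibleComponents X, ∃ p ∈ s, IsClosed {p} := fun s hs =>
    (isClosed_of_mem_irreducibleComponents s hs).exists_closed_singleton
      (hs.1.nonempty)
  have : Nonempty X := ⟨b⟩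
  choose! p hps hpc using hcp
  have hfin := NoetherianSpace.finite_irreducibleComponents (α := X)
  -- σ is nonzero at b and at a closed point of every component, so its zeros are finitely many
  -- closed points. Then τ is chosen nonzero at these and zero at b.
  obtain ⟨n, σ, hσ, hn, h1, h2, -⟩ := exists_affine_avoid hL (insert b (hfin.toFinset.image p))
    (fun z hz => by
      rcases Finset.mem_insert.1 hz with rfl | hz
      · exact hb
      · obtain ⟨s, hs, rfl⟩ := Finset.mem_image.1 hz
        exact hpc s (hfin.mem_toFinset.1 hs)) isClosed_empty (fun _ _ h => h)
  obtain ⟨hZf, hZc⟩ := finite_of_isClosed hX (nv hσ).isOpen.isClosed_compl fun z hz => by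
    obtain ⟨η, hη⟩ := exists_generic z
    have hs : irreducibleComponent z ∈ irreducibleComponents X :=
      irreducibleComponent_mem_irreducibleComponents z
    have hspec : ∀ y ∈ irreducibleComponent z, η ⤳ y := fun y hy =>
      specializes_iff_mem_closure.2 (hη ▸ hy)
    refine ⟨η, hspec z mem_irreducibleComponent, fun hc => hc ?_⟩
    refine (hspec _ (hps _ hs)).mem_open (nv hσ).isOpen (h1 _ ?_)
    exact Finset.mem_insert_of_mem (Finset.mem_image_of_mem _ (hfin.mem_toFinset.2 hs))
  obtain ⟨m, τ, hτ, hm, h1', h2', h3'⟩ := exists_affine_avoid hL hZf.toFinset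
    (fun z hz => hZc z (hZf.mem_toFinset.1 hz)) hb (fun z hz hzb => by
      rw [Set.mem_singleton_iff.1 hzb] at hz
      exact hZf.mem_toFinset.1 hz (h1 b (Finset.mem_insert_self _ _)))
  have e := hσ.pow_zpow m
  have e' : (L.zpow ((n : ℤ) * m)).IsSec (τ ^ n) := mul_comm (n : ℤ) m ▸ hτ.pow_zpow n
  have hnv : nv e = nv hσ := nv_pow hσ hm
  have hnv' : nv e' = nv hτ := by
    ext z
    exact isUnit_pow_iff (by omega)
  have e1 : ((n * m : ℕ) : ℤ) = n * m := by push_cast; ring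
  refine ⟨n * m, σ ^ m, τ ^ n, e1 ▸ e, e1 ▸ e', ?_, ?_, ?_, ?_, ?_⟩
  · convert h2 using 1
  · convert h2' using 1
  · exact IsUnit.pow m (h1 b (Finset.mem_insert_self _ _))
  · exact fun hu => h3' b rfl ((isUnit_pow_iff (by omega)).1 hu)
  · intro z
    by_cases hz : z ∈ nv hσ
    · exact Or.inl (IsUnit.pow m hz)
    · exact Or.inr (IsUnit.pow n (h1' z (hZf.mem_toFinset.2 hz)))

end LineBundle

/-! ### Functions with a single pole, and removing zeros of sections at nonsingular points. -/

section Pole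

variable {X : Scheme.{0}}

theorem exists_pow_mul_res {W D : X.Opens} (hW : IsAffineOpen W) (t : Γ(X, W))
    (hD : D = X.basicOpen t) (h : D ≤ W) (a : Γ(X, D)) :
    ∃ (n : ℕ) (b : Γ(X, W)), res X h t ^ n * a = res X h b := by
  subst hD
  obtain ⟨n, b, e⟩ := exists_eq_pow_mul_of_isCompact_of_isQuasiSeparated X W hW.isCompact
    hW.isQuasiSeparated t a
  exact ⟨n, b, e.symm⟩

theorem finiteType_const (π : X ⟶ Spec (.of ℂ)) [LocallyOfFiniteType π] {U : X.Opens}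
    (hU : IsAffineOpen U) : (const π U).FiniteType := by
  have h := π.finiteType_appLE (isAffineOpen_top _) hU le_top
  have h2 : (Scheme.ΓSpecIso (.of ℂ)).inv.hom.FiniteType :=
    RingHom.FiniteType.of_surjective _
      (ConcreteCategory.bijective_of_isIso (Scheme.ΓSpecIso (.of ℂ)).inv).2
  exact h.comp h2

theorem res_const (π : X ⟶ Spec (.of ℂ)) {U V : X.Opens} (h : V ≤ U) (a : ℂ) :
    res X h (const π U a) = const π V a := res_res X _ _ _

theorem eq_of_comap_eq {U : X.Opens} (hU : IsAffineOpen U) {z b : X} (hz : z ∈ U) (hb : b ∈ U)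
    (h : (IsLocalRing.maximalIdeal (X.presheaf.stalk z)).comap (gm hz) =
      (IsLocalRing.maximalIdeal (X.presheaf.stalk b)).comap (gm hb)) : z = b := by
  have key : ∀ {z b : X} (hz : z ∈ U) (hb : b ∈ U)
      (_ : (IsLocalRing.maximalIdeal (X.presheaf.stalk z)).comap (gm hz) =
      (IsLocalRing.maximalIdeal (X.presheaf.stalk b)).comap (gm hb)), z ⤳ b := by
    intro z b hz hb h
    rw [specializes_iff_forall_open]
    intro W hW hbW
    obtain ⟨f, hf, hbf⟩ := hU.exists_basicOpen_le (V := ⟨W, hW⟩) ⟨b, hbW⟩ hb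
    refine hf ((mem_basicOpen_iff hz f).2 ?_)
    have h1 := (mem_basicOpen_iff hb f).1 hbf
    by_contra hc
    have h2 : f ∈ (IsLocalRing.maximalIdeal (X.presheaf.stalk z)).comap (gm hz) := hc
    rw [h] at h2
    exact h2 h1
  exact ((key hz hb h).antisymm (key hb hz h.symm)).eq

/-- On a proper curve there are functions with a pole of positive order at a given nonsingular
point as their only pole. -/
theorem exists_pole (π : X ⟶ Spec (.of ℂ)) [IsProper π] {U V : X.Opens}
    (hU : IsAffineOpen U) (hV : IsAffineOpen V) (hUV : ∀ z, z ∈ U ∨ z ∈ V) (x : Γ(X, U))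
    (y : Γ(X, V))
    (hxy : res X (inf_le_left : U ⊓ V ≤ U) x * res X (inf_le_right : U ⊓ V ≤ V) y = 1)
    (hx : X.basicOpen x ≤ V) (hy : X.basicOpen y ≤ U) {b : X} (hb : IsClosed {b}) (hbU : b ∈ U)
    (hxb : ¬ IsUnit (gm hbU x)) :
    ∃ (h : Germs X) (F : Γ(X, U)) (O : X.Opens) (K : ℕ), h ∈ reg ⟨{b}ᶜ, hb.isOpen_compl⟩ ∧
      1 ≤ K ∧ b ∈ O ∧ O ≤ U ∧ IsUnit (gm hbU F) ∧
      ∀ z (hz : z ∈ U), z ∈ O → z ≠ b → IsUnit (gm hz x) ∧ gm hz F = gm hz x ^ K * h z := by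
  classical
  have hDx : U ⊓ V = X.basicOpen x := by
    refine le_antisymm (fun z hz => (mem_basicOpen_iff hz.1 x).2 ?_)
      (le_inf (X.basicOpen_le x) hx)
    have := congrArg (gm (V := U ⊓ V) hz) hxy
    rw [map_mul, map_one, gm_res, gm_res] at this
    exact IsUnit.of_mul_eq_one _ this
  have hDy : U ⊓ V = X.basicOpen y := by
    refine le_antisymm (fun z hz => (mem_basicOpen_iff hz.2 y).2 ?_)
      (le_inf hy (X.basicOpen_le y))
    have := congrArg (gm (V := U ⊓ V) hz) hxy
    rw [map_mul, map_one, gm_res, gm_res] at this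
    exact IsUnit.of_mul_eq_one_right _ this
  -- Properness makes Γ(U) finite over ℂ[x]. This gives both the finiteness needed in
  -- `exists_monic_eval` and the maximality of all primes containing x.
  have hint := isIntegral_of_cover π hU hUV x y hxy hy
  have hfin : (Polynomial.eval₂RingHom (const π U) x).Finite := by
    refine hint.to_finite (RingHom.FiniteType.of_comp_finiteType (f := Polynomial.C) ?_)
    convert finiteType_const π hU
    ext a
    simp
  have : IsNoetherianRing Γ(X, U) := by
    have := isNoetherian_of_proper π
    exact IsLocallyNoetherian.component_noetherian ⟨U, hU⟩
  have hmax : ∀ P : Ideal Γ(X, U), P.IsPrime → x ∈ P → P.IsMaximal := by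
    intro P hP hxP
    have h1 : (P.comap (Polynomial.eval₂RingHom (const π U) x)).IsMaximal := by
      refine (hP.comap _).isMaximal fun h0 => Polynomial.X_ne_zero (R := ℂ) ?_
      rw [← Ideal.mem_bot, ← h0, Ideal.mem_comap, Polynomial.coe_eval₂RingHom, Polynomial.eval₂_X]
      exact hxP
    exact Ideal.isMaximal_of_isIntegral_of_isMaximal_comap' _ hint P h1
  let I : ∀ z, z ∈ U → Ideal Γ(X, U) := fun z hz =>
    (IsLocalRing.maximalIdeal (X.presheaf.stalk z)).comap (gm hz)
  have hI : ∀ z (hz : z ∈ U) (t : Γ(X, U)), t ∈ I z hz ↔ ¬ IsUnit (gm hz t) := fun z hz t => Iff.rfl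
  have hIp : ∀ z (hz : z ∈ U), (I z hz).IsPrime := fun z hz => Ideal.comap_isPrime _ _
  -- e is invertible at b and vanishes at the other zeros of x, where e' is invertible.
  obtain ⟨e, e', c', N, hee, hN, heb, hxc, hsep⟩ := exists_separate x hmax (I b hbU)
    (hmax _ (hIp b hbU) hxb)
  set f : Γ(X, U) →+* Γ(X, U ⊓ V) := res X inf_le_left with hf
  set g : Γ(X, V) →+* Γ(X, U ⊓ V) := res X inf_le_right with hg
  -- h0 = e^N / x is singular at b, while near the other zeros of x it equals c' / e'^N and is
  -- regular.
  set h0 : Γ(X, U ⊓ V) := f e ^ N * g y with hh0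
  -- P(h0) = a + c with a regular on U and c regular on V. So c = P(h0) - a extends regularly over
  -- all zeros of x except b.
  obtain ⟨P, a, c, hPm, hPd, hPe⟩ := exists_monic_eval (const π U) (const π V) f g
    (fun a => by rw [res_const, res_const]) x y hxy hfin
    (fun a => exists_pow_mul_res hU x hDx inf_le_left a)
    (fun r => by
      obtain ⟨n, t, h⟩ := exists_pow_mul_res hV y hDy inf_le_right (f r)
      exact ⟨n, t, h⟩) h0
  obtain ⟨F0, G, hF0, hF⟩ := exists_homogenization (const π U) hPm (e ^ N) x
  -- the function near the other zeros of `x`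
  obtain ⟨ie, hie⟩ : ∃ ie, res X (X.basicOpen_le e') e' * ie = 1 :=
    (X.toRingedSpace.isUnit_res_basicOpen e').exists_right_inv
  let t1 : Γ(X, X.basicOpen e') := Polynomial.eval₂ (const π _) (res X (X.basicOpen_le e') c' * ie ^ N) P
    - res X (X.basicOpen_le e') a
  have hgmP : ∀ z (hz : z ∈ U) (hz' : z ∈ V), Polynomial.eval₂ ((gm hz).comp (const π U))
      (gm hz e ^ N * gm hz' y) P = gm hz a + gm hz' c := by
    intro z hz hz'
    have := congrArg (gm (mem_inf hz hz')) hPe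
    rw [Polynomial.hom_eval₂, map_add, gm_res, gm_res, hh0, map_mul, map_pow, gm_res, gm_res] at this
    rw [← this]
    congr 1
    ext a
    exact (gm_res inf_le_left (mem_inf hz hz') (const π U a)).symm
  have hgxy : ∀ z (hz : z ∈ U) (hz' : z ∈ V), gm hz x * gm hz' y = 1 := by
    intro z hz hz'
    have := congrArg (gm (mem_inf hz hz')) hxy
    rwa [map_mul, map_one, gm_res, gm_res] at this
  have ht1 : ∀ z (hz : z ∈ X.basicOpen e') (hz' : z ∈ V), gm hz t1 = gm hz' c := by
    intro z hz hz'
    have hzU := X.basicOpen_le e' hz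
    have h1 : gm hz ie * gm hzU e' = 1 := by
      have := congrArg (gm hz) hie
      rwa [map_mul, map_one, gm_res, mul_comm] at this
    have h2 := congrArg (gm hzU) hxc
    rw [map_pow, map_mul, map_mul, mul_pow] at h2
    have h3 : gm hzU c' * gm hz ie ^ N = gm hzU e ^ N * gm hz' y := by
      calc _ = (gm hzU x * gm hz' y) * (gm hzU c' * gm hz ie ^ N) := by rw [hgxy, one_mul]
        _ = gm hz' y * gm hz ie ^ N * (gm hzU x * gm hzU c') := by ring
        _ = (gm hz ie * gm hzU e') ^ N * (gm hzU e ^ N * gm hz' y) := by rw [← h2]; ring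
        _ = _ := by rw [h1, one_pow, one_mul]
    rw [map_sub, Polynomial.hom_eval₂, map_mul, map_pow, gm_res, gm_res, h3,
      sub_eq_iff_eq_add', ← hgmP z hzU hz']
    congr 1
    ext a
    simp only [RingHom.comp_apply]
    rw [← res_const π (X.basicOpen_le e'), gm_res]
  have hsepz : ∀ z (hz : z ∈ U), z ∉ V → z ≠ b → e ∈ I z hz ∧ e' ∉ I z hz := fun z hz hzV hzb =>
    hsep _ (hIp z hz) (fun hu => hzV (hx ((mem_basicOpen_iff hz x).2 hu)))
      fun h => hzb (eq_of_comap_eq hU hz hbU h)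
  -- With d = deg P ≥ 1, x^d (P(e^N/x) - a) has the form e^{Nd} + x(…). It is a unit at b, so the
  -- pole of c at b has exactly the order of x^d.
  refine ⟨fun z => if z ∈ V then ext0 c z else ext0 t1 z, F0 - a * x ^ P.natDegree, X.basicOpen e,
    P.natDegree, ?_, hPd, (mem_basicOpen_iff hbU e).2 (not_not.1 heb), X.basicOpen_le e, ?_, ?_⟩
  · refine reg_glue fun z hz => ?_
    by_cases hzV : z ∈ V
    · exact ⟨V, hzV, reg_congr (fun w hw => (if_pos hw).symm) (ext0_mem c)⟩
    · have hzU := (hUV z).resolve_right hzV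
      refine ⟨X.basicOpen e', (mem_basicOpen_iff hzU e').2
        (not_not.1 (hsepz z hzU hzV hz).2), reg_congr (fun w hw => ?_) (ext0_mem t1)⟩
      by_cases hwV : w ∈ V
      · rw [if_pos hwV, ext0_apply _ hwV, ext0_apply _ hw, ht1 w hw hwV]
      · rw [if_neg hwV]
  · have : F0 - a * x ^ P.natDegree = (e ^ N) ^ P.natDegree +
        x * (G - a * x ^ (P.natDegree - 1)) := by
      have h1 : x ^ P.natDegree = x * x ^ (P.natDegree - 1) := by
        rw [← pow_succ', Nat.sub_add_cancel hPd]
      rw [hF0, h1]; ring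
    rw [this, map_add, map_pow, map_pow, map_mul]
    exact LineBundle.isUnit_add_of_not (((not_not.1 heb).pow N).pow _)
      fun hu => hxb (isUnit_of_mul_isUnit_left hu)
  · intro z hz hzO hzb
    have hzV : z ∈ V := by
      by_contra hzV
      exact (hsepz z hz hzV hzb).1 ((mem_basicOpen_iff hz e).1 hzO)
    refine ⟨IsUnit.of_mul_eq_one _ (hgxy z hz hzV), ?_⟩
    have h1 := hF (gm hz) (gm hz e ^ N * gm hzV y) (by
      rw [mul_left_comm, hgxy, mul_one, map_pow])
    rw [hgmP z hz hzV] at h1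
    beta_reduce
    rw [map_sub, h1, if_pos hzV, ext0_apply _ hzV, map_mul, map_pow]
    ring

/-- A section of a line bundle, not identically zero at a nonsingular point `b`, gives a section of
some power which does not vanish at `b`. -/
theorem exists_sec_isUnit (π : X ⟶ Spec (.of ℂ)) [IsProper π] (hX : AtMostOneDim X)
    {H : LineBundle X} (hH : H.IsAmple) {L : LineBundle X} {w : Germs X} (hw : L.IsSec w) {b : X}
    (hb : IsClosed {b}) (hbs : IsSmoothPt X b) (hwb : w b ≠ 0) :
    ∃ (v : ℕ) (W : Germs X), 1 ≤ v ∧ (L.zpow v).IsSec W ∧ IsUnit (W b) := by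
  classical
  have := isNoetherian_of_proper π
  obtain ⟨n, σ, τ, hσ, hτ, hσa, hτa, hσb, hτb, hστ⟩ := LineBundle.exists_two_sections hX hH hb
  obtain ⟨x, hx⟩ := LineBundle.quot_mem_reg hσ hτ
  obtain ⟨y, hy⟩ := LineBundle.quot_mem_reg hτ hσ
  have hxu : ∀ z (hz : z ∈ LineBundle.nv hσ), IsUnit (gm hz x) ↔ IsUnit (τ z) := fun z hz => by
    rw [hx]
    exact ⟨isUnit_of_mul_isUnit_right, fun h => (IsUnit.ringInverse hz).mul h⟩
  have hyu : ∀ z (hz : z ∈ LineBundle.nv hτ), IsUnit (gm hz y) ↔ IsUnit (σ z) := fun z hz => by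
    rw [hy]
    exact ⟨isUnit_of_mul_isUnit_right, fun h => (IsUnit.ringInverse hz).mul h⟩
  have hbU : b ∈ LineBundle.nv hσ := hσb
  have hxb : ¬ IsUnit (gm hbU x) := fun h => hτb ((hxu b hbU).1 h)
  obtain ⟨h, F, O, K, hh, hK, hbO, hOU, hFb, hF⟩ := exists_pole π hσa hτa hστ x y
    (section_ext_gm fun z hz => by
      rw [map_mul, gm_res, gm_res, hx, hy, map_one]
      calc _ = (Ring.inverse (σ z) * σ z) * (Ring.inverse (τ z) * τ z) := by ring
        _ = 1 := by rw [Ring.inverse_mul_cancel _ hz.1, Ring.inverse_mul_cancel _ hz.2, one_mul])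
    (fun z hz => (hxu z (X.basicOpen_le x hz)).1 ((mem_basicOpen_iff _ x).1 hz))
    (fun z hz => (hyu z (X.basicOpen_le y hz)).1 ((mem_basicOpen_iff _ y).1 hz)) hb hbU hxb
  -- A generization of b other than b lies in O, where x is invertible. Hence x is nonzero at b and
  -- has a finite order there.
  have hx0 : gm hbU x ≠ 0 := by
    intro h0
    obtain ⟨V, hbV, h1, h2, h3⟩ := reg_eq_nhd (ext0_mem x) (zero_mem (reg (⊤ : X.Opens))) hbU
      (Opens.mem_top b) (by rw [ext0_apply x hbU, h0]; rfl)
    obtain ⟨η, hη, hηb⟩ := exists_generization hbs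
    have hηO : η ∈ O ⊓ V := hη.mem_open (O ⊓ V).isOpen (mem_inf hbO hbV)
    have h4 := (hF η (hOU hηO.1) hηO.1 hηb).1
    have h5 := h3 η hηO.2
    rw [ext0_apply x (hOU hηO.1)] at h5
    rw [h5] at h4
    exact not_isUnit_zero h4
  -- p and q are the orders of x and w in the discrete valuation ring at b.
  obtain ⟨p, q, μ, hp, hμ⟩ : ∃ (p q : ℕ) (μ : (X.presheaf.stalk b)ˣ), 1 ≤ p ∧
      w b ^ p = μ * gm hbU x ^ q := by
    obtain ⟨_, _⟩ := hbs
    obtain ⟨ϖ, hϖ⟩ := IsDiscreteValuationRing.exists_irreducible (X.presheaf.stalk b)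
    obtain ⟨p, u, hu⟩ := IsDiscreteValuationRing.eq_unit_mul_pow_irreducible hx0 hϖ
    obtain ⟨q, u', hu'⟩ := IsDiscreteValuationRing.eq_unit_mul_pow_irreducible hwb hϖ
    refine ⟨p, q, u' ^ p * (u ^ q)⁻¹, ?_, ?_⟩
    · rcases Nat.eq_zero_or_pos p with rfl | hp
      · exact absurd (by rw [hu, pow_zero, mul_one]; exact u.isUnit) hxb
      · exact hp
    · rw [hu, hu', mul_pow, mul_pow, ← pow_mul, ← pow_mul, mul_comm q p, ← mul_assoc,
        ← Units.val_pow_eq_pow_val, ← Units.val_pow_eq_pow_val, ← Units.val_mul,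
        inv_mul_cancel_right]
  obtain ⟨V, hbV, m, hm⟩ := exists_gm_eq (μ : X.presheaf.stalk b)
  obtain ⟨W, hbW, hW1, hW2, hW⟩ := reg_eq_nhd (pow_mem (hw.reg b) p)
    (mul_mem (reg_mono (V := V ⊓ LineBundle.nv hσ) inf_le_left (ext0_mem m))
      (pow_mem (reg_mono (V := V ⊓ LineBundle.nv hσ) inf_le_right (ext0_mem x)) q)) (L.mem b)
      (mem_inf hbV hbU) (by
        simp only [Pi.pow_apply, Pi.mul_apply]
        rw [ext0_apply m hbV, ext0_apply x hbU, L.c_self, Units.val_one, one_mul, hm, hμ])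
  -- Near b, off b, one has h = F / x^K and w^p = m x^q, so in h^q w^{pK} the powers of x cancel and
  -- m^K F^q remains, which is invertible at b.
  refine ⟨p * K, fun z => if z = b then ext0 m z ^ K * ext0 F z ^ q
    else h z ^ q * w z ^ (p * K), Nat.mul_pos hp hK, fun z => ?_, ?_⟩
  · by_cases hzb : z = b
    · subst hzb
      refine ⟨O ⊓ W, ⟨hbO, hbW⟩, inf_le_right.trans hW1, ?_⟩
      have hr := mul_mem (pow_mem (reg_mono (V := O ⊓ W) (inf_le_right.trans (hW2.trans inf_le_left))
        (ext0_mem m)) K) (pow_mem (reg_mono (V := O ⊓ W) (inf_le_left.trans hOU) (ext0_mem F)) q)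
      refine reg_congr (fun y hy => ?_) hr
      simp only [Pi.mul_apply, Pi.pow_apply]
      split_ifs with hyz
      · subst hyz
        rw [LineBundle.c_self, Units.val_one, one_mul]
      · obtain ⟨-, h2⟩ := hF y (hOU hy.1) hy.1 hyz
        have h3 := hW y hy.2
        simp only [Pi.mul_apply, Pi.pow_apply] at h3
        rw [ext0_apply F (hOU hy.1), h2, LineBundle.c_zpow, zpow_natCast, Units.val_pow_eq_pow_val]
        rw [ext0_apply x (hOU hy.1)] at h3
        calc _ = (ext0 m y * gm (hOU hy.1) x ^ q) ^ K * h y ^ q := by ring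
          _ = _ := by rw [← h3]; ring
    · refine ⟨L.U z ⊓ ⟨{b}ᶜ, hb.isOpen_compl⟩, ⟨L.mem z, hzb⟩, inf_le_left, ?_⟩
      refine reg_congr (fun y hy => ?_) (mul_mem
        (pow_mem (reg_mono (V := L.U z ⊓ ⟨{b}ᶜ, hb.isOpen_compl⟩) inf_le_right hh) q)
        (pow_mem (reg_mono inf_le_left (hw.reg z)) (p * K)))
      have hyb : y ≠ b := hy.2
      beta_reduce
      rw [if_neg hyb, LineBundle.c_zpow, zpow_natCast, Units.val_pow_eq_pow_val]
      simp only [Pi.mul_apply, Pi.pow_apply]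
      ring
  · beta_reduce
    rw [if_pos rfl, ext0_apply m hbV, hm, ext0_apply F hbU]
    exact (μ.isUnit.pow K).mul (hFb.pow q)

end Pole

/-! ### Trivializations, products of sections, and ample tensor semiample. -/

namespace LineBundle

variable {X : Scheme.{0}}

/-- The section of a line bundle which a trivialization takes to `1`. -/
def Triv.one {L : LineBundle X} (T : L.Triv) : Germs X :=
  fun z => (((Units.map (gm (L.mem z)).toMonoidHom (T.val z))⁻¹ : (X.presheaf.stalk z)ˣ) :
    X.presheaf.stalk z)

theorem Triv.isUnit_one {L : LineBundle X} (T : L.Triv) (z : X) : IsUnit (T.one z) := Units.isUnit _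

theorem Triv.gm_val {L : LineBundle X} (T : L.Triv) {y z : X} (h : z ∈ L.U y) :
    gm h (T.val y : Γ(X, L.U y)) * L.c y z = gm (L.mem z) (T.val z : Γ(X, L.U z)) := by
  have h2 := congrArg (gm (V := L.U y ⊓ L.U z) (mem_inf h (L.mem z))) (T.compat y z)
  rwa [map_mul, gm_res, gm_res, ← c_val L h] at h2

theorem Triv.isSec_one {L : LineBundle X} (T : L.Triv) : L.IsSec T.one := fun y => by
  refine ⟨L.U y, L.mem y, le_rfl, ((T.val y)⁻¹ : (Γ(X, L.U y))ˣ), fun z hz => ?_⟩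
  have h1 := T.gm_val hz
  have h2 : gm hz (T.val y : Γ(X, L.U y)) * gm hz (((T.val y)⁻¹ : (Γ(X, L.U y))ˣ) : Γ(X, L.U y)) = 1 := by
    rw [← map_mul, Units.mul_inv, map_one]
  have h3 : gm (L.mem z) (T.val z : Γ(X, L.U z)) * T.one z = 1 :=
    Units.mul_inv (Units.map (gm (L.mem z)).toMonoidHom (T.val z))
  calc _ = gm hz (((T.val y)⁻¹ : (Γ(X, L.U y))ˣ) : Γ(X, L.U y)) *
        (gm (L.mem z) (T.val z : Γ(X, L.U z)) * T.one z) := by rw [h3, mul_one]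
    _ = (gm hz (T.val y : Γ(X, L.U y)) * gm hz (((T.val y)⁻¹ : (Γ(X, L.U y))ˣ) : Γ(X, L.U y))) *
        (L.c y z * T.one z) := by rw [← h1]; ring
    _ = _ := by rw [h2, one_mul]

variable {ι : Type} [Fintype ι] {L : ι → LineBundle X}

theorem commonU_mem (L : ι → LineBundle X) (y : X) : y ∈ commonU L y :=
  (mem_commonU L).2 fun ρ => (L ρ).mem y

theorem IsSec.prod_pow {u : ι → Germs X} (hu : ∀ ρ, (L ρ).IsSec (u ρ)) (a : ι → ℕ) :
    (prod L fun ρ => (a ρ : ℤ)).IsSec (∏ ρ, u ρ ^ a ρ) := fun y => by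
  refine ⟨commonU L y, commonU_mem L y, le_rfl, ?_⟩
  refine reg_congr (fun z hz => ?_) (prod_mem (t := Finset.univ) fun ρ _ =>
    pow_mem (reg_mono (commonU_le L y ρ) ((hu ρ).reg y)) (a ρ))
  rw [c_prod L _ hz, Finset.prod_apply, Finset.prod_apply, Units.coe_prod, ← Finset.prod_mul_distrib]
  refine Finset.prod_congr rfl fun ρ _ => ?_
  simp [mul_pow]

theorem IsSec.prod_add {σ τ : Germs X} {a b d : ι → ℤ} (hσ : (prod L a).IsSec σ)
    (hτ : (prod L b).IsSec τ) (h : d = a + b) : (prod L d).IsSec (σ * τ) :=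
  hσ.mul hτ fun y => ⟨commonU L y, commonU_mem L y, le_rfl, fun z hz => by
    rw [c_prod L _ hz, c_prod L _ hz, c_prod L _ hz, ← Finset.prod_mul_distrib]
    refine Finset.prod_congr rfl fun ρ _ => ?_
    rw [h, Pi.add_apply, zpow_add]⟩

/-- If `A^{b₁} ⊗ 𝓛_α^{a₁}` is ample and `𝓛_{α''}` is semiample, then `A^b ⊗ 𝓛_{α'}^a` is ample,
where `N α' = α + α''` and `(N b, a) = g (b₁, a₁)`. -/
theorem isAmple_of_semiample (A : LineBundle X) {α α' α'' : ι → ℤ} {a a₁ b b₁ g N : ℕ}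
    (hN : 1 ≤ N) (hg : 1 ≤ g) (ha : 1 ≤ a) (hα : (N : ℤ) • α' = α + α'') (hb : N * b = g * b₁)
    (haa : a = g * a₁) (h1 : ((A.zpow b₁).tensor ((prod L α).zpow a₁)).IsAmple)
    (h2 : ∀ x, ∃ (k : ℕ) (W : Germs X), 1 ≤ k ∧ ((prod L α'').zpow k).IsSec W ∧ IsUnit (W x)) :
    ((A.zpow b).tensor ((prod L α').zpow a)).IsAmple := by
  rw [isAmple_iff] at h1 ⊢
  refine ⟨h1.1, fun x => ?_⟩
  obtain ⟨j, hj, s, hs, hxs, hsa⟩ := h1.2 x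
  obtain ⟨k, W, hk, hW, hxW⟩ := h2 x
  -- The exponents gk and aj make both factors fit into the (Njk)-th power of the bundle. The
  -- product vanishes nowhere on `nv hs` ∩ `nv hW`, which is affine because the inclusion of `nv hW`
  -- is an affine morphism.
  have h3 := (hs.pow_zpow (g * k)).mul (hW.pow_zpow (a * j))
    (N := ((A.zpow b).tensor ((prod L α').zpow a)).zpow (N * j * k : ℕ)) fun y => by
      refine ⟨A.U y ⊓ commonU L y, ⟨A.mem y, commonU_mem L y⟩, le_rfl, fun z hz => ?_⟩
      have e : ∀ (n m : ℤ) (β : ι → ℤ), ((A.zpow n).tensor ((prod L β).zpow m)).c y z =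
          A.c y z ^ n * (∏ ρ, (L ρ).c y z ^ β ρ) ^ m := fun n m β => by
        rw [c_tensor _ _ (show z ∈ (A.zpow n).U y from hz.1)
          (show z ∈ ((prod L β).zpow m).U y from hz.2), c_zpow, c_zpow, c_prod L _ hz.2]
      have e2 : (∏ ρ, (L ρ).c y z ^ α' ρ) ^ (N : ℤ) =
          (∏ ρ, (L ρ).c y z ^ α ρ) * ∏ ρ, (L ρ).c y z ^ α'' ρ := by
        rw [← Finset.prod_zpow, ← Finset.prod_mul_distrib]
        refine Finset.prod_congr rfl fun ρ _ => ?_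
        have := congrFun hα ρ
        simp only [Pi.smul_apply, Pi.add_apply, smul_eq_mul] at this
        rw [← zpow_mul, ← zpow_add, ← this, mul_comm]
      rw [c_zpow, c_zpow, c_zpow, e, e, c_prod L _ hz.2]
      have e3 : (b : ℤ) * (N * j * k : ℕ) = b₁ * (j * (g * k : ℕ)) := by
        have : (N : ℤ) * b = g * b₁ := by exact_mod_cast hb
        push_cast
        linear_combination (j * k : ℤ) * this
      have e4 : (a : ℤ) * (N * j * k : ℕ) = N * (k * (a * j : ℕ)) := by push_cast; ring
      have e5 : (a₁ : ℤ) * (j * (g * k : ℕ)) = k * (a * j : ℕ) := by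
        rw [haa]; push_cast; ring
      rw [mul_zpow, ← zpow_mul, ← zpow_mul, e3, e4, zpow_mul _ (N : ℤ), e2, mul_zpow, mul_zpow,
        ← zpow_mul, ← zpow_mul, e5, mul_assoc]
  refine ⟨N * j * k, Nat.mul_pos (Nat.mul_pos hN hj) hk, _, h3, ?_, ?_⟩
  · exact (IsUnit.pow _ hxs).mul (hxW.pow _)
  · have e : nv h3 = nv hs ⊓ nv hW := by
      ext z
      change IsUnit (s z ^ (g * k) * W z ^ (a * j)) ↔ IsUnit (s z) ∧ IsUnit (W z)
      rw [IsUnit.mul_iff, isUnit_pow_iff (Nat.mul_pos hg hk).ne', isUnit_pow_iff (Nat.mul_pos ha hj).ne']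
    rw [e]
    exact isAffineOpen_inf_nv hW hsa

end LineBundle

/-- The local rings at closed points are discrete valuation rings or nodes, both of dimension at
most one. -/
theorem PointedNodalCurve.atMostOneDim {k : ℕ} (Q : PointedNodalCurve k) : AtMostOneDim Q.C := by
  have := Q.proper
  have := isNoetherian_of_proper Q.π
  refine atMostOneDim_of_stalks fun p hp P R hP hR hPR => ?_
  rcases Q.nodal p hp with ⟨_, _⟩ | ⟨⟨e⟩⟩
  · exact hR.isMaximal (fun h => by rw [h] at hPR; exact not_lt_bot hPR)
  · exact isMaximal_of_lt_of_node e hP hR hPR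

/-! ### Independence of stability from the polarization. -/

namespace ToricQuasimap

variable {n : ℕ} {ι : Type} [Fintype ι] [DecidableEq ι] {F : Fan n ι} {k : ℕ}
  (Q : ToricQuasimap F k)

/-- Monomials in the sections `u_ρ`. -/
theorem exists_monomial {α : ι → ℤ} {m : Fin n → ℤ} (h : ∀ ρ, 0 ≤ α ρ + F.pairing ρ m) :
    ∃ w : Germs Q.C, (LineBundle.prod Q.L α).IsSec w ∧ ∀ z,
      (∀ ρ, α ρ + F.pairing ρ m ≠ 0 → z ∈ (Q.u ρ).nonvanishing) → IsUnit (w z) := by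
  -- The monomial ∏ u_ρ^(α_ρ + ⟨ρ, m⟩) is a section of the bundle for α + div m; the frame given by
  -- φ at -m carries it to the bundle for α.
  have h1 := LineBundle.IsSec.prod_pow (fun ρ => (Q.u ρ).isSec) fun ρ => (α ρ + F.pairing ρ m).toNat
  have h2 := (Q.φ (-m)).isSec_one
  refine ⟨_, h1.prod_add h2 (d := α) ?_, fun z hz => ?_⟩
  · ext ρ
    have : F.pairing ρ (-m) = - F.pairing ρ m := by simp [Fan.pairing]
    rw [Pi.add_apply, this, Int.toNat_of_nonneg (h ρ)]
    ring
  · refine IsUnit.mul ?_ ((Q.φ (-m)).isUnit_one z)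
    rw [Finset.prod_apply]
    refine (Finset.univ).prod_induction _ IsUnit (fun _ _ => IsUnit.mul) isUnit_one fun ρ _ => ?_
    by_cases h0 : α ρ + F.pairing ρ m = 0
    · simp [h0]
    · exact IsUnit.pow _ ((Q.u ρ).mem_nonvanishing.1 (hz ρ h0))

/-- Nα' - α is nef for large N: the strict inequalities for α' hold with integer slack at least 1,
so N only has to bound the finitely many numbers α_ρ + ⟨ρ, m_σ⟩. -/
theorem exists_multiple {α α' : ι → ℤ} (hα : F.IsAmple α) (hα' : F.IsAmple α') :
    ∃ N : ℕ, 1 ≤ N ∧ ∀ σ ∈ F.maxCones, ∃ m : Fin n → ℤ,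
      (∀ ρ ∈ σ, N * α' ρ - α ρ + F.pairing ρ m = 0) ∧
      ∀ ρ ∉ σ, 0 ≤ N * α' ρ - α ρ + F.pairing ρ m := by
  choose! m hm1 hm2 using hα
  choose! m' hm1' hm2' using hα'
  set N : ℕ := 1 + ∑ σ : Finset ι, ∑ ρ, (α ρ + F.pairing ρ (m σ)).natAbs with hN
  refine ⟨N, by omega, fun σ hσ => ⟨(N : ℤ) • m' σ - m σ, fun ρ hρ => ?_, fun ρ hρ => ?_⟩⟩
  all_goals
    have e : F.pairing ρ ((N : ℤ) • m' σ - m σ) = N * F.pairing ρ (m' σ) - F.pairing ρ (m σ) := by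
      rw [Fan.pairing, dotProduct_sub, dotProduct_smul, smul_eq_mul]; rfl
    rw [e]
  · rw [hm1 σ hσ ρ hρ, hm1' σ hσ ρ hρ]; ring
  · have h1 := hm2' σ hσ ρ hρ
    have h2 : (α ρ + F.pairing ρ (m σ)).natAbs ≤ N := by
      have h3 : (α ρ + F.pairing ρ (m σ)).natAbs ≤ ∑ ρ, (α ρ + F.pairing ρ (m σ)).natAbs :=
        Finset.single_le_sum (f := fun ρ => (α ρ + F.pairing ρ (m σ)).natAbs)
          (fun _ _ => Nat.zero_le _) (Finset.mem_univ ρ)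
      have h4 := Finset.single_le_sum (f := fun σ => ∑ ρ, (α ρ + F.pairing ρ (m σ)).natAbs)
          (fun _ _ => Nat.zero_le _) (Finset.mem_univ σ)
      omega
    have h5 : (N : ℤ) * 1 ≤ N * (α' ρ + F.pairing ρ (m' σ)) :=
      mul_le_mul_of_nonneg_left (by omega) (by omega)
    have h6 : α ρ + F.pairing ρ (m σ) ≤ N := by omega
    linarith

/-- Off the base points, the monomial for the cone given by nondegeneracy is nonzero. A base point x
has a proper generization, which is not a base point; a monomial nonzero there has nonzero germ at
x, and `exists_sec_isUnit` applies. -/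
theorem semiample {H : LineBundle Q.C} (hH : H.IsAmple) {α : ι → ℤ} (h : ∀ σ ∈ F.maxCones,
      ∃ m : Fin n → ℤ, (∀ ρ ∈ σ, α ρ + F.pairing ρ m = 0) ∧ ∀ ρ ∉ σ, 0 ≤ α ρ + F.pairing ρ m)
    (x : Q.C) : ∃ (k : ℕ) (W : Germs Q.C), 1 ≤ k ∧ ((LineBundle.prod Q.L α).zpow k).IsSec W ∧
      IsUnit (W x) := by
  obtain ⟨B, -, hB, -, hQ⟩ := Q.nondegenerate
  have key : ∀ y ∉ B, ∃ w : Germs Q.C, (LineBundle.prod Q.L α).IsSec w ∧ IsUnit (w y) := fun y hy => by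
    obtain ⟨σ, hσ, hσu⟩ := hQ y hy
    obtain ⟨m, h1, h2⟩ := h σ hσ
    obtain ⟨w, hw, hwu⟩ := Q.exists_monomial (α := α) (m := m) fun ρ => by
      by_cases hρ : ρ ∈ σ
      · exact (h1 ρ hρ).ge
      · exact h2 ρ hρ
    exact ⟨w, hw, hwu y fun ρ hρ => hσu ρ fun h => hρ (h1 ρ h)⟩
  by_cases hx : x ∈ B
  · obtain ⟨hxc, hxs⟩ := hB x hx
    obtain ⟨η, hη, hηx⟩ := exists_generization hxs
    obtain ⟨w, hw, hwu⟩ := key η fun hηB => hηx (specializes_closed_eq (hB η hηB).1 hη).symm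
    have := Q.proper
    refine exists_sec_isUnit Q.π Q.atMostOneDim hH hw hxc hxs fun h0 => ?_
    obtain ⟨V, hV, hV1, -, hV2⟩ := reg_eq_nhd (hw.reg x) (zero_mem (reg (⊤ : Q.C.Opens)))
      ((LineBundle.prod Q.L α).mem x) (Opens.mem_top x) (by simp [h0])
    have h3 := hV2 η (hη.mem_open V.isOpen hV)
    rw [Pi.zero_apply, Units.mul_right_eq_zero] at h3
    rw [h3] at hwu
    exact not_isUnit_zero hwu
  · obtain ⟨w, hw, hwu⟩ := key x hx
    exact ⟨1, w, le_rfl, LineBundle.zpow_one_isSec.2 hw, hwu⟩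

/-- With Nα' = α + α'', the ε-twist by α' is the (ε/N)-twist by α, ample by stability, times a power
of the semiample bundle for α''. -/
theorem IsStable.of_isAmple {Q : ToricQuasimap F k} {α α' : ι → ℤ} (hα : F.IsAmple α)
    (hα' : F.IsAmple α') (h : Q.IsStable α) : Q.IsStable α' := by
  obtain ⟨ω, P, hω, hP, hs⟩ := h
  refine ⟨ω, P, hω, hP, fun ε hε => ?_⟩
  obtain ⟨N, hN, hNσ⟩ := exists_multiple hα hα'
  set A := ω.tensor (LineBundle.prod P fun _ => 1)
  have hN0 : (0 : ℚ) < N := by exact_mod_cast hN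
  have h1 := hs (ε / N) (div_pos hε hN0)
  have hsa := Q.semiample h1 (α := fun ρ => N * α' ρ - α ρ) hNσ
  unfold LineBundle.IsAmpleTwist at h1 ⊢
  obtain ⟨a, ha⟩ := Int.eq_ofNat_of_zero_le (Rat.num_pos.2 hε).le
  obtain ⟨a₁, ha₁⟩ := Int.eq_ofNat_of_zero_le (Rat.num_pos.2 (div_pos hε hN0)).le
  have ha0 : 1 ≤ a := by have := Rat.num_pos.2 hε; omega
  -- g is the common factor that cancels when ε / N is brought to lowest terms.
  obtain ⟨g, hg1, hg2⟩ : ∃ g : ℕ, N * ε.den = g * (ε / N).den ∧ a = g * a₁ := by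
    have hd : ((N * ε.den : ℕ) : ℤ) ≠ 0 := by
      exact_mod_cast (Nat.mul_pos hN ε.den_pos).ne'
    obtain ⟨c, hc1, hc2⟩ := Rat.num_den_mk (q := ε / N) (n := a) hd (by
      rw [Rat.divInt_eq_div]
      conv_lhs => rw [← Rat.num_div_den ε, ha]
      push_cast
      rw [div_div, mul_comm (N : ℚ)])
    have hc0 : 0 ≤ c := by
      by_contra hc
      have h3 : 0 < (ε / N).num := Rat.num_pos.2 (div_pos hε hN0)
      nlinarith
    obtain ⟨g, rfl⟩ := Int.eq_ofNat_of_zero_le hc0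
    refine ⟨g, by exact_mod_cast hc2, ?_⟩
    rw [ha₁] at hc1
    exact_mod_cast hc1
  rw [ha]
  rw [ha₁] at h1
  refine LineBundle.isAmple_of_semiample A hN ?_ ha0 (α := α) (α'' := fun ρ => N * α' ρ - α ρ) ?_
    hg1 hg2 h1 hsa
  · rcases Nat.eq_zero_or_pos g with rfl | h
    · omega
    · exact h
  · ext ρ
    simp

end ToricQuasimap

/-! ### Indices of subspaces of a field -/

section Index

variable {k K : Type} [Field k] [Field K] [Algebra k K]

/-- The dimension of `Q / P`. -/
def ix (Q P : Submodule k K) : ℕ∞ := Module.length k (Q ⧸ P.submoduleOf Q)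

/-- The subspace `g P`. -/
def mulSub (g : K) (P : Submodule k K) : Submodule k K := P.map (LinearMap.mulLeft k g)

theorem mem_mulSub {g x : K} {P : Submodule k K} : x ∈ mulSub g P ↔ ∃ y ∈ P, g * y = x := Iff.rfl

theorem mulSub_mono {g : K} {P Q : Submodule k K} (h : P ≤ Q) : mulSub g P ≤ mulSub g Q :=
  Submodule.map_mono h

theorem mulSub_mulSub (g h : K) (P : Submodule k K) : mulSub g (mulSub h P) = mulSub (g * h) P := by
  ext x
  simp only [mem_mulSub]
  constructor
  · rintro ⟨_, ⟨y, hy, rfl⟩, rfl⟩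
    exact ⟨y, hy, by ring⟩
  · rintro ⟨y, hy, rfl⟩
    exact ⟨h * y, ⟨y, hy, rfl⟩, by ring⟩

theorem ix_add {P R Q : Submodule k K} (hPR : P ≤ R) (hRQ : R ≤ Q) : ix Q P = ix R P + ix Q R := by
  refine Module.length_eq_add_of_exact
    (Submodule.mapQ (P.submoduleOf R) (P.submoduleOf Q) (Submodule.inclusion hRQ) fun x hx => hx)
    (Submodule.factor (Submodule.comap_mono hPR)) ?_ (Submodule.factor_surjective _) ?_
  · refine (injective_iff_map_eq_zero _).2 fun x hx => ?_
    obtain ⟨y, rfl⟩ := Submodule.Quotient.mk_surjective _ x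
    have h2 : Submodule.inclusion hRQ y ∈ P.submoduleOf Q := (Submodule.Quotient.mk_eq_zero _).1 hx
    exact (Submodule.Quotient.mk_eq_zero _).2 h2
  · intro x
    obtain ⟨y, rfl⟩ := Submodule.Quotient.mk_surjective _ x
    constructor
    · intro h
      have h2 : y ∈ R.submoduleOf Q := (Submodule.Quotient.mk_eq_zero _).1 h
      exact ⟨Submodule.Quotient.mk ⟨y.1, h2⟩, rfl⟩
    · rintro ⟨z, hz⟩
      obtain ⟨w, rfl⟩ := Submodule.Quotient.mk_surjective _ z
      rw [← hz]
      exact (Submodule.Quotient.mk_eq_zero _).2 w.2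

theorem ix_mono_right {P R Q : Submodule k K} (hPR : P ≤ R) (hRQ : R ≤ Q) : ix Q R ≤ ix Q P := by
  rw [ix_add hPR hRQ]; exact le_add_self

theorem ix_self (Q : Submodule k K) : ix Q Q = 0 := by
  rw [ix, Module.length_eq_zero_iff, Submodule.submoduleOf_self]
  infer_instance

theorem ix_mulSub {g : K} (hg : g ≠ 0) (Q P : Submodule k K) :
    ix (mulSub g Q) (mulSub g P) = ix Q P := by
  have hinj : Function.Injective (LinearMap.mulLeft k g) := mul_right_injective₀ hg
  refine (LinearEquiv.length_eq (Submodule.Quotient.equiv _ _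
    (Submodule.equivMapOfInjective _ hinj Q) ?_)).symm
  ext ⟨x, hx⟩
  constructor
  · rintro ⟨y, hy, e⟩
    exact ⟨y.1, hy, congrArg Subtype.val e⟩
  · rintro ⟨y, hy, e⟩
    obtain ⟨y', hy', e'⟩ := hx
    have : y = y' := hinj (e.trans e'.symm)
    subst this
    exact ⟨⟨y, hy'⟩, hy, Subtype.ext e⟩

theorem ix_inf_eq (Q P : Submodule k K) : ix Q (Q ⊓ P) = ix (Q ⊔ P) P :=
  LinearEquiv.length_eq (LinearMap.quotientInfEquivSupQuotient Q P)

/-- The dimension of `A / g A`. -/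
def dq (A : Subalgebra k K) (g : K) : ℕ∞ := ix A.toSubmodule (mulSub g A.toSubmodule)

theorem mulSub_le {A : Subalgebra k K} {g : K} (hg : g ∈ A) :
    mulSub g A.toSubmodule ≤ A.toSubmodule := by
  rintro _ ⟨y, hy, rfl⟩
  exact A.mul_mem hg hy

theorem dq_mul {A : Subalgebra k K} {g h : K} (hg : g ∈ A) (hg0 : g ≠ 0) (hh : h ∈ A) :
    dq A (g * h) = dq A g + dq A h := by
  have h1 : mulSub (g * h) A.toSubmodule ≤ mulSub g A.toSubmodule := by
    rw [← mulSub_mulSub]; exact mulSub_mono (mulSub_le hh)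
  rw [dq, ix_add h1 (mulSub_le hg), ← mulSub_mulSub, ix_mulSub hg0, add_comm]
  rfl

theorem dq_eq_zero {A : Subalgebra k K} {g : K} (hg : g ∈ A) (hg0 : g ≠ 0) (hg' : g⁻¹ ∈ A) :
    dq A g = 0 := by
  have : mulSub g A.toSubmodule = A.toSubmodule := le_antisymm (mulSub_le hg) fun x hx =>
    ⟨g⁻¹ * x, A.mul_mem hg' hx, by
      change g * (g⁻¹ * x) = x
      field_simp⟩
  rw [dq, this, ix_self]

/-- Replacing a ring by a larger one with the same fractions does not change the index. -/
theorem dq_eq_of_conductor {A B : Subalgebra k K} {c g : K} (hAB : A ≤ B) (hc0 : c ≠ 0)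
    (hcB : ∀ b ∈ B, c * b ∈ A) (hcf : dq A c ≠ ⊤) (hg : g ∈ A) (hg0 : g ≠ 0) : dq A g = dq B g := by
  have hcB' : mulSub c B.toSubmodule ≤ A.toSubmodule := by
    rintro _ ⟨b, hb, rfl⟩
    exact hcB b hb
  have h1 : ix A.toSubmodule (mulSub c B.toSubmodule) ≠ ⊤ :=
    ne_top_of_le_ne_top hcf (ix_mono_right (mulSub_mono hAB) hcB')
  -- The index of gcB in A is computed through gA and through cB. Multiplication by a nonzero
  -- element preserves indices, so the finite index of cB in A cancels.
  have h2 : ix A.toSubmodule (mulSub g (mulSub c B.toSubmodule)) =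
      ix A.toSubmodule (mulSub c B.toSubmodule) + dq A g := by
    rw [ix_add (mulSub_mono hcB') (mulSub_le hg), ix_mulSub hg0]; rfl
  have h3 : ix A.toSubmodule (mulSub g (mulSub c B.toSubmodule)) =
      ix A.toSubmodule (mulSub c B.toSubmodule) + dq B g := by
    rw [mulSub_mulSub, mul_comm g c, ← mulSub_mulSub,
      ix_add (mulSub_mono (mulSub_le (hAB hg))) hcB', ix_mulSub hc0, add_comm]; rfl
  exact WithTop.add_left_cancel h1 (h2.symm.trans h3)

end Index

/-! ### Places of a function field -/

section Places

variable (k K : Type) [Field k] [Field K] [Algebra k K]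

/-- The places of `K` over `k`, that is, the nontrivial valuation rings. -/
def places : Set (Subalgebra k K) := {V | V ≠ ⊤ ∧ ∀ x, x ∈ V ∨ x⁻¹ ∈ V}

variable {k K}

/-- The places which contain a subring. -/
def placesOver (S : Subalgebra k K) : Set (Subalgebra k K) := {V | V ∈ places k K ∧ S ≤ V}

open Classical in
/-- The order of a function at a place. -/
def vo (V : Subalgebra k K) (f : K) : ℤ :=
  if f ∈ V then ((dq V f).toNat : ℤ) else -((dq V f⁻¹).toNat : ℤ)

/-- Additivity of the index under products; finiteness ensures that `toNat` loses nothing. -/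
theorem vo_div {V : Subalgebra k K} (hV : V ∈ places k K) {g h : K} (hg : g ∈ V) (hh : h ∈ V)
    (hg0 : g ≠ 0) (hh0 : h ≠ 0) (hgf : dq V g ≠ ⊤) (hhf : dq V h ≠ ⊤) :
    vo V (g / h) = (dq V g).toNat - (dq V h).toNat := by
  by_cases hm : g / h ∈ V
  · have h1 := dq_mul hm (div_ne_zero hg0 hh0) hh
    rw [div_mul_cancel₀ _ hh0] at h1
    have hf : dq V (g / h) ≠ ⊤ := fun h => by rw [h, top_add] at h1; exact hgf h1
    rw [vo, if_pos hm, h1, ENat.toNat_add hf hhf]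
    push_cast
    ring
  · have hm' : h / g ∈ V := by
      have := (hV.2 (g / h)).resolve_left hm
      rwa [inv_div] at this
    have h1 := dq_mul hm' (div_ne_zero hh0 hg0) hg
    rw [div_mul_cancel₀ _ hg0] at h1
    have hf : dq V (h / g) ≠ ⊤ := fun h => by rw [h, top_add] at h1; exact hhf h1
    rw [vo, if_neg hm, inv_div, h1, ENat.toNat_add hf hgf]
    push_cast
    ring

/-- Divide ub + vp = 1 by b or by p, according to which of p/b and b/p lies in V; the second case
would put p⁻¹ in V. -/
theorem inv_mem_of_coprime {S V : Subalgebra k K} (hV : V ∈ placesOver S) {b p : S}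
    (hbp : IsCoprime b p) (hb : b ≠ 0) (hp : (p : K)⁻¹ ∉ V) : (b : K)⁻¹ ∈ V := by
  obtain ⟨u, v, huv⟩ := hbp
  have huv' : (u : K) * b + v * p = 1 := congrArg Subtype.val huv
  have hb0 : (b : K) ≠ 0 := fun h => hb (Subtype.ext h)
  have hp0 : (p : K) ≠ 0 := fun h => hp (by rw [h, inv_zero]; exact V.zero_mem)
  rcases hV.1.2 (p / b) with h | h
  · have : (b : K)⁻¹ = u + v * (p / b) := by
      field_simp
      linear_combination -huv'
    rw [this]
    exact V.add_mem (hV.2 u.2) (V.mul_mem (hV.2 v.2) h)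
  · rw [inv_div] at h
    refine absurd ?_ hp
    have : (p : K)⁻¹ = u * (b / p) + v := by
      field_simp
      linear_combination -huv'
    rw [this]
    exact V.add_mem (V.mul_mem (hV.2 u.2) h) (hV.2 v.2)

variable (S : Subalgebra k K)

/-- The localization of a principal ideal domain at a prime element. -/
def locAt {p : S} (hp : Prime p) : Subalgebra k K where
  carrier := {x | ∃ a b : S, ¬ p ∣ b ∧ x * b = a}
  mul_mem' := by
    rintro x y ⟨a, b, hb, h⟩ ⟨a', b', hb', h'⟩
    refine ⟨a * a', b * b', fun hd => (hp.dvd_or_dvd hd).elim hb hb', ?_⟩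
    push_cast
    rw [← h, ← h']; ring
  add_mem' := by
    rintro x y ⟨a, b, hb, h⟩ ⟨a', b', hb', h'⟩
    refine ⟨a * b' + a' * b, b * b', fun hd => (hp.dvd_or_dvd hd).elim hb hb', ?_⟩
    push_cast
    rw [← h, ← h']; ring
  algebraMap_mem' r := ⟨algebraMap k S r, 1, fun h => hp.not_isUnit (isUnit_of_dvd_one h), by
    simp⟩

theorem le_locAt {p : S} (hp : Prime p) : S ≤ locAt S hp := fun x hx =>
  ⟨⟨x, hx⟩, 1, fun h => hp.not_isUnit (isUnit_of_dvd_one h), by simp⟩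

theorem inv_notMem_locAt {p : S} (hp : Prime p) : (p : K)⁻¹ ∉ locAt S hp := by
  rintro ⟨a, b, hb, h⟩
  have hp0 : (p : K) ≠ 0 := fun h => hp.ne_zero (Subtype.ext h)
  refine hb ⟨a, Subtype.ext ?_⟩
  push_cast
  rw [← h]
  field_simp

variable [IsPrincipalIdealRing S]

/-- With S_p the localization, S ∩ pS_p = pS and S + pS_p = S_p, so S/pS = S_p/pS_p. -/
theorem dq_locAt {p : S} (hp : Prime p) : dq S (p : K) = dq (locAt S hp) p := by
  have h1 : mulSub (p : K) S.toSubmodule =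
      S.toSubmodule ⊓ mulSub (p : K) (locAt S hp).toSubmodule := by
    refine le_antisymm (le_inf (mulSub_le p.2) (mulSub_mono (le_locAt S hp))) ?_
    rintro _ ⟨hx, y, ⟨a, b, hb, h⟩, rfl⟩
    have hx' : (p : K) * y ∈ S := hx
    have h2 : p ∣ ⟨_, hx'⟩ * b := ⟨a, Subtype.ext (by
      push_cast
      rw [← h]; ring)⟩
    obtain ⟨c, hc⟩ := (hp.dvd_or_dvd h2).resolve_right hb
    exact ⟨c, c.2, (congrArg Subtype.val hc).symm⟩
  have h2 : S.toSubmodule ⊔ mulSub (p : K) (locAt S hp).toSubmodule = (locAt S hp).toSubmodule := by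
    refine le_antisymm (sup_le (le_locAt S hp) (mulSub_le (le_locAt S hp p.2))) ?_
    rintro x ⟨a, b, hb, h⟩
    obtain ⟨u, v, huv⟩ := ((hp.irreducible.coprime_iff_not_dvd).2 hb).symm
    have huv' : (u : K) * b + v * p = 1 := congrArg Subtype.val huv
    have hx : x = a * u + p * (x * v) := by
      calc x = x * (u * b + v * p) := by rw [huv', mul_one]
        _ = _ := by rw [← h]; ring
    rw [hx]
    refine Submodule.add_mem_sup (S.mul_mem a.2 u.2) ⟨x * v, ?_, rfl⟩
    exact (locAt S hp).mul_mem ⟨a, b, hb, h⟩ (le_locAt S hp v.2)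
  rw [dq, h1, ix_inf_eq, h2]
  rfl

variable [IsFractionRing S K]

theorem exists_reduced {p : S} (hp : Prime p) (x : K) :
    ∃ a b : S, x * b = a ∧ b ≠ 0 ∧ (¬ p ∣ a ∨ ¬ p ∣ b) := by
  obtain ⟨a, b, hab, h⟩ := IsFractionRing.exists_reduced_fraction (A := S) x
  refine ⟨a, b, ?_, nonZeroDivisors.coe_ne_zero b, ?_⟩
  · rw [← h]; exact IsLocalization.mk'_spec K a b
  · by_contra hc
    push Not at hc
    exact hp.not_isUnit (hab hc.1 hc.2)

theorem locAt_mem {p : S} (hp : Prime p) : locAt S hp ∈ placesOver S := by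
  refine ⟨⟨fun h => inv_notMem_locAt S hp (h ▸ Algebra.mem_top), fun x => ?_⟩, le_locAt S hp⟩
  obtain ⟨a, b, h, hb0, ha | hb⟩ := exists_reduced S hp x
  · refine Or.inr ⟨b, a, ha, ?_⟩
    by_cases hx : x = 0
    · exact absurd (by rw [hx, zero_mul] at h; rw [← (Subtype.ext h : (0 : S) = a)]; exact dvd_zero _) ha
    · rw [← h]; field_simp
  · exact Or.inl ⟨a, b, hb, h⟩

/-- V inverts everything prime to p, so it contains the localization. An element of V whose reduced
denominator is divisible by p would make p invertible in V. -/
theorem eq_locAt {p : S} (hp : Prime p) {V : Subalgebra k K} (hV : V ∈ placesOver S)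
    (hpV : (p : K)⁻¹ ∉ V) : V = locAt S hp := by
  have hinv : ∀ b : S, ¬ p ∣ b → (b : K)⁻¹ ∈ V := fun b hb =>
    inv_mem_of_coprime hV ((hp.irreducible.coprime_iff_not_dvd).2 hb).symm
      (fun h => hb (h ▸ dvd_zero p)) hpV
  apply le_antisymm
  · intro x hx
    obtain ⟨a, b, h, hb0, hab⟩ := exists_reduced S hp x
    by_cases hb : p ∣ b
    · exfalso
      have ha := hinv a (hab.resolve_right (not_not.2 hb))
      obtain ⟨c, rfl⟩ := hb
      have hp0 : (p : K) ≠ 0 := fun h => hp.ne_zero (Subtype.ext h)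
      have hc0 : (c : K) ≠ 0 := fun h => hb0 (by rw [(Subtype.ext h : c = 0), mul_zero])
      have ha0 : (a : K) ≠ 0 := fun h => (hab.resolve_right (by simp)) (by
        rw [(Subtype.ext h : a = 0)]; exact dvd_zero _)
      refine hpV ?_
      have e : (p : K)⁻¹ = c * (x * (a : K)⁻¹) := by
        push_cast at h
        rw [← h] at ha0 ⊢
        have hx0 : x ≠ 0 := left_ne_zero_of_mul ha0
        field_simp
      rw [e]
      exact V.mul_mem (hV.2 c.2) (V.mul_mem hx ha)
    · exact ⟨a, b, hb, h⟩
  · rintro x ⟨a, b, hb, h⟩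
    have hb0 : (b : K) ≠ 0 := fun h => hb (by rw [(Subtype.ext h : b = 0)]; exact dvd_zero _)
    have : x = a * (b : K)⁻¹ := by rw [← h]; field_simp
    rw [this]
    exact V.mul_mem (hV.2 a.2) (hinv b hb)

/-- The index of a principal ideal is the sum of the local orders. -/
theorem dq_eq_finsum (g : S) (hg : g ≠ 0) :
    {V ∈ placesOver S | dq V (g : K) ≠ 0}.Finite ∧
      dq S (g : K) = ∑ᶠ V ∈ placesOver S, dq V (g : K) := by
  have hcoe : ∀ {x : S}, x ≠ 0 → (x : K) ≠ 0 := fun hx h => hx (Subtype.ext h)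
  induction g using UniqueFactorizationMonoid.induction_on_prime with
  | h₁ => exact absurd rfl hg
  | h₂ u hu =>
    obtain ⟨v, hv⟩ := hu.exists_right_inv
    have hv' : (u : K) * v = 1 := congrArg Subtype.val hv
    have hinv : (u : K)⁻¹ ∈ S := by rw [inv_eq_of_mul_eq_one_right hv']; exact v.2
    have h0 : ∀ V, S ≤ V → dq V (u : K) = 0 := fun V hV =>
      dq_eq_zero (hV u.2) (hcoe hg) (hV hinv)
    refine ⟨?_, ?_⟩
    · convert Set.finite_empty
      ext V
      simp only [Set.mem_ofPred_eq, Set.mem_empty_iff_false, iff_false, not_and, not_not]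
      exact fun hV => h0 V hV.2
    · rw [h0 S le_rfl]
      exact (finsum_mem_eq_zero_of_forall_eq_zero fun V hV => h0 V hV.2).symm
  | h₃ a p ha hp ih =>
    obtain ⟨h1, h2⟩ := ih ha
    have hmul : ∀ V, S ≤ V → dq V ((p * a : S) : K) = dq V (p : K) + dq V (a : K) := fun V hV =>
      dq_mul (hV p.2) (hcoe hp.ne_zero) (hV a.2)
    -- Among the places over S, p is a nonunit only at its own localization.
    have hpV : ∀ V ∈ placesOver S, V ≠ locAt S hp → dq V (p : K) = 0 := fun V hV hne =>
      dq_eq_zero (hV.2 p.2) (hcoe hp.ne_zero) (by_contra fun h => hne (eq_locAt S hp hV h))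
    have hfin : {V ∈ placesOver S | dq V (p : K) ≠ 0}.Finite :=
      (Set.finite_singleton (locAt S hp)).subset fun V hV => by
        by_contra hne
        exact hV.2 (hpV V hV.1 hne)
    have hsum : ∑ᶠ V ∈ placesOver S, dq V (p : K) = dq S (p : K) := by
      rw [dq_locAt S hp, ← finsum_mem_singleton (f := fun V : Subalgebra k K => dq V (p : K))]
      refine finsum_mem_inter_support_eq _ _ _ ?_
      ext V
      simp only [Set.mem_inter_iff, Function.mem_support, Set.mem_singleton_iff]
      refine ⟨fun h => ⟨by_contra fun hne => h.2 (hpV V h.1 hne), h.2⟩, fun h => ⟨?_, h.2⟩⟩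
      exact h.1 ▸ locAt_mem S hp
    refine ⟨(hfin.union h1).subset fun V hV => ?_, ?_⟩
    · by_contra hc
      simp only [Set.mem_union, Set.mem_ofPred_eq, not_or, not_and, not_not] at hc
      exact hV.2 (by rw [hmul V hV.1.2, hc.1 hV.1, hc.2 hV.1, add_zero])
    · rw [hmul S le_rfl, h2, ← hsum, ← finsum_mem_add_distrib' hfin h1]
      exact finsum_mem_congr rfl fun V hV => (hmul V hV.2).symm

end Places

/-! ### The product formula for function fields of curves -/

section Length

variable {k R : Type} [Field k] [CommRing R] [IsLocalRing R] [Algebra k R]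

/-- Over a local ring whose residue field is the base field, length is dimension. -/
theorem length_eq_of_residue (hres : ∀ r : R, ∃ c : k, r - algebraMap k R c ∈ IsLocalRing.maximalIdeal R)
    {M : Type} [AddCommGroup M] [Module R M] (hM : IsFiniteLength R M) :
    ∀ [Module k M] [IsScalarTower k R M], Module.length k M = Module.length R M := by
  induction hM with
  | of_subsingleton =>
    intro _ _
    rw [Module.length_eq_zero, Module.length_eq_zero]
  | @of_simple_quotient M _ _ N hs hN ih =>
    intro _ _
    have h1 := Module.length_eq_add_of_exact N.subtype N.mkQ N.injective_subtype
      N.mkQ_surjective (LinearMap.exact_subtype_mkQ N)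
    have h2 := Module.length_eq_add_of_exact (N.subtype.restrictScalars k)
      (N.mkQ.restrictScalars k) N.injective_subtype
      N.mkQ_surjective (LinearMap.exact_subtype_mkQ N)
    have hS : Module.length k (M ⧸ N) = 1 := by
      have := hs.nontrivial
      obtain ⟨v, hv⟩ := exists_ne (0 : M ⧸ N)
      have hm : ∀ r ∈ IsLocalRing.maximalIdeal R, r • v = 0 := by
        intro r hr
        have hle := IsLocalRing.eq_maximalIdeal (IsSimpleModule.annihilator_isMaximal (R := R) (M := M ⧸ N))
        exact Module.mem_annihilator.1 (hle ▸ hr) v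
      have hfr : Module.finrank k (M ⧸ N) = 1 := by
        refine finrank_eq_one v hv fun w => ?_
        obtain ⟨r, rfl⟩ := IsSimpleModule.toSpanSingleton_surjective R hv w
        obtain ⟨c, hc⟩ := hres r
        refine ⟨c, ?_⟩
        have := hm _ hc
        rw [sub_smul, sub_eq_zero, algebraMap_smul] at this
        exact this.symm
      have : Module.Finite k (M ⧸ N) := Module.finite_of_finrank_eq_succ hfr
      rw [Module.length_eq_finrank, hfr, Nat.cast_one]
    rw [h1, h2, ih, hS, Module.length_eq_one R (M ⧸ N)]

end Length

/-- A finite integrally closed algebra over a one-dimensional noetherian local ring is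
principal. -/
theorem isPrincipalIdealRing_of_finite (A B : Type) [CommRing A] [IsLocalRing A]
    [IsNoetherianRing A] [CommRing B] [IsDomain B] [IsIntegrallyClosed B]
    [Ring.DimensionLEOne B] [Algebra A B] [Module.Finite A B] : IsPrincipalIdealRing B := by
  have : IsNoetherianRing B := IsNoetherianRing.of_finite A B
  have : IsDedekindDomain B := { }
  refine IsPrincipalIdealRing.of_finite_maximals
    ((Algebra.QuasiFinite.finite_primesOver (S := B) (IsLocalRing.maximalIdeal A)).subset ?_)
  intro P hP
  have hP' : P.IsMaximal := hP
  refine ⟨hP'.isPrime, ⟨?_⟩⟩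
  have : (P.comap (algebraMap A B)).IsMaximal := Ideal.isMaximal_comap_of_isIntegral_of_isMaximal P
  exact (IsLocalRing.eq_maximalIdeal this).symm

section Places

variable {k K : Type} [Field k] [Field K] [Algebra k K]

theorem mem_of_isIntegral {V : Subalgebra k K} (hV : V ∈ places k K) {x : K}
    (hx : IsIntegral V x) : x ∈ V := by
  let W : ValuationSubring K := { V.toSubring with mem_or_inv_mem' := hV.2 }
  have hx' : IsIntegral W x := hx
  obtain ⟨y, rfl⟩ := IsIntegrallyClosed.isIntegral_iff.1 hx'
  exact y.2

theorem mem_of_isIntegral_of_le {V : Subalgebra k K} (hV : V ∈ places k K) {R : Type}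
    [CommRing R] [Algebra R K] (hR : ∀ r : R, algebraMap R K r ∈ V) {x : K}
    (hx : IsIntegral R x) : x ∈ V :=
  mem_of_isIntegral hV (IsIntegral.map_of_comp_eq ((algebraMap R K).codRestrict V hR)
    (RingHom.id K) (by ext; rfl) hx)

theorem toNat_dq_eq_finsum (S : Subalgebra k K) [IsPrincipalIdealRing S] [IsFractionRing S K]
    {g : K} (hgS : g ∈ S) (hg : g ≠ 0) (hf : dq S g ≠ ⊤) :
    (∀ V ∈ placesOver S, dq V g ≠ ⊤) ∧
    {V ∈ placesOver S | (dq V g).toNat ≠ 0}.Finite ∧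
      (dq S g).toNat = ∑ᶠ V ∈ placesOver S, (dq V g).toNat := by
  obtain ⟨h1, h2⟩ := dq_eq_finsum S ⟨g, hgS⟩ (fun h => hg (congrArg Subtype.val h))
  change {V ∈ placesOver S | dq V g ≠ 0}.Finite at h1
  change dq S g = ∑ᶠ V ∈ placesOver S, dq V g at h2
  have h1' : (placesOver S ∩ Function.support fun V => dq V g).Finite := h1
  rw [finsum_mem_eq_sum _ h1'] at h2
  have htop : ∀ V ∈ placesOver S, dq V g ≠ ⊤ := by
    intro V hV ht
    refine hf (top_le_iff.1 ?_)
    rw [h2, ← ht]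
    refine Finset.single_le_sum (f := fun V => dq V g) (fun _ _ => zero_le) ?_
    rw [Set.Finite.mem_toFinset]
    exact ⟨hV, by simp [ht]⟩
  have hfin : (placesOver S ∩ Function.support fun V => (dq V g).toNat).Finite :=
    h1'.subset fun V hV => ⟨hV.1, fun h => hV.2 (by simp only at h; simp [h])⟩
  refine ⟨htop, hfin, ?_⟩
  have h3 : dq S g = ((∑ V ∈ h1'.toFinset, (dq V g).toNat : ℕ) : ℕ∞) := by
    rw [h2, Nat.cast_sum]
    refine Finset.sum_congr rfl fun V hV => ?_
    rw [Set.Finite.mem_toFinset] at hV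
    exact (ENat.natCast_toNat (htop V hV.1)).symm
  rw [h3, ENat.toNat_natCast, ← finsum_mem_eq_sum_of_inter_support_eq]
  ext V
  simp only [Set.Finite.coe_toFinset, Set.mem_inter_iff, Function.mem_support]
  exact ⟨fun h => ⟨⟨h.1, fun h0 => h.2 (by simp [h0])⟩, h.2⟩, fun h => ⟨h.1.1, h.2⟩⟩

end Places

theorem dq_eq_length {k K : Type} [Field k] [Field K] [Algebra k K] {A : Subalgebra k K} {g : K}
    (hg : g ∈ A) : dq A g = Module.length k (A ⧸ Ideal.span {(⟨g, hg⟩ : A)}) := by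
  refine LinearEquiv.length_eq ((Submodule.Quotient.equiv _
    ((Ideal.span {(⟨g, hg⟩ : A)}).restrictScalars k) A.toSubmoduleEquiv ?_).trans
    (Submodule.Quotient.restrictScalarsEquiv k _))
  ext ⟨x, hx⟩
  simp only [Submodule.restrictScalars_mem, Ideal.mem_span_singleton]
  constructor
  · rintro ⟨y, ⟨z, hz, e⟩, e'⟩
    refine ⟨⟨z, hz⟩, Subtype.ext ?_⟩
    exact (congrArg Subtype.val e').symm.trans e.symm
  · rintro ⟨z, e⟩
    exact ⟨⟨x, hx⟩, ⟨z, z.2, (congrArg Subtype.val e).symm⟩, rfl⟩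

theorem length_quotient_map {k R C : Type} [Field k] [CommRing R] [IsLocalRing R] [CommRing C]
    [Algebra R C] [Algebra k R] [Algebra k C] [IsScalarTower k R C] [Module.Finite R C]
    [Module.Free R C]
    (hres : ∀ r : R, ∃ c : k, r - algebraMap k R c ∈ IsLocalRing.maximalIdeal R) :
    Module.length k (C ⧸ (IsLocalRing.maximalIdeal R).map (algebraMap R C)) =
      Module.finrank R C := by
  let _ : Field (R ⧸ IsLocalRing.maximalIdeal R) := Ideal.Quotient.field _
  have h7 : Module.Finite (R ⧸ IsLocalRing.maximalIdeal R)
      (C ⧸ (IsLocalRing.maximalIdeal R).map (algebraMap R C)) :=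
    Module.Finite.of_restrictScalars_finite R _ _
  have h8 : Function.Surjective (algebraMap k (R ⧸ IsLocalRing.maximalIdeal R)) := by
    intro x
    obtain ⟨r, rfl⟩ := Ideal.Quotient.mk_surjective x
    obtain ⟨c, hc⟩ := hres r
    exact ⟨c, (Ideal.Quotient.eq.2 hc).symm⟩
  have : IsScalarTower k (R ⧸ IsLocalRing.maximalIdeal R)
      (C ⧸ (IsLocalRing.maximalIdeal R).map (algebraMap R C)) := by
    refine IsScalarTower.of_algebraMap_eq fun c => ?_
    change Ideal.Quotient.mk _ (algebraMap k C c) =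
      Ideal.Quotient.mk _ (algebraMap R C (algebraMap k R c))
    rw [← IsScalarTower.algebraMap_apply]
  rw [Module.length_eq_of_surjective h8, Module.length_eq_finrank,
    IsLocalRing.finrank_quotient_map]

section Uniformizer

variable {k K : Type} [Field k] [Field K] [Algebra k K] (R K₀ : Type) [CommRing R] [IsDomain R]
  [IsPrincipalIdealRing R] [IsLocalRing R] [Field K₀] [Algebra R K₀] [IsFractionRing R K₀]
  [Algebra K₀ K] [Algebra R K] [IsScalarTower R K₀ K] [Algebra k R] [IsScalarTower k R K]
  [FiniteDimensional K₀ K] [Algebra.IsSeparable K₀ K]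

/-- The integral closure of a discrete valuation ring in a finite extension of its field of
fractions. -/
theorem dq_integralClosure {f : R} (hf : IsLocalRing.maximalIdeal R = Ideal.span {f})
    (hres : ∀ r : R, ∃ c : k, r - algebraMap k R c ∈ IsLocalRing.maximalIdeal R) :
    IsPrincipalIdealRing ((integralClosure R K).restrictScalars k) ∧
    IsFractionRing ((integralClosure R K).restrictScalars k) K ∧
    dq ((integralClosure R K).restrictScalars k) (algebraMap R K f) = Module.finrank K₀ K := by
  have h0 : IsFractionRing (integralClosure R K) K :=
    integralClosure.isFractionRing_of_finite_extension K₀ K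
  have h1 : IsIntegrallyClosed (integralClosure R K) :=
    integralClosure.isIntegrallyClosedOfFiniteExtension K₀
  have h2 : Module.Finite R (integralClosure R K) := IsIntegralClosure.finite R K₀ K _
  have h3 : Ring.DimensionLEOne (integralClosure R K) := Ring.DimensionLEOne.integralClosure R K
  have h4 : Module.IsTorsionFree R K := by
    refine Module.IsTorsionFree.trans_faithfulSMul R K₀ K
  have h5 : Module.Free R (integralClosure R K) := IsIntegralClosure.module_free R K₀ K _
  refine ⟨isPrincipalIdealRing_of_finite R (integralClosure R K), h0, ?_⟩
  have hfC : algebraMap R K f ∈ (integralClosure R K).restrictScalars k :=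
    (algebraMap R (integralClosure R K) f).2
  have e : (Ideal.span {(⟨_, hfC⟩ : integralClosure R K)}) =
      (IsLocalRing.maximalIdeal R).map (algebraMap R (integralClosure R K)) := by
    rw [hf, Ideal.map_span, Set.image_singleton]
    rfl
  have h6 : dq ((integralClosure R K).restrictScalars k) (algebraMap R K f) =
      Module.length k (integralClosure R K ⧸
        (IsLocalRing.maximalIdeal R).map (algebraMap R (integralClosure R K))) := by
    rw [← e]
    exact dq_eq_length hfC
  rw [h6, length_quotient_map hres, IsIntegralClosure.rank R K₀ K]

end Uniformizer

theorem residue_of_isLocalization {k P R : Type} [Field k] [CommRing P] [CommRing R]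
    [Algebra k P] [Algebra k R] [Algebra P R] [IsScalarTower k P R] (I : Ideal P) [I.IsPrime]
    [IsLocalization.AtPrime R I] [IsLocalRing R] (h8 : ∀ p : P, ∃ c : k, p - algebraMap k P c ∈ I)
    (r : R) : ∃ c : k, r - algebraMap k R c ∈ IsLocalRing.maximalIdeal R := by
  obtain ⟨⟨a, s⟩, hr⟩ := IsLocalization.surj I.primeCompl r
  simp only at hr
  obtain ⟨ca, hca⟩ := h8 a
  obtain ⟨cs, hcs⟩ := h8 s
  have hcs0 : cs ≠ 0 := by
    rintro rfl
    rw [map_zero, sub_zero] at hcs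
    exact s.2 hcs
  refine ⟨ca / cs, ?_⟩
  have hs : algebraMap P R s ∉ IsLocalRing.maximalIdeal R := fun h =>
    s.2 ((IsLocalization.AtPrime.to_map_mem_maximal_iff R I (s : P)).1 h)
  refine ((IsLocalRing.maximalIdeal.isMaximal R).isPrime.mem_or_mem ?_).resolve_right hs
  have h10 : (a : P) - algebraMap k P (ca / cs) * s ∈ I := by
    have h11 : (a : P) - algebraMap k P (ca / cs) * s =
        (a - algebraMap k P ca) - algebraMap k P (ca / cs) * (s - algebraMap k P cs) := by
      rw [mul_sub, ← map_mul, div_mul_cancel₀ _ hcs0]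
      ring
    rw [h11]
    exact Ideal.sub_mem _ hca (Ideal.mul_mem_left _ _ hcs)
  have h12 := (IsLocalization.AtPrime.to_map_mem_maximal_iff R I _).2 h10
  rw [map_sub, map_mul, ← hr, ← IsScalarTower.algebraMap_apply] at h12
  rw [sub_mul]
  exact h12

/-! ### Counting zeros of f by [K : k(f)], and the product formula. -/

section Transcendental

variable {k K : Type} [Field k] [Field K] [Algebra k K]

/-- R is k[f] localized at f. Its integral closure B in K is principal and free of rank [K : K₀]
over R, so dim B/fB is that rank. The places where f vanishes are among those over B, and the other
places over B contribute 0. -/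
theorem sum_zeros_of_isLocalization (P : Subalgebra k K) [IsPrincipalIdealRing P] {f : K}
    (hfP : f ∈ P) (hP : P ≤ Algebra.adjoin k {f}) (h2 : Prime (⟨f, hfP⟩ : P))
    (h8 : ∀ p : P, ∃ c : k, p - algebraMap k P c ∈ Ideal.span {(⟨f, hfP⟩ : P)})
    (R K₀ : Type) [CommRing R] [IsDomain R] [IsPrincipalIdealRing R] [IsLocalRing R] [Field K₀]
    [Algebra R K₀] [IsFractionRing R K₀] [Algebra K₀ K] [Algebra R K] [IsScalarTower R K₀ K]
    [Algebra k R] [IsScalarTower k R K] [Algebra P R] [IsScalarTower k P R] [IsScalarTower P R K]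
    [FiniteDimensional K₀ K] [Algebra.IsSeparable K₀ K] [(Ideal.span {(⟨f, hfP⟩ : P)}).IsPrime]
    [IsLocalization.AtPrime R (Ideal.span {(⟨f, hfP⟩ : P)})] :
    {V ∈ places k K | f ∈ V ∧ (dq V f).toNat ≠ 0}.Finite ∧
    ∑ᶠ V ∈ {V ∈ places k K | f ∈ V}, (dq V f).toNat = Module.finrank K₀ K := by
  set f₀ : P := ⟨f, hfP⟩
  have h7 : IsLocalRing.maximalIdeal R = Ideal.span {algebraMap P R f₀} := by
    rw [← IsLocalization.map_under (Ideal.span {f₀}).primeCompl R (IsLocalRing.maximalIdeal R),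
      IsLocalization.AtPrime.under_maximalIdeal R (Ideal.span {f₀}), Ideal.map_span,
      Set.image_singleton]
  obtain ⟨hB1, hB2, hB3⟩ := dq_integralClosure (k := k) (K := K) R K₀ h7
    (residue_of_isLocalization _ h8)
  rw [← IsScalarTower.algebraMap_apply P R K] at hB3
  change dq _ f = _ at hB3
  set B := (integralClosure R K).restrictScalars k
  have hf0 : f ≠ 0 := fun h => h2.ne_zero (Subtype.ext h)
  have hfB : f ∈ B := by
    have h := (algebraMap R (integralClosure R K) (algebraMap P R f₀)).2
    change algebraMap R K _ ∈ _ at h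
    rwa [← IsScalarTower.algebraMap_apply P R K] at h
  have h13 : ∀ V ∈ places k K, f⁻¹ ∉ V → V ∈ placesOver B := by
    intro V hV hfV
    have hPV : V ∈ placesOver P := ⟨hV, hP.trans (Algebra.adjoin_le
      (Set.singleton_subset_iff.2 ((hV.2 f).resolve_right hfV)))⟩
    refine ⟨hV, fun x hx => mem_of_isIntegral_of_le (R := R) hV (fun r => ?_) hx⟩
    obtain ⟨⟨a, s⟩, hr⟩ := IsLocalization.surj (Ideal.span {f₀}).primeCompl r
    have hs0 : (s : P) ≠ 0 := fun h => s.2 (h ▸ Ideal.zero_mem _)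
    have hs : ((s : P) : K)⁻¹ ∈ V := inv_mem_of_coprime hPV
      ((h2.irreducible.coprime_iff_not_dvd).2 fun h => s.2 (Ideal.mem_span_singleton.2 h)).symm
      hs0 hfV
    have hr' : algebraMap R K r * (s : P) = (a : P) := by
      have := congrArg (algebraMap R K) hr
      rwa [map_mul, ← IsScalarTower.algebraMap_apply P R K, ← IsScalarTower.algebraMap_apply P R K] at this
    have hs0' : ((s : P) : K) ≠ 0 := fun h => hs0 (Subtype.ext h)
    rw [← mul_inv_cancel_right₀ hs0' (algebraMap R K r), hr']
    exact V.mul_mem (hPV.2 a.2) hs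
  obtain ⟨-, hB4, hB5⟩ := toNat_dq_eq_finsum B hfB hf0 (by rw [hB3]; exact ENat.natCast_ne_top _)
  rw [hB3, ENat.toNat_natCast] at hB5
  have h14 : {V ∈ places k K | f ∈ V} ∩ Function.support (fun V => (dq V f).toNat) =
      placesOver B ∩ Function.support (fun V => (dq V f).toNat) := by
    ext V
    refine ⟨fun h => ⟨h13 V h.1.1 fun h' => h.2 ?_, h.2⟩, fun h => ⟨⟨h.1.1, h.1.2 hfB⟩, h.2⟩⟩
    simp [dq_eq_zero h.1.2 hf0 h']
  refine ⟨hB4.subset fun V hV => ?_, ?_⟩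
  · exact ⟨(h14 ▸ (⟨⟨hV.1, hV.2.1⟩, hV.2.2⟩ :
      V ∈ {V ∈ places k K | f ∈ V} ∩ Function.support (fun V => (dq V f).toNat)) :
      V ∈ placesOver B ∩ Function.support (fun V => (dq V f).toNat)).1, hV.2.2⟩
  · rw [hB5]
    exact finsum_mem_inter_support_eq _ _ _ h14


variable [CharZero k]

open scoped IntermediateField.algebraAdjoinAdjoin in
open IntermediateField in
theorem sum_zeros {f : K} (hf : Transcendental k f) [FiniteDimensional k⟮f⟯ K] :
    {V ∈ places k K | f ∈ V ∧ (dq V f).toNat ≠ 0}.Finite ∧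
    ∑ᶠ V ∈ {V ∈ places k K | f ∈ V}, (dq V f).toNat = Module.finrank k⟮f⟯ K := by
  let P := Algebra.adjoin k {f}
  let f₀ : P := ⟨f, Algebra.self_mem_adjoin_singleton k f⟩
  let e : Polynomial k ≃ₐ[k] P := Polynomial.algEquivOfTranscendental k f hf
  have heX : e Polynomial.X = f₀ := Polynomial.aeval_X _
  have h1 : IsPrincipalIdealRing P :=
    IsPrincipalIdealRing.of_surjective e.toRingEquiv.toRingHom e.surjective
  have h2 : Prime f₀ := by
    rw [← heX]
    exact (MulEquiv.prime_iff e).2 Polynomial.prime_X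
  have h3 : (Ideal.span {f₀}).IsPrime := (Ideal.span_singleton_prime h2.ne_zero).2 h2
  have h8 : ∀ p : P, ∃ c : k, p - algebraMap k P c ∈ Ideal.span {f₀} := by
    intro p
    obtain ⟨q, rfl⟩ := e.surjective p
    refine ⟨q.coeff 0, Ideal.mem_span_singleton.2 ?_⟩
    have : Polynomial.X ∣ q - algebraMap k (Polynomial k) (q.coeff 0) := by
      rw [Polynomial.X_dvd_iff, Polynomial.algebraMap_eq, Polynomial.coeff_sub,
        Polynomial.coeff_C_zero, sub_self]
    rw [← heX, ← AlgEquiv.commutes e, ← map_sub]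
    exact map_dvd e this
  let R := Localization.subalgebra.ofField k⟮f⟯ (Ideal.span {f₀}).primeCompl
    (Ideal.primeCompl_le_nonZeroDivisors _)
  have h4 : IsLocalization.AtPrime R (Ideal.span {f₀}) :=
    Localization.subalgebra.isLocalization_ofField _ _ _
  have h5 : IsLocalRing R := IsLocalization.AtPrime.isLocalRing R (Ideal.span {f₀})
  have h6 : IsDiscreteValuationRing R :=
    IsLocalization.AtPrime.isDiscreteValuationRing_of_dedekind_domain P
      (by rw [Ne, Ideal.span_singleton_eq_bot]; exact h2.ne_zero) R
  exact sum_zeros_of_isLocalization P f₀.2 le_rfl h2 h8 R k⟮f⟯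

open IntermediateField in
/-- The product formula: a function has as many zeros as poles. -/
theorem finsum_vo [IsAlgClosed k]
    (hK : ∀ f : K, Transcendental k f → FiniteDimensional k⟮f⟯ K) {f : K} (hf0 : f ≠ 0) :
    {V ∈ places k K | vo V f ≠ 0}.Finite ∧ ∑ᶠ V ∈ places k K, vo V f = 0 := by
  classical
  by_cases hf : Transcendental k f
  · have hf' : Transcendental k f⁻¹ := fun h => hf (by simpa using h.inv)
    have h1 := hK f hf
    have h2 := hK _ hf'
    -- The poles of f are the zeros of f⁻¹, so both counts give the same degree.
    have h7 : k⟮f⁻¹⟯ = k⟮f⟯ := by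
      apply le_antisymm
      · rw [adjoin_simple_le_iff]
        exact inv_mem (mem_adjoin_simple_self k f)
      · rw [adjoin_simple_le_iff]
        simpa using inv_mem (mem_adjoin_simple_self k f⁻¹)
    have key : ∀ g : K, {V ∈ places k K | g ∈ V ∧ (dq V g).toNat ≠ 0}.Finite →
        (places k K ∩ Function.support fun V =>
          if g ∈ V then ((dq V g).toNat : ℤ) else 0).Finite ∧
        ∑ᶠ V ∈ places k K, (if g ∈ V then ((dq V g).toNat : ℤ) else 0) =
          ((∑ᶠ V ∈ {V ∈ places k K | g ∈ V}, (dq V g).toNat : ℕ) : ℤ) := by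
      intro g hg
      refine ⟨hg.subset fun V hV => ?_, ?_⟩
      · have hV' := hV.2
        simp only [Function.mem_support, ne_eq, ite_eq_right_iff, not_forall] at hV'
        obtain ⟨h, h'⟩ := hV'
        exact ⟨hV.1, h, fun e => h' (by simp [e])⟩
      · have e := (Nat.castAddMonoidHom ℤ).map_finsum_mem' (f := fun V => (dq V g).toNat)
          (s := {V ∈ places k K | g ∈ V}) (hg.subset fun V hV => ⟨hV.1.1, hV.1.2, hV.2⟩)
        simp only [Nat.coe_castAddMonoidHom] at e
        rw [e]
        calc _ = ∑ᶠ V ∈ {V ∈ places k K | g ∈ V}, (if g ∈ V then ((dq V g).toNat : ℤ) else 0) := by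
              refine finsum_mem_inter_support_eq _ _ _ ?_
              ext V
              refine ⟨fun h => ⟨⟨h.1, by_contra fun h' => h.2 (if_neg h')⟩, h.2⟩,
                fun h => ⟨h.1.1, h.2⟩⟩
          _ = _ := finsum_mem_congr rfl fun V hV => if_pos hV.2
    obtain ⟨h3, h4⟩ := sum_zeros hf
    obtain ⟨h5, h6⟩ := sum_zeros hf'
    rw [h7] at h6
    obtain ⟨h8, h9⟩ := key f h3
    obtain ⟨h10, h11⟩ := key f⁻¹ h5
    have h12 : ∀ V ∈ places k K, vo V f = (if f ∈ V then ((dq V f).toNat : ℤ) else 0) -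
        (if f⁻¹ ∈ V then ((dq V f⁻¹).toNat : ℤ) else 0) := by
      intro V hV
      rw [vo]
      by_cases h : f ∈ V
      · by_cases h' : f⁻¹ ∈ V
        · rw [dq_eq_zero h' (inv_ne_zero hf0) (by rwa [inv_inv])]
          simp [h]
        · simp [h, h']
      · have h' := (hV.2 f).resolve_left h
        simp [h, h']
    have hfin : {V ∈ places k K | vo V f ≠ 0}.Finite := by
      refine (h8.union h10).subset fun V hV => ?_
      by_contra hc
      simp only [Set.mem_union, Set.mem_inter_iff, Function.mem_support, not_or, not_and,
        not_not] at hc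
      exact hV.2 (by rw [h12 V hV.1, hc.1 hV.1, hc.2 hV.1, sub_zero])
    refine ⟨hfin, ?_⟩
    have h13 := finsum_mem_add_distrib' hfin h10
    rw [h11, h6, finsum_mem_congr rfl fun V hV => by rw [h12 V hV, sub_add_cancel], h9, h4] at h13
    linarith
  -- An algebraic f is constant because k is algebraically closed, and has order 0 at every place.
  · have hint : IsIntegral k f := (not_not.1 hf).isIntegral
    have : Algebra.IsAlgebraic k k⟮f⟯ := isAlgebraic_adjoin_simple hint
    obtain ⟨c, hc⟩ := (IsAlgClosed.algebraMap_bijective_of_isIntegral (k := k) (K := k⟮f⟯)).2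
      ⟨f, mem_adjoin_simple_self k f⟩
    have hc' : algebraMap k K c = f := congrArg Subtype.val hc
    have h0 : ∀ V : Subalgebra k K, vo V f = 0 := by
      intro V
      have hV : f ∈ V := hc' ▸ V.algebraMap_mem c
      have hV' : f⁻¹ ∈ V := by
        rw [← hc', ← map_inv₀]
        exact V.algebraMap_mem _
      rw [vo, if_pos hV, dq_eq_zero hV hf0 hV']
      rfl
    exact ⟨by simp [h0], by simp [h0]⟩

end Transcendental

/-! ### Orders at a one-dimensional local ring as sums over the places above. -/

section Local

variable {k K : Type} [Field k] [Field K] [Algebra k K]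

/-- c is a common denominator of finitely many generators of the integral closure. -/
theorem exists_conductor (O : Subalgebra k K) [IsFractionRing O K]
    (hfin : Module.Finite O (integralClosure O K)) :
    ∃ c ∈ O, c ≠ 0 ∧ ∀ b ∈ integralClosure O K, c * b ∈ O := by
  classical
  obtain ⟨s, hs⟩ := hfin.fg_top
  obtain ⟨c, hc⟩ := IsLocalization.exist_integer_multiples_of_finset (nonZeroDivisors O)
    (s.image (Subtype.val : integralClosure O K → K))
  refine ⟨c, c.1.2, fun h => nonZeroDivisors.coe_ne_zero c (Subtype.ext h), fun b hb => ?_⟩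
  have : (⟨b, hb⟩ : integralClosure O K) ∈ Submodule.span O (s : Set (integralClosure O K)) :=
    hs ▸ Submodule.mem_top
  have key : ∀ x : integralClosure O K, x ∈ Submodule.span O (s : Set (integralClosure O K)) →
      (c : K) * (x : K) ∈ O := by
    intro x hx
    induction hx using Submodule.span_induction with
    | mem x hx =>
      obtain ⟨y, hy⟩ := hc x (Finset.mem_image_of_mem _ hx)
      have hy' : (y : K) = (c : K) * (x : K) := hy
      exact hy' ▸ y.2
    | zero => simp
    | add x y _ _ hx hy =>
      have : (c : K) * ((x + y : integralClosure O K) : K) = c * x + c * y := mul_add _ _ _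
      exact this ▸ O.add_mem hx hy
    | smul r x _ hx =>
      have : (c : K) * ((r • x : integralClosure O K) : K) = r * (c * x) := mul_left_comm _ _ _
      exact this ▸ O.mul_mem r.2 hx
  exact key _ this

/-- Lengths over O are dimensions over k by `hres`. The conductor allows O to be replaced by its
integral closure, which is principal, and there the dimension is a sum over places. -/
theorem sum_vo_local (O : Subalgebra k K) [IsLocalRing O] [IsNoetherianRing O]
    [Ring.DimensionLEOne O] [IsFractionRing O K] (hfin : Module.Finite O (integralClosure O K))
    (hres : ∀ r : O, ∃ c : k, r - algebraMap k O c ∈ IsLocalRing.maximalIdeal O) {g h : O}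
    (hg : g ≠ 0) (hh : h ≠ 0) :
    ∑ᶠ V ∈ placesOver O, vo V ((g : K) / h) =
      ((Ring.ord O g).toNat : ℤ) - ((Ring.ord O h).toNat : ℤ) := by
  have hcoe : ∀ {x : O}, x ≠ 0 → (x : K) ≠ 0 := fun hx h => hx (Subtype.ext h)
  have hord : ∀ x : O, x ≠ 0 → dq O (x : K) = Ring.ord O x ∧ Ring.ord O x ≠ ⊤ := by
    intro x hx
    have hx' : x ∈ nonZeroDivisors O := mem_nonZeroDivisors_of_ne_zero hx
    refine ⟨?_, Ring.ord_ne_top hx'⟩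
    rw [dq_eq_length x.2, Ring.ord]
    exact length_eq_of_residue hres (isFiniteLength_quotient_span_singleton O hx')
  obtain ⟨c, hcO, hc0, hc⟩ := exists_conductor O hfin
  let B : Subalgebra k K := (integralClosure O K).restrictScalars k
  have hOB : O ≤ B := fun x hx => (algebraMap O (integralClosure O K) ⟨x, hx⟩).2
  have h1 : IsIntegrallyClosed (integralClosure O K) :=
    integralClosure.isIntegrallyClosedOfFiniteExtension K
  have h2 : Ring.DimensionLEOne (integralClosure O K) := Ring.DimensionLEOne.integralClosure O K
  have h3 : IsPrincipalIdealRing B := isPrincipalIdealRing_of_finite O (integralClosure O K)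
  have h4 : IsFractionRing B K := integralClosure.isFractionRing_of_finite_extension (A := O) K K
  have h5 : placesOver B = placesOver O := by
    ext V
    refine ⟨fun hV => ⟨hV.1, hOB.trans hV.2⟩, fun hV => ⟨hV.1, fun x hx => ?_⟩⟩
    exact mem_of_isIntegral_of_le (R := O) hV.1 (fun r => hV.2 r.2) hx
  have key : ∀ x : O, x ≠ 0 → (∀ V ∈ placesOver O, dq V (x : K) ≠ ⊤) ∧
      {V ∈ placesOver O | (dq V (x : K)).toNat ≠ 0}.Finite ∧
      (Ring.ord O x).toNat = ∑ᶠ V ∈ placesOver O, (dq V (x : K)).toNat := by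
    intro x hx
    have e : dq O (x : K) = dq B (x : K) := by
      refine dq_eq_of_conductor (c := c) hOB hc0 hc ?_ x.2 (hcoe hx)
      have := hord ⟨c, hcO⟩ fun h => hc0 (congrArg Subtype.val h)
      rw [← this.1] at this
      exact this.2
    have h6 := toNat_dq_eq_finsum B (hOB x.2) (hcoe hx)
      (by rw [← e, (hord x hx).1]; exact (hord x hx).2)
    rw [h5, ← e, (hord x hx).1] at h6
    exact h6
  obtain ⟨h6, h7, h8⟩ := key g hg
  obtain ⟨h9, h10, h11⟩ := key h hh
  have hvo : ∀ V ∈ placesOver O, vo V ((g : K) / h) =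
      ((dq V (g : K)).toNat : ℤ) - ((dq V (h : K)).toNat : ℤ) := fun V hV =>
    vo_div hV.1 (hV.2 g.2) (hV.2 h.2) (hcoe hg) (hcoe hh) (h6 V hV) (h9 V hV)
  have hsupp : ∀ x : O, {V ∈ placesOver O | (dq V (x : K)).toNat ≠ 0}.Finite →
      (placesOver O ∩ Function.support fun V => ((dq V (x : K)).toNat : ℤ)).Finite ∧
      ((∑ᶠ V ∈ placesOver O, (dq V (x : K)).toNat : ℕ) : ℤ) =
        ∑ᶠ V ∈ placesOver O, ((dq V (x : K)).toNat : ℤ) := by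
    intro x hx
    refine ⟨hx.subset fun V hV => ⟨hV.1, fun e => hV.2 (by simp [e])⟩, ?_⟩
    exact (Nat.castAddMonoidHom ℤ).map_finsum_mem' (f := fun V => (dq V (x : K)).toNat) hx
  obtain ⟨h12, h13⟩ := hsupp g h7
  obtain ⟨h14, h15⟩ := hsupp h h10
  have hfin' : (placesOver O ∩ Function.support fun V => vo V ((g : K) / h)).Finite := by
    refine (h12.union h14).subset fun V hV => ?_
    by_contra hn
    simp only [Set.mem_union, Set.mem_inter_iff, Function.mem_support, not_or, not_and,
      not_not] at hn
    exact hV.2 (by simp only [hvo V hV.1, hn.1 hV.1, hn.2 hV.1, sub_zero])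
  have h16 := finsum_mem_add_distrib' hfin' h14
  rw [finsum_mem_congr rfl fun V hV => by rw [hvo V hV, sub_add_cancel], ← h13, ← h15] at h16
  rw [h8, h11]
  linarith

end Local

/-! ### Coordinate rings of affine curves -/

section AffineCurve

theorem dimensionLEOne_of_isIntegral (P A : Type) [CommRing P] [CommRing A] [IsDomain A]
    [Algebra P A] [Ring.DimensionLEOne A] [Algebra.IsIntegral P A] [FaithfulSMul P A] :
    Ring.DimensionLEOne P where
  maximalOfPrime := by
    intro p hp _
    have hinj := FaithfulSMul.algebraMap_injective P A
    obtain ⟨Q, hQ, hQ'⟩ := Ideal.exists_ideal_over_prime_of_isIntegral_of_isDomain (S := A) p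
      (by simp [(RingHom.injective_iff_ker_eq_bot _).1 hinj])
    have hQ0 : Q ≠ ⊥ := by
      rintro rfl
      refine hp ?_
      rw [← hQ', ← RingHom.ker_eq_comap_bot, (RingHom.injective_iff_ker_eq_bot _).1 hinj]
    have := Ring.DimensionLEOne.maximalOfPrime hQ0 hQ
    exact hQ' ▸ Ideal.isMaximal_comap_of_isIntegral_of_isMaximal Q

/-- Noether normalization; by lying over, the polynomial ring inherits dimension at most one, which
bounds the number of variables. -/
theorem exists_normalization (k A : Type) [Field k] [CommRing A] [IsDomain A] [Algebra k A]
    [Algebra.FiniteType k A] [Ring.DimensionLEOne A] :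
    ∃ s ≤ 1, ∃ g : MvPolynomial (Fin s) k →ₐ[k] A, Function.Injective g ∧ g.Finite := by
  obtain ⟨s, g, hg, hfin⟩ := exists_finite_inj_algHom_of_fg k A
  refine ⟨s, ?_, g, hg, hfin⟩
  algebraize [g.toRingHom]
  have : Module.Finite (MvPolynomial (Fin s) k) A := hfin
  have : FaithfulSMul (MvPolynomial (Fin s) k) A := (faithfulSMul_iff_algebraMap_injective _ _).2 hg
  have h1 : Ring.DimensionLEOne (MvPolynomial (Fin s) k) :=
    dimensionLEOne_of_isIntegral _ A
  have h2 : ringKrullDim (MvPolynomial (Fin s) k) ≤ 1 :=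
    (Ring.krullDimLE_iff (n := 1)).1 inferInstance
  rw [MvPolynomial.ringKrullDim_of_isNoetherianRing, ringKrullDim_eq_zero_of_field] at h2
  simpa using h2

theorem essFiniteType_fractionRing (k A K : Type) [Field k] [CommRing A] [Field K] [Algebra k A]
    [Algebra A K] [Algebra k K] [IsScalarTower k A K] [IsFractionRing A K]
    [Algebra.FiniteType k A] : Algebra.EssFiniteType k K := by
  have : Algebra.EssFiniteType A K := Algebra.EssFiniteType.of_isLocalization K (nonZeroDivisors A)
  exact Algebra.EssFiniteType.comp k A K

-- K has transcendence degree at most one, so it is algebraic over k(f); being finitely generated as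
-- a field, it is finite.
open IntermediateField in
theorem finiteDimensional_of_transcendental {k : Type} (A : Type) {K : Type} [Field k] [CommRing A] [IsDomain A] [Field K]
    [Algebra k A] [Algebra A K] [Algebra k K] [IsScalarTower k A K] [IsFractionRing A K]
    [Algebra.FiniteType k A] [Ring.DimensionLEOne A] {f : K} (hf : Transcendental k f) :
    FiniteDimensional k⟮f⟯ K := by
  obtain ⟨s, hs, g, hg, hfin⟩ := exists_normalization k A
  have h1 : Algebra.trdeg k K ≤ 1 := by
    let g' : MvPolynomial (Fin s) k →ₐ[k] K := (IsScalarTower.toAlgHom k A K).comp g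
    have hg' : Function.Injective g' := (IsFractionRing.injective A K).comp hg
    algebraize [g.toRingHom, g'.toRingHom]
    have h2 : Module.Finite (MvPolynomial (Fin s) k) A := hfin
    have h3 : FaithfulSMul (MvPolynomial (Fin s) k) K :=
      (faithfulSMul_iff_algebraMap_injective _ _).2 hg'
    have : IsScalarTower (MvPolynomial (Fin s) k) A K := IsScalarTower.of_algebraMap_eq fun _ => rfl
    have : IsScalarTower k (MvPolynomial (Fin s) k) K :=
      IsScalarTower.of_algebraMap_eq fun c => (g'.commutes c).symm
    have : Algebra.IsAlgebraic A K := IsLocalization.isAlgebraic K (nonZeroDivisors A)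
    have : Algebra.IsAlgebraic (MvPolynomial (Fin s) k) K :=
      Algebra.IsAlgebraic.trans _ A _
    have h4 := trdeg_add_eq k (MvPolynomial (Fin s) k) (A := K)
    rw [trdeg_eq_zero (R := MvPolynomial (Fin s) k), add_zero,
      MvPolynomial.trdeg_of_isDomain] at h4
    rw [← h4]
    simpa using hs
  have h5 : Algebra.trdeg k⟮f⟯ K = 0 := by
    have h6 := trdeg_add_eq k k⟮f⟯ (A := K)
    have h7 : 1 ≤ Algebra.trdeg k k⟮f⟯ := by
      have : Algebra.Transcendental k k⟮f⟯ := ⟨AdjoinSimple.gen k f, fun h => hf (by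
        simpa using h.algebraMap (A := K))⟩
      exact Cardinal.one_le_iff_pos.2 (trdeg_pos _ _)
    by_contra h8
    have h9 := add_le_add h7 (Cardinal.one_le_iff_pos.2 (pos_iff_ne_zero.2 h8))
    rw [h6] at h9
    have h10 := h9.trans h1
    norm_num at h10
  have : Algebra.IsAlgebraic k⟮f⟯ K := trdeg_eq_zero_iff.1 h5
  have := essFiniteType_fractionRing k A K
  have : Algebra.EssFiniteType k⟮f⟯ K := Algebra.EssFiniteType.of_comp k _ _
  exact Algebra.finite_of_essFiniteType_of_isAlgebraic

/-- By transitivity this is also the integral closure of a polynomial ring P. As P is normal and K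
is finite and, in characteristic zero, separable over Frac P, it is finite over P. -/
theorem finite_integralClosure (k A K : Type) [Field k] [CommRing A] [IsDomain A] [Field K]
    [Algebra k A] [Algebra A K] [Algebra k K] [IsScalarTower k A K] [IsFractionRing A K]
    [Algebra.FiniteType k A] [Ring.DimensionLEOne A] [CharZero k] : Module.Finite A (integralClosure A K) := by
  obtain ⟨s, hs, g, hg, hfin⟩ := exists_normalization k A
  let P := MvPolynomial (Fin s) k
  have : IsDomain P := inferInstance
  let g' : P →ₐ[k] K := (IsScalarTower.toAlgHom k A K).comp g
  have hg' : Function.Injective g' := (IsFractionRing.injective A K).comp hg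
  algebraize [g.toRingHom, g'.toRingHom]
  have h2 : Module.Finite P A := hfin
  have h3 : FaithfulSMul P K :=
    (faithfulSMul_iff_algebraMap_injective _ _).2 hg'
  have : IsScalarTower P A K := IsScalarTower.of_algebraMap_eq fun _ => rfl
  have : IsScalarTower k P K :=
    IsScalarTower.of_algebraMap_eq fun c => (g'.commutes c).symm
  have : Algebra.IsAlgebraic A K := IsLocalization.isAlgebraic K (nonZeroDivisors A)
  have : Algebra.IsAlgebraic P K :=
    Algebra.IsAlgebraic.trans _ A _
  let _ : Algebra (FractionRing P) K := FractionRing.liftAlgebra (R := P) K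
  have h4 : IsScalarTower P (FractionRing P) K := inferInstance
  have h5 : Algebra.IsAlgebraic (FractionRing P) K :=
    (IsFractionRing.comap_isAlgebraic_iff (A := P)).1 inferInstance
  have := essFiniteType_fractionRing k A K
  have : IsScalarTower k (FractionRing P) K := IsScalarTower.of_algebraMap_eq fun c => by
    rw [IsScalarTower.algebraMap_apply k P K, IsScalarTower.algebraMap_apply k P (FractionRing P),
      ← IsScalarTower.algebraMap_apply P (FractionRing P) K]
  have : Algebra.EssFiniteType (FractionRing P) K := Algebra.EssFiniteType.of_comp k _ _
  have : FiniteDimensional (FractionRing P) K := Algebra.finite_of_essFiniteType_of_isAlgebraic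
  have : CharZero (FractionRing P) :=
    charZero_of_injective_algebraMap (algebraMap k (FractionRing P)).injective
  have h6 : IsIntegralClosure (integralClosure A K) P K := 
    { algebraMap_injective := Subtype.val_injective
      isIntegral_iff := by
        intro x
        refine ⟨fun hx => ⟨⟨x, hx.tower_top⟩, rfl⟩, ?_⟩
        rintro ⟨y, rfl⟩
        exact isIntegral_trans (A := A) _ y.2 }
  have h7 : Module.Finite P (integralClosure A K) :=
    IsIntegralClosure.finite P (FractionRing P) K _
  exact Module.Finite.of_restrictScalars_finite P A _

theorem finite_integralClosure_localization {A K : Type} [CommRing A] [Field K] [Algebra A K] (h : Module.Finite A (integralClosure A K))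
    (M : Submonoid A) (O : Type) [CommRing O] [Algebra A O] [IsLocalization M O] [Algebra O K]
    [IsScalarTower A O K] : Module.Finite O (integralClosure O K) := by
  classical
  obtain ⟨s, hs⟩ := h.fg_top
  let φ : integralClosure A K → integralClosure O K := fun x => ⟨x, IsIntegral.tower_top x.2⟩
  refine ⟨s.image φ, ?_⟩
  rw [eq_top_iff]
  intro x _
  have key : ∀ y : integralClosure A K, φ y ∈ Submodule.span O ((s.image φ : Finset _) : Set _) := by
    intro y
    have hy : y ∈ Submodule.span A (s : Set (integralClosure A K)) := hs ▸ Submodule.mem_top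
    induction hy using Submodule.span_induction with
    | mem y hy => exact Submodule.subset_span (Finset.mem_coe.2 (Finset.mem_image_of_mem φ hy))
    | zero => exact Submodule.zero_mem _
    | add y z _ _ hy hz => exact Submodule.add_mem _ hy hz
    | smul a y _ hy =>
      have e : φ (a • y) = algebraMap A O a • φ y := Subtype.ext (algebraMap_smul O a (y : K)).symm
      exact e ▸ Submodule.smul_mem _ _ hy
  obtain ⟨m, hm⟩ := IsIntegral.exists_multiple_integral_of_isLocalization M (x : K) x.2
  obtain ⟨u, hu⟩ := IsLocalization.map_units O m
  have e : x = (u⁻¹ : Oˣ) • φ ⟨_, hm⟩ := by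
    rw [eq_inv_smul_iff]
    refine Subtype.ext ?_
    change (u : O) • (x : K) = (m : A) • (x : K)
    rw [hu, algebraMap_smul]
  rw [e]
  exact Submodule.smul_mem _ _ (key _)

end AffineCurve

/-! ### Transfer from subalgebras of K to abstract local rings. -/

section LocalRing

theorem ord_ringEquiv {A B : Type} [CommRing A] [CommRing B] (e : A ≃+* B) (x : A) :
    Ring.ord B (e x) = Ring.ord A x := by
  let _ : Algebra A B := e.toRingHom.toAlgebra
  have h1 : Function.Surjective (algebraMap A B) := e.surjective
  let e' : A ≃ₐ[A] B := AlgEquiv.ofRingEquiv (f := e) fun _ => rfl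
  rw [Ring.ord, Ring.ord, ← Module.length_eq_of_surjective h1]
  refine (LinearEquiv.length_eq (Ideal.quotientEquivAlg (Ideal.span {x}) (Ideal.span {e x}) e' ?_).toLinearEquiv).symm
  rw [Ideal.map_span, Set.image_singleton]
  rfl

variable {k K A : Type} [Field k] [Field K] [Algebra k K] [CommRing A]
  [Algebra k A] [Algebra A K] [IsScalarTower k A K] [IsFractionRing A K] [IsLocalRing A]
  [IsNoetherianRing A] [Ring.DimensionLEOne A]

/-- The order of a function at a local ring of a curve is the sum of its orders at the places
above. -/
theorem sum_vo_of_isLocalRing (hfin : Module.Finite A (integralClosure A K))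
    (hres : ∀ r : A, ∃ c : k, r - algebraMap k A c ∈ IsLocalRing.maximalIdeal A) {g h : A}
    (hg : g ≠ 0) (hh : h ≠ 0) :
    ∑ᶠ V ∈ {V ∈ places k K | ∀ a, algebraMap A K a ∈ V}, vo V (algebraMap A K g / algebraMap A K h) =
      ((Ring.ord A g).toNat : ℤ) - ((Ring.ord A h).toNat : ℤ) := by
  let O : Subalgebra k K := (IsScalarTower.toAlgHom k A K).range
  have hinj : Function.Injective (IsScalarTower.toAlgHom k A K) := IsFractionRing.injective A K
  let e : A ≃ₐ[k] O := AlgEquiv.ofInjective _ hinj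
  have he : ∀ a, (e a : K) = algebraMap A K a := fun a => rfl
  have h1 : IsLocalRing O := e.toRingEquiv.isLocalRing
  have h2 : IsNoetherianRing O := isNoetherianRing_of_ringEquiv A e.toRingEquiv
  have h3 : Ring.DimensionLEOne O := Ring.DimensionLEOne.of_ringEquiv e.symm.toRingEquiv
  have h4 : IsFractionRing O K := IsFractionRing.of_field O K fun z => by
    obtain ⟨x, y, -, rfl⟩ := IsFractionRing.div_surjective (A := A) z
    exact ⟨e x, e y, rfl⟩
  have hint : ∀ x : K, IsIntegral A x ↔ IsIntegral O x := fun x =>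
    ⟨fun hx => IsIntegral.map_of_comp_eq e.toRingEquiv.toRingHom (RingHom.id K) rfl hx,
      fun hx => IsIntegral.map_of_comp_eq e.symm.toRingEquiv.toRingHom (RingHom.id K)
        (RingHom.ext fun y => by
          obtain ⟨a, rfl⟩ := e.surjective y
          change algebraMap A K (e.symm (e a)) = (e a : K)
          rw [e.symm_apply_apply, he]) hx⟩
  let e₂ : integralClosure A K ≃+* integralClosure O K :=
    { toFun := fun x => ⟨x, (hint x).1 x.2⟩
      invFun := fun x => ⟨x, (hint x).2 x.2⟩
      left_inv := fun _ => rfl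
      right_inv := fun _ => rfl
      map_mul' := fun _ _ => rfl
      map_add' := fun _ _ => rfl }
  have h5 : Module.Finite O (integralClosure O K) :=
    Module.Finite.of_equiv_equiv e.toRingEquiv e₂ (RingHom.ext fun _ => rfl)
  have h6 : ∀ r : O, ∃ c : k, r - algebraMap k O c ∈ IsLocalRing.maximalIdeal O := by
    intro r
    obtain ⟨a, rfl⟩ := e.surjective r
    obtain ⟨c, hc⟩ := hres a
    refine ⟨c, ?_⟩
    rw [← e.commutes, ← map_sub]
    rw [IsLocalRing.mem_maximalIdeal, mem_nonunits_iff] at hc ⊢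
    exact fun hu => hc ((isUnit_map_iff e.toRingEquiv _).1 hu)
  have h7 : {V ∈ places k K | ∀ a, algebraMap A K a ∈ V} = placesOver O := by
    ext V
    refine and_congr_right fun _ => ⟨?_, fun hV a => hV (e a).2⟩
    rintro hV _ ⟨a, rfl⟩
    exact hV a
  have h8 := sum_vo_local O h5 h6 (g := e g) (h := e h) (by simpa using hg) (by simpa using hh)
  have h9 : ∀ a, Ring.ord O (e a) = Ring.ord A a := ord_ringEquiv e.toRingEquiv
  rw [h9, h9] at h8
  rw [h7]
  exact h8

end LocalRing

/-! ### Function fields of proper curves -/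

section ProperCurve

variable {X : Scheme.{0}}

/-- The local ring at a point of a scheme over `ℂ` as a `ℂ`-algebra. -/
abbrev stalkAlg (π : X ⟶ Spec (.of ℂ)) (z : X) : Algebra ℂ (X.presheaf.stalk z) :=
  ((gm (V := ⊤) (Set.mem_univ z)).comp (const π ⊤)).toAlgebra

theorem algebraMap_stalkAlg (π : X ⟶ Spec (.of ℂ)) (z : X) (U : X.Opens) (hz : z ∈ U) (c : ℂ) :
    letI := stalkAlg π z
    algebraMap ℂ (X.presheaf.stalk z) c = gm hz (const π U c) := by
  change gm _ (const π ⊤ c) = _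
  rw [← res_const π (le_top : U ≤ ⊤) c, gm_res le_top hz]

theorem isMaximal_of_isClosed {U : X.Opens} (hU : IsAffineOpen U) (x : U)
    (hx : IsClosed ({x.1} : Set X)) : (hU.primeIdealOf x).asIdeal.IsMaximal := by
  rw [← PrimeSpectrum.isClosed_singleton_iff_isMaximal]
  have e : hU.fromSpec ⁻¹' {x.1} = {hU.primeIdealOf x} := Set.ext fun y => by
    rw [Set.mem_preimage, Set.mem_singleton_iff, ← hU.fromSpec_primeIdealOf x]
    exact hU.fromSpec.isOpenEmbedding.injective.eq_iff
  exact e ▸ hx.preimage hU.fromSpec.continuous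

/-- The Nullstellensatz: in an affine neighbourhood the closed point is a maximal ideal with residue
field ℂ. -/
theorem residue_stalk (π : X ⟶ Spec (.of ℂ)) [LocallyOfFiniteType π] {z : X} (hz : IsClosed ({z} : Set X)) (r : X.presheaf.stalk z) :
    letI := stalkAlg π z
    ∃ c : ℂ, r - algebraMap ℂ _ c ∈ IsLocalRing.maximalIdeal (X.presheaf.stalk z) := by
  let _ := stalkAlg π z
  obtain ⟨U, hU, hzU, -⟩ := exists_isAffineOpen_mem_and_subset (x := z) (U := ⊤) trivial
  let _ : Algebra ℂ Γ(X, U) := (const π U).toAlgebra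
  have : Algebra.FiniteType ℂ Γ(X, U) := finiteType_const π hU
  have h1 := hU.isLocalization_stalk ⟨z, hzU⟩
  have h2 := isMaximal_of_isClosed hU ⟨z, hzU⟩ hz
  let _ : Algebra Γ(X, U) (X.presheaf.stalk z) := TopCat.Presheaf.algebra_section_stalk X.presheaf ⟨z, hzU⟩
  have : IsScalarTower ℂ Γ(X, U) (X.presheaf.stalk z) := IsScalarTower.of_algebraMap_eq fun c =>
    algebraMap_stalkAlg π z U hzU c
  refine residue_of_isLocalization (hU.primeIdealOf ⟨z, hzU⟩).asIdeal (fun p => ?_) r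
  let _ := Ideal.Quotient.field (hU.primeIdealOf ⟨z, hzU⟩).asIdeal
  have := finite_of_finite_type_of_isJacobsonRing ℂ (Γ(X, U) ⧸ (hU.primeIdealOf ⟨z, hzU⟩).asIdeal)
  obtain ⟨c, hc⟩ := (IsAlgClosed.algebraMap_bijective_of_isIntegral (k := ℂ)
    (K := Γ(X, U) ⧸ (hU.primeIdealOf ⟨z, hzU⟩).asIdeal)).2 (Ideal.Quotient.mk _ p)
  exact ⟨c, Ideal.Quotient.eq.1 hc.symm⟩

variable [IsIntegral X]

theorem isClosed_of_ne_generic (hX : AtMostOneDim X) {z : X} (hz : z ≠ genericPoint X) :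
    IsClosed ({z} : Set X) := by
  rw [← closure_subset_iff_isClosed]
  intro y hy
  have h := hX _ _ _ ((genericPoint_spec X).specializes (Set.mem_univ z))
    (specializes_iff_mem_closure.2 hy)
  exact (h.resolve_left fun h => hz h.symm).symm

theorem dimensionLEOne_of_isAffineOpen (hX : AtMostOneDim X) {U : X.Opens} (hU : IsAffineOpen U)
    [Nonempty U] : Ring.DimensionLEOne Γ(X, U) where
  maximalOfPrime := by
    intro p hp hp'
    let P : PrimeSpectrum Γ(X, U) := ⟨p, hp'⟩
    have hinj := hU.fromSpec.isOpenEmbedding.injective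
    have hPU : hU.fromSpec P ∈ U := by
      have := Set.mem_range_self (f := hU.fromSpec) P
      rwa [hU.range_fromSpec] at this
    have hne : hU.fromSpec P ≠ genericPoint X := by
      intro h
      have hg : genericPoint X ∈ U := h ▸ hPU
      have h1 := hU.fromSpec_primeIdealOf ⟨_, hg⟩
      rw [hU.primeIdealOf_genericPoint, genericPoint_eq_bot_of_affine] at h1
      exact hp (congrArg PrimeSpectrum.asIdeal (hinj (h.trans h1.symm)))
    have h2 := isMaximal_of_isClosed hU ⟨_, hPU⟩ (isClosed_of_ne_generic hX hne)
    have h3 : hU.primeIdealOf ⟨_, hPU⟩ = P := hinj (hU.fromSpec_primeIdealOf ⟨_, hPU⟩)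
    rwa [h3] at h2

variable (π : X ⟶ Spec (.of ℂ)) 

theorem isScalarTower_stalk (z : X) :
    letI := stalkAlg π z
    letI := stalkAlg π (genericPoint X)
    IsScalarTower ℂ (X.presheaf.stalk z) X.functionField := by
  let _ := stalkAlg π z
  let _ := stalkAlg π (genericPoint X)
  refine IsScalarTower.of_algebraMap_eq fun c => ?_
  exact (TopCat.Presheaf.germ_stalkSpecializes_apply X.presheaf (Set.mem_univ z) _ _).symm

theorem finite_integralClosure_stalk [LocallyOfFiniteType π] (hX : AtMostOneDim X) (z : X) :
    Module.Finite (X.presheaf.stalk z) (integralClosure (X.presheaf.stalk z) X.functionField) := by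
  obtain ⟨U, hU, hzU, -⟩ := exists_isAffineOpen_mem_and_subset (x := z) (U := ⊤) trivial
  let _ : Algebra ℂ Γ(X, U) := (const π U).toAlgebra
  have : Algebra.FiniteType ℂ Γ(X, U) := finiteType_const π hU
  have : Nonempty U := ⟨z, hzU⟩
  have h1 := hU.isLocalization_stalk ⟨z, hzU⟩
  let _ : Algebra Γ(X, U) (X.presheaf.stalk z) := TopCat.Presheaf.algebra_section_stalk X.presheaf ⟨z, hzU⟩
  have : IsScalarTower Γ(X, U) (X.presheaf.stalk z) X.functionField :=
    functionField_isScalarTower X U ⟨z, hzU⟩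
  let _ := stalkAlg π (genericPoint X)
  have : IsScalarTower ℂ Γ(X, U) X.functionField := IsScalarTower.of_algebraMap_eq fun c =>
    algebraMap_stalkAlg π _ U _ c
  have := functionField_isFractionRing_of_isAffineOpen X U hU
  have := dimensionLEOne_of_isAffineOpen hX hU
  exact finite_integralClosure_localization (finite_integralClosure ℂ Γ(X, U) X.functionField)
    (hU.primeIdealOf ⟨z, hzU⟩).asIdeal.primeCompl (X.presheaf.stalk z)

open IntermediateField in
theorem finiteDimensional_functionField [LocallyOfFiniteType π] (hX : AtMostOneDim X) :
    letI := stalkAlg π (genericPoint X)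
    ∀ f : X.functionField, Transcendental ℂ f → FiniteDimensional ℂ⟮f⟯ X.functionField := by
  let _ := stalkAlg π (genericPoint X)
  intro f hf
  obtain ⟨U, hU, hzU, -⟩ := exists_isAffineOpen_mem_and_subset (x := genericPoint X) (U := ⊤) trivial
  let _ : Algebra ℂ Γ(X, U) := (const π U).toAlgebra
  have : Algebra.FiniteType ℂ Γ(X, U) := finiteType_const π hU
  have : Nonempty U := ⟨_, hzU⟩
  have : IsScalarTower ℂ Γ(X, U) X.functionField := IsScalarTower.of_algebraMap_eq fun c =>
    algebraMap_stalkAlg π _ U _ c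
  have := functionField_isFractionRing_of_isAffineOpen X U hU
  have := dimensionLEOne_of_isAffineOpen hX hU
  exact finiteDimensional_of_transcendental Γ(X, U) hf

theorem dimensionLEOne_stalk (hX : AtMostOneDim X) (z : X) :
    Ring.DimensionLEOne (X.presheaf.stalk z) := by
  obtain ⟨U, hU, hzU, -⟩ := exists_isAffineOpen_mem_and_subset (x := z) (U := ⊤) trivial
  have : Nonempty U := ⟨z, hzU⟩
  have h1 := hU.isLocalization_stalk ⟨z, hzU⟩
  let _ : Algebra Γ(X, U) (X.presheaf.stalk z) := TopCat.Presheaf.algebra_section_stalk X.presheaf ⟨z, hzU⟩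
  have := dimensionLEOne_of_isAffineOpen hX hU
  exact Ring.DimensionLEOne.localization (X.presheaf.stalk z)
    (Ideal.primeCompl_le_nonZeroDivisors (hU.primeIdealOf ⟨z, hzU⟩).asIdeal)

/-- `Scheme.ord` is 0 at points of coheight other than 1, so the generic point contributes nothing
to a sum of orders. -/
theorem coheight_genericPoint : Order.coheight (genericPoint X) ≠ 1 := by
  rw [Order.coheight_eq_zero.2]
  · exact zero_ne_one
  · intro y _
    exact (genericPoint_spec X).specializes (Set.mem_univ y)

theorem coheight_eq_one (hX : AtMostOneDim X) {z : X} (hz : z ≠ genericPoint X) :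
    Order.coheight z = 1 := by
  have := dimensionLEOne_stalk hX z
  have h1 : ringKrullDim (X.presheaf.stalk z) ≤ 1 :=
    (Ring.krullDimLE_iff (n := 1)).1 inferInstance
  rw [ringKrullDim_stalk_eq_coheight] at h1
  have h2 : Order.coheight z ≤ 1 := by exact_mod_cast h1
  refine le_antisymm h2 (Order.one_le_iff_ne_zero.2 fun h => hz ?_)
  have h3 := Order.coheight_eq_zero.1 h
  have h4 : genericPoint X ⤳ z := (genericPoint_spec X).specializes (Set.mem_univ z)
  exact (show z ⤳ genericPoint X from h3 h4).antisymm h4 |>.eq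

open Classical in
theorem ord_eq_finsum_vo [IsLocallyNoetherian X] [LocallyOfFiniteType π] (hX : AtMostOneDim X)
    {z : X} (hz : z ≠ genericPoint X) {f : X.functionField} (hf : f ≠ 0) :
    letI := stalkAlg π (genericPoint X)
    Scheme.ord f z = ∑ᶠ V ∈ {V ∈ places ℂ X.functionField |
      ∀ a : X.presheaf.stalk z, algebraMap _ X.functionField a ∈ V}, vo V f := by
  let _ := stalkAlg π (genericPoint X)
  let _ := stalkAlg π z
  have := isScalarTower_stalk π z
  have := dimensionLEOne_stalk hX z
  obtain ⟨g, h, hh, rfl⟩ := IsFractionRing.div_surjective (A := X.presheaf.stalk z) f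
  have hh0 := nonZeroDivisors.ne_zero hh
  have hg0 : g ≠ 0 := fun h => hf (by rw [h, map_zero, zero_div])
  rw [sum_vo_of_isLocalRing (finite_integralClosure_stalk π hX z)
    (residue_stalk π (isClosed_of_ne_generic hX hz)) hg0 hh0]
  have hc := coheight_eq_one hX hz
  rw [Scheme.ord_eq_iff hc hf]
  have : Ring.KrullDimLE 1 (X.presheaf.stalk z) := krullDimLE_of_coheight_le hc.le
  have key : ∀ x : X.presheaf.stalk z, x ≠ 0 → Ring.ordMonoidWithZeroHom (X.presheaf.stalk z) x =
      WithZero.coe (Multiplicative.ofAdd ((Ring.ord (X.presheaf.stalk z) x).toNat : ℤ)) := by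
    intro x hx
    have hx' := mem_nonZeroDivisors_of_ne_zero hx
    exact Ring.ordMonoidWithZeroHom_eq_coe _ hx' (ENat.natCast_toNat (Ring.ord_ne_top hx')).symm
  rw [Scheme.ordHom, map_div₀, Ring.ordFrac_eq_ord _ hg0, Ring.ordFrac_eq_ord _ hh0, key _ hg0,
    key _ hh0]
  rfl

end ProperCurve

/-! ### Centers of places -/

section Center

variable {X : Scheme.{0}}

theorem fromSpecStalk_eq {U : X.Opens} (hU : IsAffineOpen U) {z : X} (hz : z ∈ U) :
    X.fromSpecStalk z = Spec.map (CommRingCat.ofHom (gm hz)) ≫ hU.fromSpec :=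
  (hU.fromSpecStalk_eq_fromSpecStalk hz).symm

theorem fromSpecStalk_comp (π : X ⟶ Spec (.of ℂ)) (z : X) :
    letI := stalkAlg π z
    X.fromSpecStalk z ≫ π = Spec.map (CommRingCat.ofHom (algebraMap ℂ (X.presheaf.stalk z))) := by
  let _ := stalkAlg π z
  obtain ⟨U, hU, hzU, -⟩ := exists_isAffineOpen_mem_and_subset (x := z) (U := ⊤) trivial
  rw [fromSpecStalk_eq hU hzU, Category.assoc, fromSpec_const, ← Spec.map_comp]
  congr 1
  ext c
  exact (algebraMap_stalkAlg π z U hzU c).symm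

theorem ev_fromSpecStalk (z : X) {W : X.Opens} (hz : z ∈ W)
    (h : ∀ p, X.fromSpecStalk z p ∈ W) (t : Γ(X, W)) :
    ev (A := X.presheaf.stalk z) (X.fromSpecStalk z) W h t = gm hz t := by
  obtain ⟨U, hU, hzU, hUW⟩ := exists_isAffineOpen_mem_and_subset (x := z) (U := W) hz
  have h' : ∀ p, hU.fromSpec p ∈ U := fun p => hU.range_fromSpec.subset ⟨_, rfl⟩
  have h'' : ∀ p, (Spec.map (CommRingCat.ofHom (gm hzU)) ≫ hU.fromSpec) p ∈ U := fun p => h' _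
  have h3 : ∀ p, X.fromSpecStalk z p ∈ U := fun p => by
    rw [fromSpecStalk_eq hU hzU]
    exact h'' p
  refine (ev_res (A := X.presheaf.stalk z) (X.fromSpecStalk z) hUW h3 t).symm.trans
    ((ev_congr (A := X.presheaf.stalk z) (fromSpecStalk_eq hU hzU) U h3 h'' _).trans
    ((ev_comp (A := Γ(X, U)) (B := X.presheaf.stalk z) hU.fromSpec (gm hzU) U h' h'' _).trans ?_))
  rw [ev_fromSpec hU]
  exact gm_res hUW hzU t

variable [IsIntegral X] (π : X ⟶ Spec (.of ℂ))

theorem algebraMap_gm {z : X} {W : X.Opens} (hz : z ∈ W) (hξ : genericPoint X ∈ W) (t : Γ(X, W)) :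
    algebraMap (X.presheaf.stalk z) X.functionField (gm hz t) = gm hξ t :=
  TopCat.Presheaf.germ_stalkSpecializes_apply X.presheaf hz _ _

theorem genericPoint_mem {z : X} {W : X.Opens} (hz : z ∈ W) : genericPoint X ∈ W :=
  ((genericPoint_spec X).specializes (Set.mem_univ z)).mem_open W.isOpen hz

/-- The valuative criterion extends Spec K → X to Spec V, and the center is the image of the closed
point. If it were generic, V would be all of K. -/
theorem exists_center [IsProper π] :
    letI := stalkAlg π (genericPoint X)
    ∀ V ∈ places ℂ X.functionField,
      ∃ z, z ≠ genericPoint X ∧ ∀ a : X.presheaf.stalk z, algebraMap _ X.functionField a ∈ V := by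
  let _ := stalkAlg π (genericPoint X)
  intro V hV
  let R : ValuationSubring X.functionField := { V.toSubring with mem_or_inv_mem' := hV.2 }
  let j : ℂ →+* R := algebraMap ℂ V
  obtain ⟨l, hl, -⟩ := exists_lift π (R := R) (K := X.functionField)
    (X.fromSpecStalk (genericPoint X)) (Spec.map (CommRingCat.ofHom j)) (by
      rw [fromSpecStalk_comp, ← Spec.map_comp]
      rfl)
  set z := l (IsLocalRing.closedPoint R) with hz
  have hmem : ∀ a : X.presheaf.stalk z, algebraMap _ X.functionField a ∈ V := by
    intro a
    obtain ⟨W, hzW, t, rfl⟩ := exists_gm_eq a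
    have hlW : ∀ p, l p ∈ W := fun p =>
      ((IsLocalRing.specializes_closedPoint p).map l.continuous).mem_open W.isOpen hzW
    have hlW' : ∀ p, (Spec.map (CommRingCat.ofHom (algebraMap R X.functionField)) ≫ l) p ∈ W :=
      fun p => hlW _
    have hlW'' : ∀ p, (X.fromSpecStalk (genericPoint X)) p ∈ W := fun p => by
      have := hlW' p
      rwa [hl] at this
    have h := ev_comp (A := R) (B := X.functionField) l (algebraMap R X.functionField) W hlW hlW' t
    have h' : gm (genericPoint_mem hzW) t = algebraMap R X.functionField (ev l W hlW t) :=
      (ev_fromSpecStalk _ (genericPoint_mem hzW) hlW'' t).symm.trans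
        ((ev_congr (A := X.functionField) hl W hlW' hlW'' t).symm.trans h)
    rw [algebraMap_gm hzW (genericPoint_mem hzW), h']
    exact (ev l W hlW t).2
  refine ⟨z, fun h => hV.1 (eq_top_iff.2 fun x _ => ?_), hmem⟩
  rw [h] at hmem
  obtain ⟨W, hW, t, rfl⟩ := exists_gm_eq (z := genericPoint X) x
  have h' := hmem (gm hW t)
  rwa [algebraMap_gm hW hW] at h'

/-- The two maps Spec V → X through the local rings agree on Spec K, hence agree by separatedness.
-/
theorem center_unique [IsSeparated π] (hX : AtMostOneDim X) :
    letI := stalkAlg π (genericPoint X)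
    ∀ V ∈ places ℂ X.functionField, ∀ z z', 
      (∀ a : X.presheaf.stalk z, algebraMap _ X.functionField a ∈ V) → 
      (∀ a : X.presheaf.stalk z', algebraMap _ X.functionField a ∈ V) → z = z' := by
  let _ := stalkAlg π (genericPoint X)
  intro V hV
  let R : ValuationSubring X.functionField := { V.toSubring with mem_or_inv_mem' := hV.2 }
  let j : ℂ →+* R := algebraMap ℂ V
  let ι : Spec (.of X.functionField) ⟶ Spec (.of R) := Spec.map (CommRingCat.ofHom (algebraMap R X.functionField))
  have hι : IsDominant ι :=
    ⟨(PrimeSpectrum.denseRange_comap_iff_ker_le_nilRadical _).2 (le_of_eq_of_le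
      ((RingHom.injective_iff_ker_eq_bot _).1 (IsFractionRing.injective R X.functionField)) bot_le)⟩
  have key : ∀ z, (∀ a : X.presheaf.stalk z, algebraMap _ X.functionField a ∈ V) →
      ∃ g : Spec (.of R) ⟶ X, g ≫ π = Spec.map (CommRingCat.ofHom j) ∧
        ι ≫ g = X.fromSpecStalk (genericPoint X) ∧ g (IsLocalRing.closedPoint R) = z := by
    intro z hz
    let _ := stalkAlg π z
    have := isScalarTower_stalk π z
    have := dimensionLEOne_stalk hX z
    let f : X.presheaf.stalk z →+* R := (algebraMap (X.presheaf.stalk z) X.functionField).codRestrict R hz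
    refine ⟨Spec.map (CommRingCat.ofHom f) ≫ X.fromSpecStalk z, ?_, ?_, ?_⟩
    · rw [Category.assoc, fromSpecStalk_comp, ← Spec.map_comp]
      refine congrArg Spec.map (CommRingCat.hom_ext (RingHom.ext fun c => Subtype.ext ?_))
      exact (IsScalarTower.algebraMap_apply ℂ (X.presheaf.stalk z) X.functionField c).symm
    · rw [← Category.assoc, ← Spec.map_comp, ← Scheme.SpecMap_stalkSpecializes_fromSpecStalk
        ((genericPoint_spec X).specializes (Set.mem_univ z))]
      rfl
    -- The contracted prime is maximal unless it is zero; in the latter case V would contain all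
    -- fractions of the local ring, that is, K.
    · have h1 : (IsLocalRing.maximalIdeal R).comap f = IsLocalRing.maximalIdeal _ := by
        by_cases h0 : (IsLocalRing.maximalIdeal R).comap f = ⊥
        · refine absurd (eq_top_iff.2 fun x _ => ?_) hV.1
          obtain ⟨a, b, hb, rfl⟩ := IsFractionRing.div_surjective (A := X.presheaf.stalk z) x
          have hb' : IsUnit (f b) := by
            by_contra hn
            have : b ∈ (IsLocalRing.maximalIdeal R).comap f := hn
            rw [h0] at this
            exact nonZeroDivisors.ne_zero hb this
          obtain ⟨u, hu⟩ := hb'.exists_right_inv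
          have hu' : algebraMap (X.presheaf.stalk z) X.functionField b * u = 1 := congrArg Subtype.val hu
          rw [div_eq_mul_inv, inv_eq_of_mul_eq_one_right hu']
          exact V.mul_mem (hz a) u.2
        · exact IsLocalRing.eq_maximalIdeal (Ring.DimensionLEOne.maximalOfPrime h0 inferInstance)
      have h2 : Spec.map (CommRingCat.ofHom f) (IsLocalRing.closedPoint R) = IsLocalRing.closedPoint (X.presheaf.stalk z) :=
        PrimeSpectrum.ext h1
      exact (congrArg (X.fromSpecStalk z) h2).trans Scheme.fromSpecStalk_closedPoint
  intro z z' hz hz'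
  obtain ⟨g, h1, h2, h3⟩ := key z hz
  obtain ⟨g', h1', h2', h3'⟩ := key z' hz'
  have : g = g' := ext_of_isDominant_of_isSeparated π (h1.trans h1'.symm) ι (h2.trans h2'.symm)
  rw [← h3, ← h3', this]

/-- A rational function has as many zeros as poles. -/
theorem finsum_ord_eq_zero [IsLocallyNoetherian X] [IsProper π] (hX : AtMostOneDim X)
    {f : X.functionField} (hf : f ≠ 0) :
    (Function.support fun z => Scheme.ord f z).Finite ∧ ∑ᶠ z : X, Scheme.ord f z = 0 := by
  classical
  let _ := stalkAlg π (genericPoint X)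
  obtain ⟨h1, h2⟩ := finsum_vo (finiteDimensional_functionField π hX) hf
  have hc : ∀ V, ∃ z, V ∈ places ℂ X.functionField → 
      z ≠ genericPoint X ∧ ∀ a : X.presheaf.stalk z, algebraMap _ X.functionField a ∈ V := by
    intro V
    by_cases hV : V ∈ places ℂ X.functionField
    · obtain ⟨z, hz⟩ := exists_center π V hV
      exact ⟨z, fun _ => hz⟩
    · exact ⟨genericPoint X, fun h => absurd h hV⟩
  choose c hc using hc
  have h1' : (places ℂ X.functionField ∩ Function.support fun V => vo V f).Finite := h1
  set T := h1'.toFinset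
  -- Grouping the places by their centers turns the product formula into a sum over points.
  have h3 : ∀ z, Scheme.ord f z = ∑ V ∈ T with c V = z, vo V f := by
    intro z
    by_cases hz : z = genericPoint X
    · rw [hz, Scheme.ord_eq_zero_of_coheight_neq_one coheight_genericPoint, Finset.filter_false_of_mem, Finset.sum_empty]
      intro V hV
      exact (hc V (h1'.mem_toFinset.1 hV).1).1
    · rw [ord_eq_finsum_vo π hX hz hf]
      refine finsum_mem_eq_sum_of_inter_support_eq _ ?_
      ext V
      simp only [Set.mem_inter_iff, Finset.coe_filter, Set.mem_ofPred_eq, Function.mem_support, T, Set.Finite.mem_toFinset]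
      constructor
      · rintro ⟨⟨hV, hz⟩, h⟩
        exact ⟨⟨⟨hV, h⟩, center_unique π hX V hV _ _ (hc V hV).2 hz⟩, h⟩
      · rintro ⟨⟨⟨hV, h⟩, rfl⟩, -⟩
        exact ⟨⟨hV, (hc V hV).2⟩, h⟩
  have h4 : (Function.support fun z => Scheme.ord f z) ⊆ (T.image c : Finset X) := by
    intro z hz
    rw [Function.mem_support, h3] at hz
    obtain ⟨V, hV, -⟩ := Finset.exists_ne_zero_of_sum_ne_zero hz
    rw [Finset.mem_filter] at hV
    exact Finset.mem_coe.2 (Finset.mem_image.2 ⟨V, hV⟩)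
  refine ⟨(T.image c).finite_toSet.subset h4, ?_⟩
  rw [finsum_eq_sum_of_support_subset _ h4, Finset.sum_congr rfl fun z _ => h3 z,
    Finset.sum_fiberwise_of_maps_to fun V hV => Finset.mem_image_of_mem c hV, ← h2,
    finsum_mem_eq_sum _ h1']

end Center

/-! ### Degrees of line bundles -/

namespace LineBundle

variable {X : Scheme.{0}} [IsIntegral X]

theorem Sec.fn_ne_zero {L : LineBundle X} (s : L.Sec) (hs : s.fn (genericPoint X) ≠ 0) (z : X) :
    s.fn z ≠ 0 := by
  intro h0
  have h := genericPoint_mem (L.mem z)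
  have h1 := algebraMap_gm (L.mem z) h (s.val z)
  rw [s.gm_val h] at h1
  rw [Sec.fn] at h0
  rw [h0, map_zero] at h1
  exact hs ((Units.mul_right_eq_zero _).1 h1.symm)

variable [IsLocallyNoetherian X]

theorem ord_algebraMap {z : X} (hz : Order.coheight z = 1) {a : X.presheaf.stalk z} (ha : a ≠ 0) :
    Scheme.ord (algebraMap (X.presheaf.stalk z) X.functionField a) z =
      (Ring.ord (X.presheaf.stalk z) a).toNat := by
  have hf : algebraMap (X.presheaf.stalk z) X.functionField a ≠ 0 := fun h =>
    ha (IsFractionRing.injective _ X.functionField (h.trans (map_zero _).symm))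
  rw [Scheme.ord_eq_iff hz hf]
  have : Ring.KrullDimLE 1 (X.presheaf.stalk z) := krullDimLE_of_coheight_le hz.le
  have ha' := mem_nonZeroDivisors_of_ne_zero ha
  rw [Scheme.ordHom, Ring.ordFrac_eq_ord _ ha,
    Ring.ordMonoidWithZeroHom_eq_coe _ ha' (ENat.natCast_toNat (Ring.ord_ne_top ha')).symm]

theorem ord_algebraMap_nonneg {z : X} {a : X.presheaf.stalk z} (ha : a ≠ 0) :
    0 ≤ Scheme.ord (algebraMap (X.presheaf.stalk z) X.functionField a) z := by
  by_cases hz : Order.coheight z = 1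
  · rw [ord_algebraMap hz ha]
    exact Int.natCast_nonneg _
  · rw [Scheme.ord_eq_zero_of_coheight_neq_one hz]

theorem ord_algebraMap_of_isUnit {z : X} {a : X.presheaf.stalk z} (ha : IsUnit a) :
    Scheme.ord (algebraMap (X.presheaf.stalk z) X.functionField a) z = 0 := by
  by_cases hz : Order.coheight z = 1
  · rw [ord_algebraMap hz ha.ne_zero, Ring.ord_of_isUnit ha]
    rfl
  · rw [Scheme.ord_eq_zero_of_coheight_neq_one hz]

theorem isUnit_of_ord_eq_zero {z : X} (hz : Order.coheight z = 1) {a : X.presheaf.stalk z}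
    (ha : a ≠ 0) (h : Scheme.ord (algebraMap (X.presheaf.stalk z) X.functionField a) z = 0) :
    IsUnit a := by
  have : Ring.KrullDimLE 1 (X.presheaf.stalk z) := krullDimLE_of_coheight_le hz.le
  rw [ord_algebraMap hz ha, Nat.cast_eq_zero, ENat.toNat_eq_zero, Ring.ord,
    Module.length_eq_zero_iff, Ideal.Quotient.subsingleton_iff, Ideal.span_singleton_eq_top] at h
  exact h.resolve_right (Ring.ord_ne_top (mem_nonZeroDivisors_of_ne_zero ha))

/-- The order at `z` of the rational section which is `1` at the generic point. -/
def div (L : LineBundle X) (z : X) : ℤ :=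
  Scheme.ord (X := X) (L.c z (genericPoint X) : X.presheaf.stalk (genericPoint X)) z

theorem degree_eq (L : LineBundle X) : L.degree = ∑ᶠ z, L.div z :=
  finsum_congr fun z => by
    rw [div, c_val L (genericPoint_mem (L.mem z))]
    rfl

theorem div_eq_zero (L : LineBundle X) {z : X} (hz : z ∈ L.U (genericPoint X)) : L.div z = 0 := by
  have h : z ∈ L.U z ⊓ L.U (genericPoint X) := ⟨L.mem z, hz⟩
  rw [div, c_val L (genericPoint_mem (L.mem z)), ← algebraMap_gm h]
  exact ord_algebraMap_of_isUnit ((Units.isUnit _).map _)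

theorem finite_support_div (hX : AtMostOneDim X) [CompactSpace X] (L : LineBundle X) :
    (Function.support L.div).Finite := by
  have : IsNoetherian X := {}
  refine ((finite_of_isClosed hX (L.U (genericPoint X)).isOpen.isClosed_compl fun z _ =>
    ⟨genericPoint X, (genericPoint_spec X).specializes (Set.mem_univ z), fun h => h (L.mem _)⟩).1).subset
    fun z hz h => hz (L.div_eq_zero h)

theorem Sec.div_add {L : LineBundle X} (s : L.Sec) (hs : s.fn (genericPoint X) ≠ 0) (z : X) :
    L.div z + Scheme.ord (X := X) (s.fn (genericPoint X)) z =
      Scheme.ord (algebraMap (X.presheaf.stalk z) X.functionField (s.fn z)) z := by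
  have h := genericPoint_mem (L.mem z)
  have h1 := algebraMap_gm (L.mem z) h (s.val z)
  rw [s.gm_val h] at h1
  rw [show s.fn z = gm (L.mem z) (s.val z) from rfl, h1]
  exact (Scheme.ord_mul (X := X) (Units.ne_zero (M₀ := X.functionField) _) hs).symm

/-- The rational section defining the degree differs from s by a rational function, whose orders sum
to zero. -/
theorem Sec.degree_eq (π : X ⟶ Spec (.of ℂ)) [IsProper π]
    (hX : AtMostOneDim X) {L : LineBundle X} (s : L.Sec) (hs : s.fn (genericPoint X) ≠ 0) :
    (Function.support fun z =>
      Scheme.ord (algebraMap (X.presheaf.stalk z) X.functionField (s.fn z)) z).Finite ∧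
    L.degree =
      ∑ᶠ z, Scheme.ord (algebraMap (X.presheaf.stalk z) X.functionField (s.fn z)) z := by
  have := isNoetherian_of_proper π
  have h1 := L.finite_support_div hX
  obtain ⟨h2, h3⟩ := finsum_ord_eq_zero π hX (f := s.fn (genericPoint X)) hs
  simp only [← s.div_add hs]
  refine ⟨(h1.union h2).subset (Function.support_add _ _), ?_⟩
  rw [finsum_add_distrib h1 h2, h3, add_zero, LineBundle.degree_eq]

theorem Sec.degree_nonneg (π : X ⟶ Spec (.of ℂ)) [IsProper π]
    (hX : AtMostOneDim X) {L : LineBundle X} (s : L.Sec) (hs : s.fn (genericPoint X) ≠ 0) :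
    0 ≤ L.degree := by
  rw [(s.degree_eq π hX hs).2]
  exact finsum_nonneg fun z => ord_algebraMap_nonneg (s.fn_ne_zero hs z)

theorem Sec.isUnit_of_degree_eq_zero (π : X ⟶ Spec (.of ℂ)) [IsProper π]
    (hX : AtMostOneDim X) {L : LineBundle X} (s : L.Sec)
    (hs : s.fn (genericPoint X) ≠ 0) (h : L.degree = 0) (z : X) : IsUnit (s.fn z) := by
  by_cases hz : z = genericPoint X
  · rw [hz]
    exact isUnit_iff_ne_zero (G₀ := X.functionField).2 hs
  · obtain ⟨h1, h2⟩ := s.degree_eq π hX hs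
    refine isUnit_of_ord_eq_zero (coheight_eq_one hX hz) (s.fn_ne_zero hs z) ?_
    rw [h, eq_comm, finsum_eq_sum _ h1, Finset.sum_eq_zero_iff_of_nonneg fun z _ =>
      ord_algebraMap_nonneg (s.fn_ne_zero hs z)] at h2
    by_contra hn
    exact hn (h2 z (h1.mem_toFinset.2 hn))

theorem degree_eq_zero (π : X ⟶ Spec (.of ℂ)) [IsProper π]
    (hX : AtMostOneDim X) {L : LineBundle X} {σ : Germs X} (hσ : L.IsSec σ)
    (h : ∀ z, IsUnit (σ z)) : L.degree = 0 := by
  obtain ⟨s, rfl⟩ := hσ.exists_sec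
  rw [(s.degree_eq π hX (h _).ne_zero).2]
  exact finsum_eq_zero_of_forall_eq_zero fun z => ord_algebraMap_of_isUnit (h z)

theorem degree_prod (π : X ⟶ Spec (.of ℂ)) [IsProper π]
    (hX : AtMostOneDim X) {ι : Type} [Fintype ι] (L : ι → LineBundle X) (a : ι → ℤ) :
    (prod L a).degree = ∑ ρ, a ρ * (L ρ).degree := by
  have := isNoetherian_of_proper π
  have h : ∀ z, (prod L a).div z = ∑ ρ, a ρ * (L ρ).div z := fun z => by
    rw [div, c_prod L a (genericPoint_mem (commonU_mem L z))]
    -- The order at z is a homomorphism on the nonzero rational functions, so it turns the product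
    -- of transition functions into a sum.
    let φ : (X.presheaf.stalk (genericPoint X))ˣ →* Multiplicative ℤ :=
      { toFun u := .ofAdd (Scheme.ord (X := X) (u : X.presheaf.stalk (genericPoint X)) z)
        map_one' := congrArg Multiplicative.ofAdd ((congrArg (fun f => Scheme.ord (X := X) f z)
          (map_one (algebraMap (X.presheaf.stalk z) X.functionField)).symm).trans
            (ord_algebraMap_of_isUnit isUnit_one))
        map_mul' u v := congrArg Multiplicative.ofAdd (Scheme.ord_mul (X := X)
          (Units.ne_zero (M₀ := X.functionField) u) (Units.ne_zero (M₀ := X.functionField) v)) }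
    have h1 : φ (∏ ρ, (L ρ).c z (genericPoint X) ^ a ρ) = _ := map_prod φ _ _
    refine (congrArg Multiplicative.toAdd h1).trans ?_
    rw [toAdd_prod]
    refine Finset.sum_congr rfl fun ρ _ => ?_
    rw [map_zpow, toAdd_zpow]
    rfl
  rw [degree_eq, finsum_congr h, finsum_sum_comm]
  · refine Finset.sum_congr rfl fun ρ _ => ?_
    rw [degree_eq, mul_finsum]
  · intro ρ _
    exact ((L ρ).finite_support_div hX).subset fun z hz h => hz (by simp [h])

theorem Sec.exists_triv {X : Scheme.{0}} {L : LineBundle X} (s : L.Sec)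
    (h : ∀ z, IsUnit (s.fn z)) :
    ∃ T : L.Triv, ∀ x, (T.val x : Γ(X, L.U x)) * s.val x = 1 := by
  have hu : ∀ x, IsUnit (s.val x) := fun x => isUnit_of_gm fun z hz => by
    rw [s.gm_val hz]
    exact (Units.isUnit _).mul (h z)
  choose u hu using hu
  have h1 : ∀ x, (((u x)⁻¹ : (Γ(X, L.U x))ˣ) : Γ(X, L.U x)) * s.val x = 1 := fun x => by
    rw [← hu, Units.inv_mul]
  refine ⟨⟨fun x => (u x)⁻¹, fun x y => ?_⟩, h1⟩
  have h2 := congrArg (res X (inf_le_left : L.U x ⊓ L.U y ≤ _)) (h1 x)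
  have h3 := congrArg (res X (inf_le_right : L.U x ⊓ L.U y ≤ _)) (h1 y)
  rw [map_mul, map_one] at h2 h3
  rw [s.compat x y] at h2
  linear_combination (res X inf_le_right (((u y)⁻¹ : (Γ(X, L.U y))ˣ) : Γ(X, L.U y))) * h2 -
    (res X inf_le_left (((u x)⁻¹ : (Γ(X, L.U x))ˣ) : Γ(X, L.U x))) * (L.g x y : Γ(X, L.U x ⊓ L.U y)) * h3

theorem Sec.val_eq_zero {X : Scheme.{0}} [IsIntegral X] {L : LineBundle X} (s : L.Sec)
    (h : s.fn (genericPoint X) = 0) (x : X) : s.val x = 0 := by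
  refine section_ext_gm fun z hz => IsFractionRing.injective _ X.functionField ?_
  rw [map_zero, map_zero, algebraMap_gm hz (genericPoint_mem hz), s.gm_val, h, mul_zero]

theorem reg_zpow {X : Scheme.{0}} {U : X.Opens} {w : ∀ z : X, (X.presheaf.stalk z)ˣ}
    (h : (fun z => (w z : X.presheaf.stalk z)) ∈ reg U) (k : ℤ) :
    (fun z => ((w z ^ k : (X.presheaf.stalk z)ˣ) : X.presheaf.stalk z)) ∈ reg U := by
  have h1 : ∀ k : ℕ, (fun z => ((w z ^ k : (X.presheaf.stalk z)ˣ) : X.presheaf.stalk z)) ∈ reg U :=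
    fun k => reg_congr (fun z _ => by simp) (pow_mem h k)
  obtain ⟨k, rfl | rfl⟩ := k.eq_nat_or_neg
  · simpa using h1 k
  · refine reg_inv (h1 k) fun z _ => ?_
    rw [zpow_neg, zpow_natCast, Units.mul_inv]

section Prod

variable {X : Scheme.{0}} {ι : Type} [Fintype ι] {L : ι → LineBundle X}

theorem IsSec.prod_zpow {b : ι → ℤ} {w : ι → ∀ z : X, (X.presheaf.stalk z)ˣ}
    (h : ∀ κ, b κ ≠ 0 → (L κ).IsSec fun z => (w κ z : X.presheaf.stalk z)) :
    (prod L b).IsSec fun z => ((∏ κ, w κ z ^ b κ : (X.presheaf.stalk z)ˣ) : X.presheaf.stalk z) := by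
  refine fun y => ⟨commonU L y, commonU_mem L y, le_rfl, ?_⟩
  have h1 : ∀ κ ∈ Finset.univ, (fun z => (((((L κ).c y z) * w κ z) ^ b κ : (X.presheaf.stalk z)ˣ) :
      X.presheaf.stalk z)) ∈ ToricQM.reg (commonU L y) := fun κ _ => by
    by_cases hκ : b κ = 0
    · exact reg_congr (fun z _ => by simp [hκ]) (one_mem _)
    · exact reg_mono (commonU_le L y κ) (reg_zpow (w := fun z => (L κ).c y z * w κ z) ((h κ hκ).reg y) _)
  refine reg_congr (fun z hz => ?_) (prod_mem h1)
  rw [c_prod L _ hz, Finset.prod_apply, ← Units.val_mul, ← Finset.prod_mul_distrib, Units.coe_prod]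
  exact Finset.prod_congr rfl fun κ _ => by rw [mul_zpow]

/-- If `⊗_κ L_κ^{a_κ}` is trivial and so are the factors other than `L_ρ`, which occurs once, then
`L_ρ` is trivial. -/
theorem exists_isSec_of_prod [DecidableEq ι] {a : ι → ℤ} {ρ : ι} (ha : a ρ = 1) {τ : Germs X}
    (hτ : (prod L a).IsSec τ) (hτu : ∀ z, IsUnit (τ z))
    (h : ∀ κ ≠ ρ, a κ ≠ 0 → ∃ σ : Germs X, (L κ).IsSec σ ∧ ∀ z, IsUnit (σ z)) :
    ∃ σ : Germs X, (L ρ).IsSec σ ∧ ∀ z, IsUnit (σ z) := by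
  -- The exponent δ_ρ - a is 0 at ρ, so passing from the product to L_ρ uses only frames of the
  -- other factors.
  have h' : ∀ κ, ∃ w : ∀ z : X, (X.presheaf.stalk z)ˣ, (Pi.single ρ 1 - a : ι → ℤ) κ ≠ 0 →
      (L κ).IsSec fun z => (w z : X.presheaf.stalk z) := fun κ => by
    by_cases hκ : (Pi.single ρ 1 - a : ι → ℤ) κ = 0
    · exact ⟨1, fun h => absurd hκ h⟩
    · have h1 : κ ≠ ρ := fun e => hκ (by rw [e, Pi.sub_apply, Pi.single_eq_same, ha, sub_self])
      obtain ⟨σ, hσ, hu⟩ := h κ h1 fun h2 => hκ (by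
        rw [Pi.sub_apply, Pi.single_eq_of_ne h1, h2, sub_self])
      choose w hw using hu
      obtain rfl : (fun z => (w z : X.presheaf.stalk z)) = σ := funext hw
      exact ⟨w, fun _ => hσ⟩
  choose w hw using h'
  refine ⟨_, (hτ.prod_add (IsSec.prod_zpow hw) (d := Pi.single ρ 1) (by abel)).congr fun y =>
    ⟨commonU L y, commonU_mem L y, commonU_le L y ρ, fun z hz => ?_⟩, fun z =>
      (hτu z).mul (Units.isUnit _)⟩
  rw [c_prod L _ hz, Finset.prod_eq_single ρ]
  · rw [Pi.single_eq_same, zpow_one]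
  · intro κ _ hκ
    rw [Pi.single_eq_of_ne hκ, zpow_zero]
  · exact fun h => absurd (Finset.mem_univ ρ) h

end Prod

/-! ### Pullbacks -/

section Pullback

variable {X Y : Scheme.{0}} (f : Y ⟶ X)

/-- The pullback of germs. -/
def sm (y : Y) : X.presheaf.stalk (f y) →+* Y.presheaf.stalk y := (f.stalkMap y).hom

theorem gm_pull {A : X.Opens} {V : Y.Opens} (h : V ≤ f ⁻¹ᵁ A) {y : Y} (hy : y ∈ V) (t : Γ(X, A)) :
    gm hy (pull f A V h t) = sm f y (gm (show f y ∈ A from h hy) t) := by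
  have h1 : pull f A V h t = res Y h (pull f A _ le_rfl t) := (res_pull f A h le_rfl t).symm
  rw [h1, gm_res h hy]
  refine Eq.trans ?_ (f.germ_stalkMap_apply A y (h hy) t).symm
  rw [Scheme.Hom.app_eq_appLE]
  rfl

theorem c_pullback (L : LineBundle X) {y z : Y} (h : f z ∈ L.U (f y)) :
    (L.pullback f).c y z = Units.map (sm f z).toMonoidHom (L.c (f y) (f z)) := by
  ext
  rw [c_val (L.pullback f) h]
  change _ = sm f z (L.c (f y) (f z) : X.presheaf.stalk (f z))
  rw [c_val L h]
  exact gm_pull f _ _ _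

theorem Sec.fn_pullback {L : LineBundle X} (s : L.Sec) (y : Y) :
    (s.pullback f).fn y = sm f y (s.fn (f y)) := gm_pull f _ _ _

theorem isSec_prod_pullback {ι : Type} [Fintype ι] {L : ι → LineBundle X} {a : ι → ℤ}
    {σ : Germs X} (hσ : (prod L a).IsSec σ) :
    (prod (fun ρ => (L ρ).pullback f) a).IsSec fun y => sm f y (σ (f y)) := by
  obtain ⟨s, rfl⟩ := hσ.exists_sec
  have h1 : (fun y => sm f y (s.fn (f y))) = (s.pullback f).fn := funext fun y =>
    (s.fn_pullback f y).symm
  rw [h1]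
  refine (s.pullback f).isSec.congr fun y => ⟨_, commonU_mem _ y, le_rfl, fun z hz => ?_⟩
  have hz' : f z ∈ commonU L (f y) := (mem_commonU L).2 fun ρ => (mem_commonU _).1 hz ρ
  rw [c_prod _ _ hz, c_pullback f (prod L a) hz', c_prod L a hz', map_prod]
  refine Finset.prod_congr rfl fun ρ _ => ?_
  rw [map_zpow, c_pullback f (L ρ) ((mem_commonU L).1 hz' ρ)]

end Pullback

end LineBundle

/-! ### The classes of the components of a toric quasimap -/

/-- The dual basis of the generators of a maximal cone. -/
theorem Fan.exists_pairing {n : ℕ} {ι : Type} [Fintype ι] [DecidableEq ι] (F : Fan n ι)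
    {σ : Finset ι} (hσ : σ ∈ F.maxCones) (ρ : ι) : ∃ m : Fin n → ℤ,
      ∀ κ, F.pairing κ m = F.coord hσ (F.gen κ) ρ := by
  by_cases hρ : ρ ∈ σ
  · refine ⟨fun j => (F.basis hσ).coord ⟨ρ, hρ⟩ (Pi.single j 1), fun κ => ?_⟩
    rw [Fan.coord, dif_pos hρ, Fan.pairing, dotProduct]
    conv_rhs => rw [← Module.Basis.coord_apply, pi_eq_sum_univ' (F.gen κ), map_sum]
    refine Finset.sum_congr rfl fun j _ => ?_
    rw [map_smul, smul_eq_mul]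
  · exact ⟨0, fun κ => by simp [Fan.pairing, F.coord_of_notMem hσ _ hρ]⟩

theorem AtMostOneDim.of_isClosedImmersion {X Y : Scheme.{0}} (i : X ⟶ Y) [IsClosedImmersion i]
    (hY : AtMostOneDim Y) : AtMostOneDim X := fun _ _ _ hab hbc =>
  (hY _ _ _ (hab.map i.continuous) (hbc.map i.continuous)).imp
    (fun h => i.isClosedEmbedding.injective h) fun h => i.isClosedEmbedding.injective h

theorem eq_of_specializes_genericPoint {X Y : Scheme.{0}} [IsIntegral X] (i : X ⟶ Y)
    (hi : Set.range i ∈ irreducibleComponents Y) {η : Y} (h : η ⤳ i (genericPoint X)) :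
    η = i (genericPoint X) := by
  have h1 : Set.range i ⊆ closure {η} := by
    rintro _ ⟨z, rfl⟩
    exact specializes_iff_mem_closure.1
      (h.trans (((genericPoint_spec X).specializes (Set.mem_univ z)).map i.continuous))
  obtain ⟨z, hz⟩ := (show Maximal IsIrreducible (Set.range i) from hi).2
    isIrreducible_singleton.closure h1 (subset_closure rfl)
  refine (h.antisymm ?_).eq
  rw [← hz]
  exact ((genericPoint_spec X).specializes (Set.mem_univ z)).map i.continuous

namespace ToricQuasimap

variable {n : ℕ} {ι : Type} [Fintype ι] [DecidableEq ι] {F : Fan n ι} {k : ℕ}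
  (Q : ToricQuasimap F k) {C' : Scheme.{0}} (i : C' ⟶ Q.C) [IsIntegral C']

/-- The generic point of a component has no proper generization, whereas a base point, being
nonsingular, has one. So nondegeneracy applies at the generic point. -/
theorem exists_maxCone (hi : Set.range i ∈ irreducibleComponents Q.C) : ∃ σ ∈ F.maxCones,
    ∀ ρ ∉ σ, ((Q.u ρ).pullback i).fn (genericPoint C') ≠ 0 := by
  obtain ⟨B, -, hB, -, hQ⟩ := Q.nondegenerate
  obtain ⟨σ, hσ, h⟩ := hQ (i (genericPoint C')) fun hη => by
    obtain ⟨η, h1, h2⟩ := exists_generization (hB _ hη).2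
    exact h2 (eq_of_specializes_genericPoint i hi h1)
  refine ⟨σ, hσ, fun ρ hρ => ?_⟩
  rw [LineBundle.Sec.fn_pullback]
  exact (((Q.u ρ).mem_nonvanishing.1 (h ρ hρ)).map _).ne_zero

variable [IsLocallyNoetherian C'] [IsClosedImmersion i]

/-- φ_m pulls back to a nowhere vanishing section of ⊗ L_ρ^⟨ρ, m⟩ on C', which therefore has degree
0. -/
theorem sum_pairing_degree (m : Fin n → ℤ) :
    ∑ ρ, F.pairing ρ m * ((Q.L ρ).pullback i).degree = 0 := by
  have := Q.proper
  have hX := Q.atMostOneDim.of_isClosedImmersion i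
  rw [← LineBundle.degree_prod (i ≫ Q.π) hX]
  exact LineBundle.degree_eq_zero (i ≫ Q.π) hX
    (LineBundle.isSec_prod_pullback i (Q.φ m).isSec_one) fun z => ((Q.φ m).isUnit_one _).map _

theorem existsUnique_hasClass : ∃! β : F.H2, Q.HasClass i β :=
  ⟨F.ofRel _ (F.rel_of_pairing _ (Q.sum_pairing_degree i)), fun ρ => F.ofRel_D _ _ ρ,
    fun _ hβ => F.H2_ext fun ρ => (hβ ρ).trans (F.ofRel_D (fun ρ => ((Q.L ρ).pullback i).degree) _ ρ).symm⟩

theorem HasClass.exists_nonneg {Q : ToricQuasimap F k} {i : C' ⟶ Q.C} [IsClosedImmersion i]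
    (hi : Set.range i ∈ irreducibleComponents Q.C) {β : F.H2} (hβ : Q.HasClass i β) :
    ∃ σ ∈ F.maxCones, ∀ ρ ∉ σ, 0 ≤ β (F.D ρ) := by
  have := Q.proper
  obtain ⟨σ, hσ, h⟩ := Q.exists_maxCone i hi
  refine ⟨σ, hσ, fun ρ hρ => ?_⟩
  rw [hβ]
  exact LineBundle.Sec.degree_nonneg (i ≫ Q.π) (Q.atMostOneDim.of_isClosedImmersion i) _ (h ρ hρ)

theorem isConstant_of_degree_eq_zero (hi : Set.range i ∈ irreducibleComponents Q.C)
    (h : ∀ ρ, ((Q.L ρ).pullback i).degree = 0) (ρ : ι) :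
    IsConstant (i ≫ Q.π) ((Q.u ρ).pullback i) := by
  have := Q.proper
  have hu : ∀ κ, ((Q.u κ).pullback i).fn (genericPoint C') ≠ 0 →
      ∀ z, IsUnit (((Q.u κ).pullback i).fn z) := fun κ hκ =>
    LineBundle.Sec.isUnit_of_degree_eq_zero (i ≫ Q.π) (Q.atMostOneDim.of_isClosedImmersion i)
      _ hκ (h κ)
  by_cases h0 : ((Q.u ρ).pullback i).fn (genericPoint C') = 0
  -- Degree 0 alone does not make L_ρ trivial when u_ρ = 0. For m dual to ρ in σ, φ_m expresses L_ρ
  -- through the L_κ with κ ∉ σ, which are trivialized by u_κ.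
  · obtain ⟨σ, hσ, hσu⟩ := Q.exists_maxCone i hi
    obtain ⟨m, hm⟩ := F.exists_pairing hσ ρ
    have hρ : ρ ∈ σ := by
      by_contra hρ
      exact hσu ρ hρ h0
    obtain ⟨τ, hτ, hτu⟩ := LineBundle.exists_isSec_of_prod (ρ := ρ)
      (by rw [hm, F.coord_gen hσ hρ, Pi.single_eq_same])
      (LineBundle.isSec_prod_pullback i (Q.φ m).isSec_one)
      (fun z => ((Q.φ m).isUnit_one _).map _) fun κ hκρ hκ => by
        refine ⟨_, ((Q.u κ).pullback i).isSec, hu κ (hσu κ fun hκσ => hκ ?_)⟩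
        rw [hm, F.coord_gen hσ hκσ, Pi.single_eq_of_ne hκρ.symm]
    obtain ⟨s, rfl⟩ := hτ.exists_sec
    obtain ⟨T, -⟩ := s.exists_triv hτu
    refine ⟨T, 0, fun x => ?_⟩
    rw [map_zero, ((Q.u ρ).pullback i).val_eq_zero h0, mul_zero]
  · obtain ⟨T, hT⟩ := ((Q.u ρ).pullback i).exists_triv (hu ρ h0)
    exact ⟨T, 1, fun x => by rw [hT, map_one]⟩

theorem HasClass.eq_zero_iff {Q : ToricQuasimap F k} {i : C' ⟶ Q.C} [IsClosedImmersion i]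
    (hi : Set.range i ∈ irreducibleComponents Q.C) {β : F.H2} (hβ : Q.HasClass i β) :
    β = 0 ↔ ∀ ρ, IsConstant (i ≫ Q.π) ((Q.u ρ).pullback i) := by
  have := Q.proper
  constructor
  · rintro rfl
    exact Q.isConstant_of_degree_eq_zero i hi fun ρ => (hβ ρ).symm
  · intro h
    refine F.H2_ext fun ρ => ?_
    obtain ⟨T, -⟩ := h ρ
    rw [hβ]
    exact LineBundle.degree_eq_zero (i ≫ Q.π) (Q.atMostOneDim.of_isClosedImmersion i) T.isSec_one
      T.isUnit_one

end ToricQuasimap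

end

end ToricQM

theorem mainTheorem7 {n : ℕ} {ι : Type} [Fintype ι] [DecidableEq ι] (F : ToricQM.Fan n ι)
    (hF : F.IsProjective) (k : ℕ) (Q : ToricQM.ToricQuasimap F k) :
    (∀ (C' : Scheme.{0}) (i : C' ⟶ Q.C) [IsIntegral C'] [IsLocallyNoetherian C']
        [IsClosedImmersion i], Set.range i ∈ irreducibleComponents Q.C →
      (∃! β : F.H2, Q.HasClass i β) ∧
      ∀ β : F.H2, Q.HasClass i β →
        F.IsEffective β ∧
        (∀ α : ι → ℤ, F.IsAmple α →
          0 ≤ β (F.lineClass α) ∧ (β (F.lineClass α) = 0 ↔ β = 0)) ∧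
        (β = 0 ↔ ∀ ρ, ToricQM.IsConstant (i ≫ Q.π) ((Q.u ρ).pullback i))) ∧
    (∀ α α' : ι → ℤ, F.IsAmple α → F.IsAmple α' → (Q.IsStable α ↔ Q.IsStable α')) := by
  refine ⟨fun C' i _ _ _ hi => ⟨Q.existsUnique_hasClass i, fun β hβ => ?_⟩, fun α α' hα hα' =>
    ⟨fun h => h.of_isAmple hα hα', fun h => h.of_isAmple hα' hα⟩⟩
  obtain ⟨σ, hσ, h0⟩ := hβ.exists_nonneg hi
  exact ⟨F.isEffective_of_nonneg hF hσ β h0, fun α hα => F.ample_nonneg hα hσ β h0,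
    hβ.eq_zero_iff hi⟩
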